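/- **Definitions.** The Cayley distance $d(\rho,\pi)$ of $\rho,\pi\in S_n$ is the least number of transpositions $\tau_i$ with $\rho\tau_1\cdots\tau_k=\pi$, and $d(H,\pi)=\min_{\eta\in H}d(\eta,\pi)$ for a subgroup $H\le S_n$. Involutions with disjoint support (an IDS) are permutations $\gamma_j=(x_j^{(1)}\,y_j^{(1)})\cdots(x_j^{(r_j)}\,y_j^{(r_j)})$ with $r_j\ge 1$, where the points $x_j^{(i)},y_j^{(i)}$ (over all $i$ and $j$) are all distinct; the width is $\max_j r_j$. *IDS$w$–Subgroup–Distance.* Instance: $n\ge 1$, $\pi\in S_n$, a list $\gamma_1,\dots,\gamma_t$ in $S_n$ that is an IDS of width at most $w$, and an integer $K$. Solutions: the elements $\eta\in H=\langle\gamma_1,\dots,\gamma_t\rangle$ with $d(\eta,\pi)\le K$. A switching circuit is a finite directed graph (loops and multiple edges allowed) in which every vertex $v$ has the same number $\partial(v)$ of incoming and of outgoing edges, with a labelling by $1,\dots,\partial(v)$ of the incoming and of the outgoing edges of each vertex $v$. A polarisation $T$ is an equivalence relation on the vertices such that equivalent vertices have the same valency $\partial$; its width is the maximum size of a class. A routing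 $\rho$ is a choice of $\rho(v)\in S_{\partial(v)}$ for each vertex $v$; it joins the incoming edge of $v$ labelled $i$ to the outgoing edge of $v$ labelled $\rho(v)(i)$ and so decomposes the edge set into directed cycles, the cycles of $\rho$. It respects $T$ if $\rho(x)=\rho(y)$ for equivalent $x,y$. *Width$w$–Valency$2$–Maximal–Routing.* Instance: a switching circuit $G$ with all valencies at most $2$, a polarisation $T$ of width at most $w$, and a positive integer $K$. Solutions: the routings that respect $T$ and have at least $K$ cycles. **Theorem.** Let $w\ge 1$. There are maps $f$, from the instances of Width$w$–Valency$2$–Maximal–Routing to those of IDS$w$–Subgroup–Distance, and $g$, in the opposite direction, that are computable in polynomial time (by a Turing machine, in the length of the encoded instance) and parsimonious (an instance and its image have equally many solutions; in particular one has a solution if and only if the other has). Moreover, for every routing instance with at least one edge and its image under $f$, and for every IDS instance and its image under $g$, the following holds, where $(G,T)$ is the polarised switching circuit, $\pi\in S_n$ the permutation and $H$ the subgroup generated by the IDS of the two instances concerned. There is a bijection between the routings $\rho$ of $G$ that respect $T$ and the permutations $\pi\eta$, $\eta\in H$, in which $\rho$ and $\pi\eta$ have the same number of cycles (fixed points counted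 as cycles). Consequently, for every integer $d$, $d(H,\pi)\le d$ if and only if some routing of $G$ that respects $T$ has at least $n-d$ cycles. -/

import Mathlib

/-! ### Search problems and polynomial-time parsimonious transformations -/

/-- A search problem: instances, encoded without ambiguity as words over the alphabet
`{0, 1, separator}` (`some false`, `some true`, `none`), and the solutions of each instance.
The associated decision problem asks whether an instance has a solution. -/
structure SearchProblem where
  Instance : Type
  encode : Instance → List (Option Bool)
  encode_injective : Function.Injective encode
  Solution : Instance → Type

/-- `f` is a parsimonious transformation from `A` to `B` computable in polynomial time: a
(multi-stack) Turing machine computes `f` in a number of steps that is polynomial in the length of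
the encoded instance, and every instance of `A` has as many solutions as its image. -/
def IsPolyTimeParsimonious (A B : SearchProblem) (f : A.Instance → B.Instance) : Prop :=
  Nonempty (Turing.TM2ComputableInPolyTime A.encode B.encode f) ∧
    ∀ I : A.Instance, Nonempty (A.Solution I ≃ B.Solution (f I))

/-! ### Words for numbers

Indices of points, vertices, edges and labels are written in unary (each of them is at most the
number of objects that an instance lists, so this changes the length of an instance only
polynomially); the threshold of an instance, which may be arbitrarily large, is written in
binary. -/

def encodeIndex (k : ℕ) : List (Option Bool) := List.replicate k (some true) ++ [none]

def encodeIndices (l : List ℕ) : List (Option Bool) := l.flatMap encodeIndex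

/-- Binary digits, least significant digit first, and a separator. -/
def encodeBinary (k : ℕ) : List (Option Bool) :=
  (Computability.encodeNat k).map some ++ [none]

/-- A sign and the binary digits of the absolute value. -/
def encodeSigned (k : ℤ) : List (Option Bool) :=
  some (decide (k < 0)) :: encodeBinary k.natAbs

theorem encodeIndex_append_inj {a b : ℕ} {s t : List (Option Bool)}
    (h : encodeIndex a ++ s = encodeIndex b ++ t) : a = b ∧ s = t := by
  induction a generalizing b with
  | zero => cases b <;> simp_all [encodeIndex, List.replicate_succ]
  | succ a ih =>
    cases b with
    | zero => simp [encodeIndex, List.replicate_succ] at h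
    | succ b =>
      have h2 : encodeIndex a ++ s = encodeIndex b ++ t := by
        simpa [encodeIndex, List.replicate_succ] using h
      exact ⟨congrArg _ (ih h2).1, (ih h2).2⟩

theorem encodeIndices_append_inj {l m : List ℕ} (hlm : l.length = m.length)
    {s t : List (Option Bool)} (h : encodeIndices l ++ s = encodeIndices m ++ t) :
    l = m ∧ s = t := by
  induction l generalizing m with
  | nil => cases m <;> simp_all [encodeIndices]
  | cons a l ih =>
    cases m with
    | nil => simp at hlm
    | cons b m =>
      have h1 : encodeIndex a ++ (encodeIndices l ++ s)
          = encodeIndex b ++ (encodeIndices m ++ t) := by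
        simpa [encodeIndices] using h
      obtain ⟨h2, h3⟩ := encodeIndex_append_inj h1
      obtain ⟨h4, h5⟩ := ih (by simpa using hlm) h3
      exact ⟨by rw [h2, h4], h5⟩

theorem encodeBinary_injective : Function.Injective encodeBinary := by
  intro a b h
  have h1 : Computability.encodeNat a = Computability.encodeNat b := by
    apply List.map_injective_iff.2 (Option.some_injective Bool)
    exact List.append_cancel_right h
  rw [← Computability.decode_encodeNat a, h1, Computability.decode_encodeNat]

theorem encodeSigned_injective : Function.Injective encodeSigned := by
  intro a b h
  simp only [encodeSigned, List.cons.injEq, Option.some.injEq, decide_eq_decide] at h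
  have h2 := encodeBinary_injective h.2
  have h1 := h.1
  omega

/-! ### Cycles, Cayley distance and distance from a subgroup -/

/-- The number of cycles of a permutation, fixed points included. -/
noncomputable def numCycles {α : Type*} (σ : Equiv.Perm α) : ℕ :=
  Nat.card (Quotient (Equiv.Perm.SameCycle.setoid σ))

/-- The least number of transpositions that change `ρ` to `π` by post-multiplication. -/
noncomputable def cayleyDist {α : Type*} [DecidableEq α] (ρ π : Equiv.Perm α) : ℕ :=
  sInf {k | ∃ τ : List (Equiv.Perm α),
    (∀ t ∈ τ, t.IsSwap) ∧ τ.length = k ∧ ρ * τ.prod = π}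

/-- The distance of `π` from the subgroup `H`. -/
noncomputable def subgroupDist {α : Type*} [DecidableEq α] (H : Subgroup (Equiv.Perm α))
    (π : Equiv.Perm α) : ℕ :=
  sInf ((fun η => cayleyDist η π) '' (H : Set (Equiv.Perm α)))

/-- Involutions with disjoint support: `γ_j = (x_j^1 y_j^1) ⋯ (x_j^r y_j^r)` with `r = r_j ≥ 1`,
where all the points `x_j^i`, `y_j^i` (over all `i` and `j`) are distinct. -/
def IsIDS {α : Type*} [DecidableEq α] (γ : List (Equiv.Perm α)) : Prop :=
  ∃ c : List (List (α × α)),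
    γ = c.map (fun r => (r.map fun p => Equiv.swap p.1 p.2).prod) ∧
    (∀ r ∈ c, r ≠ []) ∧
    (c.flatten.flatMap fun p => [p.1, p.2]).Nodup

/-- The maximum number of 2-cycles in the members of the list. -/
def idsWidth {α : Type*} [Fintype α] [DecidableEq α] (γ : List (Equiv.Perm α)) : ℕ :=
  (γ.map fun g => g.cycleType.count 2).foldr max 0

/-! ### Subgroup distance problems -/

/-- A degree `n ≥ 1`, an element of `S_n`, a list of generators and an integer threshold. -/
structure SubgroupDistanceInstance where
  n : ℕ
  n_pos : 0 < n
  π : Equiv.Perm (Fin n)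
  gens : List (Equiv.Perm (Fin n))
  K : ℤ

namespace SubgroupDistanceInstance

/-- The subgroup generated by the list. -/
def H (J : SubgroupDistanceInstance) : Subgroup (Equiv.Perm (Fin J.n)) :=
  Subgroup.closure {g | g ∈ J.gens}

/-- One-line notation of a permutation. -/
def oneLine {n : ℕ} (σ : Equiv.Perm (Fin n)) : List ℕ :=
  (List.finRange n).map fun i => (σ i : ℕ)

def encode (J : SubgroupDistanceInstance) : List (Option Bool) :=
  encodeIndex J.n ++ (encodeIndices (oneLine J.π) ++ (encodeIndex J.gens.length ++
    (encodeIndices (J.gens.flatMap oneLine) ++ encodeSigned J.K)))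

theorem oneLine_injective {n : ℕ} : Function.Injective (oneLine (n := n)) := by
  intro σ τ h
  ext i
  exact List.map_inj_left.1 h i (List.mem_finRange i)

theorem length_oneLine {n : ℕ} (σ : Equiv.Perm (Fin n)) : (oneLine σ).length = n := by
  simp [oneLine]

theorem flatMap_oneLine_inj {n : ℕ} {l m : List (Equiv.Perm (Fin n))}
    (hlm : l.length = m.length) (h : l.flatMap oneLine = m.flatMap oneLine) : l = m := by
  induction l generalizing m with
  | nil => cases m <;> simp_all
  | cons a l ih =>
    cases m with
    | nil => simp at hlm
    | cons b m =>
      simp only [List.flatMap_cons] at h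
      obtain ⟨h1, h2⟩ := List.append_inj h (by simp [length_oneLine])
      rw [oneLine_injective h1, ih (by simpa using hlm) h2]

theorem encode_injective : Function.Injective encode := by
  rintro ⟨n, hn, π, γ, K⟩ ⟨n', hn', π', γ', K'⟩ h
  simp only [encode] at h
  obtain ⟨h1, h⟩ := encodeIndex_append_inj h
  subst h1
  obtain ⟨h2, k⟩ := encodeIndices_append_inj (by simp [length_oneLine]) h
  obtain rfl := oneLine_injective h2
  obtain ⟨h3, l⟩ := encodeIndex_append_inj k
  obtain ⟨h4, m⟩ := encodeIndices_append_inj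
    (by simp [List.length_flatMap, length_oneLine, h3]) l
  obtain rfl := flatMap_oneLine_inj h3 h4
  obtain rfl := encodeSigned_injective m
  rfl

end SubgroupDistanceInstance

/-- Subgroup distance: find `η` in the subgroup with `d(η, π) ≤ K`. -/
def subgroupDistance : SearchProblem where
  Instance := SubgroupDistanceInstance
  encode := SubgroupDistanceInstance.encode
  encode_injective := SubgroupDistanceInstance.encode_injective
  Solution J := {η : Equiv.Perm (Fin J.n) // η ∈ J.H ∧ (cayleyDist η J.π : ℤ) ≤ J.K}

/-- Subgroup distance, with the list of generators restricted to be involutions with disjoint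
support of width at most `w`. -/
def idsSubgroupDistance (w : ℕ) : SearchProblem where
  Instance := {J : SubgroupDistanceInstance // IsIDS J.gens ∧ idsWidth J.gens ≤ w}
  encode J := subgroupDistance.encode J.1
  encode_injective := subgroupDistance.encode_injective.comp Subtype.val_injective
  Solution J := subgroupDistance.Solution J.1

/-! ### Switching circuits, routings and polarisations -/

/-- A directed graph (loops and multiple edges allowed) in which every vertex `v` has as many edges
out of it as into it, namely `valency v`, with a labelling of either set of edges. -/
structure SwitchingCircuit (V E : Type*) where
  src : E → V
  tgt : E → V
  valency : V → ℕ
  outLabel : ∀ v, {e : E // src e = v} ≃ Fin (valency v)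
  inLabel : ∀ v, {e : E // tgt e = v} ≃ Fin (valency v)

namespace SwitchingCircuit

variable {V E : Type*} (G : SwitchingCircuit V E)

/-- A permutation of the labels at each vertex. -/
abbrev Routing : Type _ := ∀ v, Equiv.Perm (Fin (G.valency v))

/-- The permutation of the edges defined by a routing: an edge into `v` with label `i` is followed
by the edge out of `v` with label `ρ v i`. Its cycles are the directed cycles into which the
routing decomposes the edge set. -/
def next (ρ : G.Routing) : Equiv.Perm E :=
  (Equiv.sigmaFiberEquiv G.tgt).symm.trans
    ((Equiv.sigmaCongrRight fun v =>
      (G.inLabel v).trans ((ρ v).trans (G.outLabel v).symm)).trans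
    (Equiv.sigmaFiberEquiv G.src))

/-- An equivalence relation on the vertices such that equivalent vertices have the same valency. -/
structure Polarisation extends Setoid V where
  valency_eq : ∀ {x y : V}, r x y → G.valency x = G.valency y

variable {G}

/-- A routing respects `T` if it has the same permutation at equivalent vertices. -/
def Polarisation.Respects (T : G.Polarisation) (ρ : G.Routing) : Prop :=
  ∀ (x y : V) (h : T.r x y) (i : Fin (G.valency x)),
    ρ y (Fin.cast (T.valency_eq h) i) = Fin.cast (T.valency_eq h) (ρ x i)

/-- The maximum number of vertices in an equivalence class. -/
noncomputable def Polarisation.width [Fintype V] (T : G.Polarisation) : ℕ :=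
  Finset.univ.sup fun x : V => Nat.card {y : V // T.r x y}

end SwitchingCircuit

/-! ### Maximal routing problems -/

/-- A polarised switching circuit on the vertices `0, …, numV - 1` with the edges
`0, …, numE - 1`, and a positive threshold. -/
structure RoutingInstance where
  numV : ℕ
  numE : ℕ
  G : SwitchingCircuit (Fin numV) (Fin numE)
  T : G.Polarisation
  K : ℕ
  K_pos : 0 < K

namespace RoutingInstance

/-- The source, the label at the source, the target and the label at the target of each edge. -/
def edgeData {m n : ℕ} (G : SwitchingCircuit (Fin m) (Fin n)) (e : Fin n) : List ℕ :=
  [(G.src e : ℕ), (G.outLabel (G.src e) ⟨e, rfl⟩ : ℕ),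
    (G.tgt e : ℕ), (G.inLabel (G.tgt e) ⟨e, rfl⟩ : ℕ)]

open Classical in
/-- The matrix of the equivalence relation, row by row. -/
noncomputable def relMatrix {m : ℕ} (r : Fin m → Fin m → Prop) : List (Option Bool) :=
  (List.finRange m).flatMap fun x => (List.finRange m).map fun y => some (decide (r x y))

noncomputable def encode (I : RoutingInstance) : List (Option Bool) :=
  encodeIndex I.numV ++ (encodeIndex I.numE ++
    (encodeIndices ((List.finRange I.numE).flatMap (edgeData I.G)) ++
      (relMatrix I.T.r ++ encodeBinary I.K)))

theorem flatMap_inj_of_length {ι β : Type*} (k : ℕ) (f g : ι → List β)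
    (hf : ∀ i, (f i).length = k) (hg : ∀ i, (g i).length = k) (l : List ι)
    (h : l.flatMap f = l.flatMap g) : ∀ i ∈ l, f i = g i := by
  induction l with
  | nil => simp
  | cons a l ih =>
    simp only [List.flatMap_cons] at h
    obtain ⟨h1, h2⟩ := List.append_inj h (by rw [hf, hg])
    intro i hi
    rcases List.mem_cons.1 hi with rfl | hi
    · exact h1
    · exact ih h2 i hi

theorem relMatrix_injective {m : ℕ} {r s : Fin m → Fin m → Prop}
    (h : relMatrix r = relMatrix s) : r = s := by
  funext x y
  have h1 := flatMap_inj_of_length m _ _ (by simp) (by simp) _ h x (List.mem_finRange x)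
  have h2 := List.map_inj_left.1 h1 y (List.mem_finRange y)
  simpa using h2

theorem circuit_ext {m n : ℕ} {G G' : SwitchingCircuit (Fin m) (Fin n)}
    (h : ∀ e, edgeData G e = edgeData G' e) : G = G' := by
  obtain ⟨s, t, v, o, i⟩ := G
  obtain ⟨s', t', v', o', i'⟩ := G'
  simp only [edgeData, List.cons.injEq, and_true] at h
  obtain rfl : s = s' := funext fun e => Fin.ext (h e).1
  obtain rfl : t = t' := funext fun e => Fin.ext (h e).2.2.1
  obtain rfl : v = v' := funext fun x => by
    simpa using Fintype.card_congr ((o x).symm.trans (o' x))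
  obtain rfl : o = o' := by
    funext x
    ext ⟨e, rfl⟩
    exact (h e).2.1
  obtain rfl : i = i' := by
    funext x
    ext ⟨e, rfl⟩
    exact (h e).2.2.2
  rfl

theorem encode_injective : Function.Injective encode := by
  rintro ⟨m, n, G, T, K, hK⟩ ⟨m', n', G', T', K', hK'⟩ h
  simp only [encode] at h
  obtain ⟨h1, h⟩ := encodeIndex_append_inj h
  subst h1
  obtain ⟨h2, h⟩ := encodeIndex_append_inj h
  subst h2
  obtain ⟨h3, h⟩ := encodeIndices_append_inj (by simp [List.length_flatMap, edgeData]) h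
  have h3 := circuit_ext fun e => flatMap_inj_of_length 4 _ _ (by simp [edgeData])
    (by simp [edgeData]) _ h3 e (List.mem_finRange e)
  subst h3
  obtain ⟨h4, h⟩ := List.append_inj h (by simp [relMatrix, List.length_flatMap])
  have h5 := encodeBinary_injective h
  subst h5
  have h4 := relMatrix_injective h4
  obtain ⟨⟨r, hr⟩, hT⟩ := T
  obtain ⟨⟨r', hr'⟩, hT'⟩ := T'
  change r = r' at h4
  subst h4
  rfl

end RoutingInstance

/-- Maximal routing of polarised switching circuits: find a routing which respects the polarisation
and has at least `K` cycles. -/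
noncomputable def polarisedMaximalRouting : SearchProblem where
  Instance := RoutingInstance
  encode := RoutingInstance.encode
  encode_injective := RoutingInstance.encode_injective
  Solution I := {ρ : I.G.Routing // I.T.Respects ρ ∧ I.K ≤ numCycles (I.G.next ρ)}

/-- Maximal routing restricted to polarisations of width at most `w` and valencies at most `v`. -/
noncomputable def maximalRouting (w v : ℕ) : SearchProblem where
  Instance := {I : RoutingInstance // I.T.width ≤ w ∧ ∀ x, I.G.valency x ≤ v}
  encode I := polarisedMaximalRouting.encode I.1
  encode_injective := polarisedMaximalRouting.encode_injective.comp Subtype.val_injective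
  Solution I := polarisedMaximalRouting.Solution I.1

/-- The polarised switching circuit of `I` matches the permutation and the subgroup of `J`: there
is a bijection between the routings `ρ` which respect the polarisation and the elements `η` of the
subgroup `H` (that is, the permutations `π η`), such that `ρ` and `π η` have the same number of
cycles; and, for every integer `d`, the distance of `π` from `H` is at most `d` if and only if some
routing which respects the polarisation has at least `n - d` cycles. -/
def RoutingInstance.Matches (I : RoutingInstance) (J : SubgroupDistanceInstance) : Prop :=
  (∃ φ : {ρ : I.G.Routing // I.T.Respects ρ} ≃ J.H,
    ∀ ρ, numCycles (I.G.next ρ.1) = numCycles (J.π * (φ ρ : Equiv.Perm (Fin J.n)))) ∧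
  ∀ d : ℤ, (subgroupDist J.H J.π : ℤ) ≤ d ↔
    ∃ ρ : I.G.Routing, I.T.Respects ρ ∧ (J.n : ℤ) - d ≤ (numCycles (I.G.next ρ) : ℤ)

/-!
The combinatorial content is a dictionary between the two problems. Let `π` be the permutation of
the edges given by the identity routing of a switching circuit. Any routing `ρ` gives the
permutation `π η`, where `η` permutes the labels of the incoming edges at each vertex
(`SwitchingCircuit.next_eq_mul`), and `ρ ↦ η` is an injective homomorphism. If all valencies are at
most two, the routings that respect a polarisation form an elementary abelian group, generated by
the flips of the classes of valency two (`Polarisation.respecting_eq_closure`); a flip becomes an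
involution which exchanges the two edges into each vertex of the class, and the involutions of
different classes have disjoint support. Conversely, a list of involutions with disjoint support
comes from the circuit whose vertices are the orbits of their product and whose edges are the
points, with two orbits equivalent if they are moved by the same involution
(`SwitchingCircuit.edgePerm_flip_ofInvolutions`).

The Cayley distance of two permutations of `n` points is `n` minus the number of cycles of their
quotient (`cayleyDist_add_numCycles`), because multiplication by a transposition decreases the
number of cycles by at most one, and a suitable transposition increases it. As every element
`η` of the subgroup satisfies `η² = 1`, the distance of `η` from `π` is
`n` minus the number of cycles of `π η`. So distance at most `K` means at least `n - K` cycles, which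
gives both the bijection of solutions and the statement on `d(H, π)`. The thresholds need care at
the boundary: a circuit without edges has no routing with a positive number of cycles, and is sent
to an instance with a negative threshold; in the other direction `n - K` is replaced by `1` if it is
not positive, which is harmless as each permutation of a nonempty set has a cycle.

For the running times, a small language of stack programs with a big-step cost semantics is compiled
to multi-stack Turing machines (`StackProg.nonempty_computableInPolyTime`). On top of it there are
terms, which denote numbers computed from the input word by bounded sums, tests and lookups, and
generators, which denote output words; both compile to stack programs that run in polynomial time
whatever the term or generator is (`Term.exists_exec_compile`, `Gen.exists_exec_compile`). The unary
parts of both transformations can be written as generators: the `j`-th field of the input is found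
by counting separators, and sums over an index with a unique solution invert permutations and look up
edges. Only the threshold is binary; it is counted down or up by a number of steps bounded by the
length of the input (`StackProg.exists_exec_signedDiffProg`, `StackProg.exists_exec_sumOrDiffProg`).
-/

/-! ### Structured stack programs and their compilation to Turing machines -/

/-- The alphabet `{0, 1, separator}`, which is used on all stacks. -/
abbrev Symb : Type := Option Bool

/-- Programs that act on stacks numbered by `ℕ`. Stack `0` holds the input at the beginning and the
output at the end. Tests look at the top of a stack, which is `none` if the stack is empty. -/
inductive StackProg : Type
  | skip : StackProg
  | push (k : ℕ) (a : Symb) : StackProg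
  | pop (k : ℕ) : StackProg
  | seq (p q : StackProg) : StackProg
  | cases (k : ℕ) (f : Option Symb → StackProg) : StackProg
  | whileTop (k : ℕ) (b : Option Symb → Bool) (p : StackProg) : StackProg

namespace StackProg

scoped infixr:60 " ;; " => StackProg.seq

/-- The contents of all stacks. -/
abbrev Stacks : Type := ℕ → List Symb

/-- Big-step semantics: `Exec p s s' n` says that the program `p`, started on the stacks `s`,
terminates with the stacks `s'` after at most `n` steps. -/
inductive Exec : StackProg → Stacks → Stacks → ℕ → Prop
  | skip (s : Stacks) : Exec skip s s 1
  | push (k : ℕ) (a : Symb) (s : Stacks) : Exec (push k a) s (Function.update s k (a :: s k)) 1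
  | pop (k : ℕ) (s : Stacks) : Exec (pop k) s (Function.update s k (s k).tail) 1
  | seq {p q : StackProg} {s s₁ s₂ : Stacks} {m n : ℕ} :
      Exec p s s₁ m → Exec q s₁ s₂ n → Exec (seq p q) s s₂ (m + n)
  | cases {k : ℕ} {f : Option Symb → StackProg} {s s' : Stacks} {n : ℕ} :
      Exec (f (s k).head?) s s' n → Exec (cases k f) s s' (n + 1)
  | while_false {k : ℕ} {b : Option Symb → Bool} {p : StackProg} {s : Stacks} :
      b (s k).head? = false → Exec (whileTop k b p) s s 1
  | while_true {k : ℕ} {b : Option Symb → Bool} {p : StackProg} {s s₁ s₂ : Stacks} {m n : ℕ} :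
      b (s k).head? = true → Exec p s s₁ m → Exec (whileTop k b p) s₁ s₂ n →
      Exec (whileTop k b p) s s₂ (m + n + 1)
  | mono {p : StackProg} {s s' : Stacks} {m n : ℕ} : Exec p s s' m → m ≤ n → Exec p s s' n

/-- All stacks that occur in the program have a number less than `M`. -/
def Below (M : ℕ) : StackProg → Prop
  | skip => True
  | push k _ => k < M
  | pop k => k < M
  | seq p q => p.Below M ∧ q.Below M
  | cases k f => k < M ∧ ∀ a, (f a).Below M
  | whileTop k _ p => k < M ∧ p.Below M

theorem Below.mono {M M' : ℕ} (h : M ≤ M') : ∀ {p : StackProg}, p.Below M → p.Below M'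
  | skip, _ => trivial
  | push _ _, hp => lt_of_lt_of_le hp h
  | pop _, hp => lt_of_lt_of_le hp h
  | seq _ _, hp => ⟨hp.1.mono h, hp.2.mono h⟩
  | cases _ _, hp => ⟨lt_of_lt_of_le hp.1 h, fun a => (hp.2 a).mono h⟩
  | whileTop _ _ _, hp => ⟨lt_of_lt_of_le hp.1 h, hp.2.mono h⟩

theorem exists_below (p : StackProg) : ∃ M, p.Below M := by
  induction p with
  | skip => exact ⟨0, trivial⟩
  | push k a => exact ⟨k + 1, Nat.lt_succ_self k⟩
  | pop k => exact ⟨k + 1, Nat.lt_succ_self k⟩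
  | seq p q hp hq =>
    obtain ⟨M, hM⟩ := hp
    obtain ⟨M', hM'⟩ := hq
    exact ⟨max M M', hM.mono (le_max_left _ _), hM'.mono (le_max_right _ _)⟩
  | cases k f hf =>
    choose M hM using hf
    refine ⟨max (k + 1) (Finset.univ.sup M), lt_of_lt_of_le (Nat.lt_succ_self k)
      (le_max_left _ _), fun a => (hM a).mono ?_⟩
    exact (Finset.le_sup (f := M) (Finset.mem_univ a)).trans (le_max_right _ _)
  | whileTop k b p hp =>
    obtain ⟨M, hM⟩ := hp
    exact ⟨max (k + 1) M, lt_of_lt_of_le (Nat.lt_succ_self k) (le_max_left _ _),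
      hM.mono (le_max_right _ _)⟩

/-- The labels (program points) of the machine that runs a program. -/
def Label : StackProg → Type
  | skip => Unit
  | push _ _ => Unit
  | pop _ => Unit
  | seq p q => p.Label ⊕ q.Label
  | cases _ f => Option (Σ a, (f a).Label)
  | whileTop _ _ p => Option p.Label

noncomputable instance fintypeLabel : ∀ p : StackProg, Fintype p.Label
  | skip => inferInstanceAs (Fintype Unit)
  | push _ _ => inferInstanceAs (Fintype Unit)
  | pop _ => inferInstanceAs (Fintype Unit)
  | seq p q =>
    letI := fintypeLabel p
    letI := fintypeLabel q
    inferInstanceAs (Fintype (p.Label ⊕ q.Label))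
  | cases _ f =>
    letI := fun a => fintypeLabel (f a)
    inferInstanceAs (Fintype (Option (Σ a, (f a).Label)))
  | whileTop _ _ p =>
    letI := fintypeLabel p
    inferInstanceAs (Fintype (Option p.Label))

/-- The label at which the execution of a program begins. -/
def start : ∀ p : StackProg, p.Label
  | skip => ()
  | push _ _ => ()
  | pop _ => ()
  | seq p _ => Sum.inl p.start
  | cases _ _ => (none : Option _)
  | whileTop _ _ _ => (none : Option _)

/-- The statements of the machine that runs a program, as part of a larger machine with the labels
`Λ` which continues at the label `exit`. The internal state of the machine is the last symbol
inspected. -/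
def code {M : ℕ} [NeZero M] {Λ : Type} : ∀ p : StackProg, (p.Label → Λ) → Λ → p.Label →
    Turing.TM2.Stmt (fun _ : Fin M => Symb) Λ (Option Symb)
  | skip, _, exit, _ => .goto fun _ => exit
  | push k a, _, exit, _ => .push (Fin.ofNat M k) (fun _ => a) (.goto fun _ => exit)
  | pop k, _, exit, _ => .pop (Fin.ofNat M k) (fun v _ => v) (.goto fun _ => exit)
  | seq p q, emb, exit, l =>
    Sum.casesOn (motive := fun _ => Turing.TM2.Stmt (fun _ : Fin M => Symb) Λ (Option Symb)) l
      (fun l => p.code (fun x => emb (Sum.inl x)) (emb (Sum.inr q.start)) l)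
      (fun l => q.code (fun x => emb (Sum.inr x)) exit l)
  | cases k f, emb, exit, l =>
    Option.casesOn (motive := fun _ => Turing.TM2.Stmt (fun _ : Fin M => Symb) Λ (Option Symb)) l
      (.peek (Fin.ofNat M k) (fun _ a => a)
        (.goto fun a => emb (some (⟨a, (f a).start⟩ : Σ a, (f a).Label))))
      (fun x => (f x.1).code (fun y => emb (some (⟨x.1, y⟩ : Σ a, (f a).Label))) exit x.2)
  | whileTop k b p, emb, exit, l =>
    Option.casesOn (motive := fun _ => Turing.TM2.Stmt (fun _ : Fin M => Symb) Λ (Option Symb)) l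
      (.peek (Fin.ofNat M k) (fun _ a => a)
        (.goto fun a => bif b a then emb (some p.start) else exit))
      (fun x => p.code (fun y => emb (some y)) (emb none) x)

section Correctness

variable {M : ℕ} {Λ : Type}

/-- The machine gets from one configuration to another one in exactly `n` steps. -/
def Steps (m : Λ → Turing.TM2.Stmt (fun _ : Fin M => Symb) Λ (Option Symb)) (n : ℕ)
    (c c' : Turing.TM2.Cfg (fun _ : Fin M => Symb) Λ (Option Symb)) : Prop :=
  (flip bind (Turing.TM2.step m))^[n] (some c) = some c'

theorem Steps.trans {m : Λ → Turing.TM2.Stmt (fun _ : Fin M => Symb) Λ (Option Symb)} {n n' : ℕ}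
    {c c' c'' : Turing.TM2.Cfg (fun _ : Fin M => Symb) Λ (Option Symb)}
    (h : Steps m n c c') (h' : Steps m n' c' c'') : Steps m (n' + n) c c'' := by
  unfold Steps at *
  rw [Function.iterate_add_apply, h, h']

theorem Steps.single {m : Λ → Turing.TM2.Stmt (fun _ : Fin M => Symb) Λ (Option Symb)}
    {c c' : Turing.TM2.Cfg (fun _ : Fin M => Symb) Λ (Option Symb)}
    (h : Turing.TM2.step m c = some c') : Steps m 1 c c' := h

theorem Steps.of_eq {m : Λ → Turing.TM2.Stmt (fun _ : Fin M => Symb) Λ (Option Symb)} {l : Λ}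
    {q : Turing.TM2.Stmt (fun _ : Fin M => Symb) Λ (Option Symb)} {v : Option Symb}
    {S : ∀ _ : Fin M, List Symb} {c' : Turing.TM2.Cfg (fun _ : Fin M => Symb) Λ (Option Symb)}
    (h : m l = q) (h' : Turing.TM2.stepAux q v S = c') : Steps m 1 ⟨some l, v, S⟩ c' :=
  Steps.single (by rw [Turing.TM2.step, h, h'])

/-- The stacks of a machine with `M` stacks. -/
def restrict (M : ℕ) (s : Stacks) : ∀ _ : Fin M, List Symb := fun k => s k

variable [NeZero M]

theorem restrict_ofNat (s : Stacks) {k : ℕ} (hk : k < M) : restrict M s (Fin.ofNat M k) = s k := by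
  simp [restrict, Nat.mod_eq_of_lt hk]

theorem restrict_update (s : Stacks) {k : ℕ} (hk : k < M) (l : List Symb) :
    restrict M (Function.update s k l) = Function.update (restrict M s) (Fin.ofNat M k) l := by
  funext i
  simp only [restrict, Function.update_apply, Fin.ext_iff, Fin.val_ofNat, Nat.mod_eq_of_lt hk]

/-- The compiled program does what the big-step semantics says. -/
theorem Exec.steps {p : StackProg} {s s' : Stacks} {n : ℕ} (h : Exec p s s' n) :
    ∀ (m : Λ → Turing.TM2.Stmt (fun _ : Fin M => Symb) Λ (Option Symb))
      (emb : p.Label → Λ) (exit : Λ) (_ : ∀ l, m (emb l) = p.code emb exit l) (_ : p.Below M)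
      (v : Option Symb), ∃ (v' : Option Symb) (k : ℕ), k ≤ n ∧
        Steps m k ⟨some (emb p.start), v, restrict M s⟩ ⟨some exit, v', restrict M s'⟩ := by
  induction h with
  | skip s =>
    intro m emb exit hm hp v
    refine ⟨v, 1, le_rfl, Steps.of_eq (hm _) ?_⟩
    simp [code]
  | push k a s =>
    intro m emb exit hm hp v
    refine ⟨v, 1, le_rfl, Steps.of_eq (hm _) ?_⟩
    simp only [code, Turing.TM2.stepAux, restrict_update s hp, restrict_ofNat s hp]
  | pop k s =>
    intro m emb exit hm hp v
    refine ⟨v, 1, le_rfl, Steps.of_eq (hm _) ?_⟩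
    simp only [code, Turing.TM2.stepAux, restrict_update s hp, restrict_ofNat s hp]
  | @seq p q s s₁ s₂ a b _ _ ihp ihq =>
    intro m emb exit hm hp v
    obtain ⟨v₁, k₁, hk₁, h₁⟩ := ihp m (fun x => emb (Sum.inl x)) (emb (Sum.inr q.start))
      (fun l => hm (Sum.inl l)) hp.1 v
    obtain ⟨v₂, k₂, hk₂, h₂⟩ := ihq m (fun x => emb (Sum.inr x)) exit
      (fun l => hm (Sum.inr l)) hp.2 v₁
    exact ⟨v₂, k₂ + k₁, by omega, h₁.trans h₂⟩
  | @cases k f s s' n _ ih =>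
    intro m emb exit hm hp v
    obtain ⟨v₁, k₁, hk₁, h₁⟩ := ih m
      (fun y => emb (some (⟨(s k).head?, y⟩ : Σ a, (f a).Label))) exit
      (fun l => hm (some (⟨_, l⟩ : Σ a, (f a).Label))) (hp.2 _) (s k).head?
    refine ⟨v₁, k₁ + 1, by omega, Steps.trans (Steps.of_eq (hm _) ?_) h₁⟩
    simp only [start, code, Turing.TM2.stepAux]
    rw [restrict_ofNat s hp.1]
  | @while_false k b p s hb =>
    intro m emb exit hm hp v
    refine ⟨(s k).head?, 1, le_rfl, Steps.of_eq (hm _) ?_⟩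
    simp only [start, code, Turing.TM2.stepAux, restrict_ofNat s hp.1, hb, cond_false]
  | @while_true k b p s s₁ s₂ x y hb _ _ ih ih' =>
    intro m emb exit hm hp v
    obtain ⟨v₁, k₁, hk₁, h₁⟩ := ih m (fun y => emb (some y)) (emb none)
      (fun l => hm (some l)) hp.2 (s k).head?
    obtain ⟨v₂, k₂, hk₂, h₂⟩ := ih' m emb exit hm hp v₁
    refine ⟨v₂, k₂ + (k₁ + 1), by omega, Steps.trans (Steps.trans (Steps.of_eq (hm _) ?_) h₁) h₂⟩
    simp only [start, code, Turing.TM2.stepAux, restrict_ofNat s hp.1, hb, cond_true]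
  | mono _ hmn ih =>
    intro m emb exit hm hp v
    obtain ⟨v', k, hk, h'⟩ := ih m emb exit hm hp v
    exact ⟨v', k, hk.trans hmn, h'⟩

end Correctness

/-- The stacks with one word on stack `0`. -/
def word (u : List Symb) : Stacks := Function.update (fun _ => []) 0 u

/-- The Turing machine that runs a program and then halts. -/
noncomputable def machine (M : ℕ) [NeZero M] (p : StackProg) : Turing.FinTM2 where
  K := Fin M
  k₀ := Fin.ofNat M 0
  k₁ := Fin.ofNat M 0
  Γ _ := Symb
  Λ := Option p.Label
  main := some p.start
  σ := Option Symb
  initialState := none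
  Γk₀Fin := inferInstanceAs (Fintype Symb)
  m := fun l => Option.casesOn (motive := fun _ =>
    Turing.TM2.Stmt (fun _ : Fin M => Symb) (Option p.Label) (Option Symb)) l
      (.load (fun _ => none) .halt) (fun l => p.code some none l)

/-- A function between encoded types that is computed by a stack program in polynomial time is
computed by a Turing machine in polynomial time. -/
theorem nonempty_computableInPolyTime {α β : Type} {ea : α → List Symb} {eb : β → List Symb}
    {f : α → β} (p : StackProg) (P : Polynomial ℕ)
    (h : ∀ a, Exec p (word (ea a)) (word (eb (f a))) (P.eval (ea a).length)) :
    Nonempty (Turing.TM2ComputableInPolyTime ea eb f) := by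
  obtain ⟨M, hM⟩ := p.exists_below
  have hM' : p.Below (M + 1) := hM.mono (Nat.le_succ M)
  have hword : ∀ u : List Symb, restrict (M + 1) (word u) = fun k =>
      if k = Fin.ofNat (M + 1) 0 then u else [] := by
    intro u
    rw [word, restrict_update _ (Nat.succ_pos M)]
    funext k
    rw [Function.update_apply]
    rfl
  have key : ∀ a, ∃ k ≤ P.eval (ea a).length + 1, (flip bind (machine (M + 1) p).step)^[k]
      (some (Turing.initList (machine (M + 1) p) (ea a)))
        = some (Turing.haltList (machine (M + 1) p) (eb (f a))) := by
    intro a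
    obtain ⟨v', k, hk, hs⟩ := (h a).steps (M := M + 1) (Λ := Option p.Label)
      (machine (M + 1) p).m some none (fun _ => rfl) hM' none
    refine ⟨1 + k, by omega, ?_⟩
    have h2 : Steps (machine (M + 1) p).m 1
        ⟨some none, v', restrict (M + 1) (word (eb (f a)))⟩
        ⟨none, none, restrict (M + 1) (word (eb (f a)))⟩ := rfl
    have h3 := hs.trans h2
    rw [hword, hword] at h3
    have h4 : Turing.initList (machine (M + 1) p) (ea a) = ⟨some (some p.start), none,
        fun k : Fin (M + 1) => if k = Fin.ofNat (M + 1) 0 then ea a else []⟩ := by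
      simp only [Turing.initList]
      congr 1
    have h5 : Turing.haltList (machine (M + 1) p) (eb (f a)) = ⟨none, none,
        fun k : Fin (M + 1) => if k = Fin.ofNat (M + 1) 0 then eb (f a) else []⟩ := by
      simp only [Turing.haltList]
      congr 1
    rw [h4, h5]
    exact h3
  choose k hk hs using key
  exact ⟨{
    tm := machine (M + 1) p
    inputAlphabet := Equiv.refl _
    outputAlphabet := Equiv.refl _
    time := P + 1
    outputsFun := fun a =>
      { steps := k a
        evals_in_steps := by
          have hid : ∀ l : List Symb, List.map (Equiv.refl Symb).invFun l = l := fun l =>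
            List.map_id l
          erw [hid, hid]
          exact hs a
        steps_le_m := by simpa using hk a } }⟩

end StackProg

/-! ### Basic programs -/

namespace StackProg

open Function (update)

theorem Exec.conv {p : StackProg} {s s' s'' : Stacks} {m n : ℕ} (h : Exec p s s' m)
    (hs : s' = s'') (hn : m ≤ n) : Exec p s s'' n := hs ▸ h.mono hn

theorem Exec.seq' {p q : StackProg} {s s₁ s₁' s₂ : Stacks} {m n : ℕ} (h : Exec p s s₁ m)
    (h' : Exec q s₁' s₂ n) (hs : s₁ = s₁') : Exec (p ;; q) s s₂ (m + n) := h.seq (hs ▸ h')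

/-- The unary representation of a number on a stack. -/
def unary (n : ℕ) : List Symb := List.replicate n (some true)

@[simp] theorem unary_zero : unary 0 = [] := rfl

theorem unary_succ (n : ℕ) : unary (n + 1) = some true :: unary n := rfl

@[simp] theorem unary_tail (n : ℕ) : (unary n).tail = unary (n - 1) := by
  cases n <;> simp [unary_succ]

@[simp] theorem unary_length (n : ℕ) : (unary n).length = n := List.length_replicate

theorem unary_append (m n : ℕ) : unary m ++ unary n = unary (m + n) :=
  List.replicate_append_replicate

@[simp] theorem unary_reverse (n : ℕ) : (unary n).reverse = unary n := List.reverse_replicate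

@[simp] theorem unary_head?_isSome (n : ℕ) : (unary n).head?.isSome = decide (0 < n) := by
  cases n <;> simp [unary_succ]

/-- A loop whose body is executed `n` times, passing through the states `S 0, …, S n`. -/
theorem exec_while {k : ℕ} {b : Option Symb → Bool} {p : StackProg} {c : ℕ} (n : ℕ)
    (S : ℕ → Stacks) (hb : ∀ i < n, b (S i k).head? = true) (hn : b (S n k).head? = false)
    (hp : ∀ i < n, Exec p (S i) (S (i + 1)) c) :
    Exec (whileTop k b p) (S 0) (S n) (n * (c + 1) + 1) := by
  induction n generalizing S with
  | zero => exact (Exec.while_false hn).conv rfl (by omega)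
  | succ n ih =>
    have h := ih (fun i => S (i + 1)) (fun i hi => hb _ (by omega)) hn
      (fun i hi => hp _ (by omega))
    exact (Exec.while_true (hb 0 (by omega)) (hp 0 (by omega)) h).conv rfl
      (by rw [Nat.succ_mul]; omega)

/-- Empty a stack. -/
def clear (k : ℕ) : StackProg := whileTop k Option.isSome (pop k)

/-- Move the top symbol of stack `k`, if there is one, to stack `l`. -/
def moveTop (k l : ℕ) : StackProg :=
  cases k fun a => Option.rec skip (fun a => pop k ;; push l a) a

/-- Move all symbols of stack `k`, one by one, to stack `l`. -/
def moveAll (k l : ℕ) : StackProg := whileTop k Option.isSome (moveTop k l)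

/-- Add the number in stack `k` to stack `l`, with the help of the empty stack `f`. -/
def copyUnary (k l f : ℕ) : StackProg :=
  whileTop k Option.isSome (pop k ;; push f (some true) ;; push l (some true)) ;; moveAll f k

/-- Put the length of the input into the empty stack `f`, with the help of the empty
stack `1`. -/
def inputLength (f : ℕ) : StackProg :=
  moveAll 0 1 ;; whileTop 1 Option.isSome (moveTop 1 0 ;; push f (some true))

/-- Execute a program as often as the input has symbols. Stack `f` holds the number of the remaining
passes and stack `f + 1` the number of the passes that have been completed. -/
def forInput (f : ℕ) (p : StackProg) : StackProg :=
  inputLength f ;; whileTop f Option.isSome (pop f ;; p ;; push (f + 1) (some true)) ;;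
    clear (f + 1)

theorem exec_clear (k : ℕ) (s : Stacks) :
    Exec (clear k) s (update s k []) (2 * (s k).length + 1) := by
  have h := exec_while (k := k) (b := Option.isSome) (p := pop k) (c := 1) (s k).length
    (fun i => update s k ((s k).drop i)) (by simp +contextual) (by simp)
    (fun i _ => (Exec.pop k _).conv (by simp [List.tail_drop]) le_rfl)
  simp only [List.drop_zero, Function.update_eq_self, List.drop_length] at h
  exact h.conv rfl (by omega)

theorem exec_moveTop_nil {k l : ℕ} {s : Stacks} (h : s k = []) : Exec (moveTop k l) s s 2 :=
  Exec.cases (by rw [h]; exact Exec.skip s)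

theorem exec_moveTop_cons {k l : ℕ} {s : Stacks} {a : Symb} {t : List Symb} (h : s k = a :: t) :
    Exec (moveTop k l) s (update (update s k t) l (a :: update s k t l)) 3 := by
  refine Exec.cases (n := 2) ?_
  rw [h]
  refine (Exec.pop k s).seq (?_ : Exec _ _ _ 1)
  rw [h]
  exact Exec.push l a _

theorem exec_moveAll {k l : ℕ} (hkl : k ≠ l) (s : Stacks) :
    Exec (moveAll k l) s (update (update s k []) l ((s k).reverse ++ s l))
      (4 * (s k).length + 1) := by
  have h := exec_while (k := k) (b := Option.isSome) (p := moveTop k l) (c := 3) (s k).length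
    (fun i => update (update s k ((s k).drop i)) l (((s k).take i).reverse ++ s l))
    (fun i hi => by simpa [Function.update_of_ne hkl] using hi) (by simp [Function.update_of_ne hkl])
    (fun i hi => by
      have hd : (s k).drop i = (s k)[i] :: (s k).drop (i + 1) := List.drop_eq_getElem_cons hi
      refine (exec_moveTop_cons (a := (s k)[i]) (t := (s k).drop (i + 1)) ?_).conv ?_ le_rfl
      · rw [Function.update_of_ne hkl, Function.update_self, hd]
      · rw [List.take_succ_eq_append_getElem hi]
        funext x
        grind [Function.update_apply])
  simp only [List.drop_zero, Function.update_eq_self, List.drop_length, List.take_zero,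
    List.reverse_nil, List.nil_append, List.take_length] at h
  exact h.conv rfl (by omega)

theorem exec_copyUnary {k l f : ℕ} (hkl : k ≠ l) (hkf : k ≠ f) (hlf : l ≠ f) {s : Stacks} {n : ℕ}
    (hk : s k = unary n) (hf : s f = []) :
    Exec (copyUnary k l f) s (update s l (unary n ++ s l)) (8 * n + 2) := by
  have h := exec_while (k := k) (b := Option.isSome)
    (p := pop k ;; push f (some true) ;; push l (some true)) (c := 3) n
    (fun i => update (update (update s k (unary (n - i))) f (unary i)) l (unary i ++ s l))
    (fun i hi => by
      simp [Function.update_of_ne hkl, Function.update_of_ne hkf]; omega)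
    (by simp [Function.update_of_ne hkl, Function.update_of_ne hkf])
    (fun i hi => by
      refine ((Exec.pop k _).seq ((Exec.push f _ _).seq (Exec.push l _ _))).conv ?_ le_rfl
      funext x
      have h1 : n - i - 1 = n - (i + 1) := by omega
      grind [Function.update_apply, unary_succ, unary_tail])
  have h0 : update (update (update s k (unary (n - 0))) f (unary 0)) l (unary 0 ++ s l) = s := by
    funext x
    grind [Function.update_apply, unary_zero]
  rw [h0] at h
  refine (h.seq (exec_moveAll (Ne.symm hkf) _)).conv ?_ ?_
  · funext x
    grind [Function.update_apply, unary_zero, unary_reverse]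
  · simp [Function.update_of_ne (Ne.symm hlf)]
    omega

theorem exec_inputLength {f : ℕ} (hf2 : 2 ≤ f) {s : Stacks} (h1 : s 1 = []) (hf : s f = []) :
    Exec (inputLength f) s (update s f (unary (s 0).length)) (9 * (s 0).length + 2) := by
  have hm := exec_moveAll (k := 0) (l := 1) (by omega) s
  rw [h1, List.append_nil] at hm
  have h := exec_while (k := 1) (b := Option.isSome)
    (p := moveTop 1 0 ;; push f (some true)) (c := 4) (s 0).length
    (fun i => update (update (update s 0 (((s 0).reverse.take i).reverse)) 1
      ((s 0).reverse.drop i)) f (unary i))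
    (fun i hi => by
      have : (1 : ℕ) ≠ f := by omega
      simpa [Function.update_of_ne this] using hi)
    (by
      have : (1 : ℕ) ≠ f := by omega
      simp [Function.update_of_ne this])
    (fun i hi => by
      have hi' : i < (s 0).reverse.length := by simpa using hi
      have hd : (s 0).reverse.drop i = (s 0).reverse[i] :: (s 0).reverse.drop (i + 1) :=
        List.drop_eq_getElem_cons hi'
      have hne : (1 : ℕ) ≠ f := by omega
      refine ((exec_moveTop_cons (a := (s 0).reverse[i]) (t := (s 0).reverse.drop (i + 1)) ?_).seq
        (Exec.push f _ _)).conv ?_ le_rfl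
      · simp only [Function.update_of_ne hne, Function.update_self, hd]
      · rw [List.take_succ_eq_append_getElem hi']
        funext x
        grind [Function.update_apply, unary_succ])
  refine (hm.seq' h ?_).conv ?_ (by omega)
  · funext x
    grind [Function.update_apply, unary_zero]
  · funext x
    have h2 : ((s 0).reverse.take (s 0).length).reverse = s 0 := by
      rw [List.take_of_length_le (by simp), List.reverse_reverse]
    have h3 : (s 0).reverse.drop (s 0).length = [] :=
      List.drop_of_length_le (by simp)
    grind [Function.update_apply]

/-- The body of the loop takes `S i` to `S (i + 1)` while the two counters in the stacks `f` and
`f + 1` have any values. -/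
theorem exec_forInput {f : ℕ} {p : StackProg} {c : ℕ} (hf2 : 2 ≤ f) (N : ℕ) (S : ℕ → Stacks)
    (hN : (S 0 0).length = N) (h1 : S 0 1 = []) (hf : S 0 f = []) (hf1 : S 0 (f + 1) = [])
    (hSf : S N f = []) (hSf1 : S N (f + 1) = [])
    (hp : ∀ i < N, ∀ m, Exec p (update (update (S i) f (unary m)) (f + 1) (unary i))
      (update (update (S (i + 1)) f (unary m)) (f + 1) (unary i)) c) :
    Exec (forInput f p) (S 0) (S N) (N * (c + 14) + 4) := by
  have h := exec_while (k := f) (b := Option.isSome)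
    (p := pop f ;; p ;; push (f + 1) (some true)) (c := c + 2) N
    (fun i => update (update (S i) f (unary (N - i))) (f + 1) (unary i))
    (fun i hi => by simp; omega) (by simp)
    (fun i hi => by
      refine ((Exec.pop f _).seq' ((hp i hi (N - (i + 1))).seq (Exec.push (f + 1) _ _)) ?_).conv
        ?_ (by omega)
      · funext x
        have h1 : N - i - 1 = N - (i + 1) := by omega
        grind [Function.update_apply, unary_tail]
      · funext x
        grind [Function.update_apply, unary_succ])
  have hi := exec_inputLength hf2 h1 hf
  rw [hN] at hi
  have h0 : update (update (S 0) f (unary (N - 0))) (f + 1) (unary 0)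
      = update (S 0) f (unary N) := by
    funext x
    grind [Function.update_apply, unary_zero]
  rw [h0] at h
  refine (hi.seq (h.seq (exec_clear (f + 1) _))).conv ?_ ?_
  · funext x
    grind [Function.update_apply, unary_zero]
  · simp only [Function.update_self, unary_length]
    nlinarith

end StackProg

/-! ### Terms: bounded counting in the input word -/

open StackProg Function in
/-- Terms for natural numbers that depend on the input word `u`, of length `N`, and on variables
(de Bruijn indices): constants, sum, truncated difference, case distinction on whether a value is
zero, test whether the symbol of `u` at a position is a given one, sum of the values for all
`i < N`, and evaluation of a term in two variables. -/
inductive Term : Type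
  | var (i : ℕ) : Term
  | zero : Term
  | one : Term
  | add (a b : Term) : Term
  | sub (a b : Term) : Term
  | ite (c a b : Term) : Term
  | sym (x : Symb) (t : Term) : Term
  | sum (t : Term) : Term
  | call (t a b : Term) : Term

namespace Term

open StackProg
open Function (update)

/-- The value of a term. -/
def eval (u : List Symb) : Term → List ℕ → ℕ
  | var i, ρ => ρ.getD i 0
  | zero, _ => 0
  | one, _ => 1
  | add a b, ρ => a.eval u ρ + b.eval u ρ
  | sub a b, ρ => a.eval u ρ - b.eval u ρ
  | ite c a b, ρ => if c.eval u ρ = 0 then b.eval u ρ else a.eval u ρ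
  | sym x t, ρ => if u[t.eval u ρ]? = some x then 1 else 0
  | sum t, ρ => ∑ i ∈ Finset.range u.length, t.eval u (i :: ρ)
  | call t a b, ρ => t.eval u [a.eval u ρ, b.eval u ρ]

/-- A program that adds the value of a term to the stack `tgt`. The variables are in the stacks
`ctx`; the stacks from `f` on are empty and serve as a workspace. -/
def compile : Term → (ctx : List ℕ) → (tgt f : ℕ) → StackProg
  | var i, ctx, tgt, f => Option.rec skip (fun r => copyUnary r tgt f) ctx[i]?
  | zero, _, _, _ => skip
  | one, _, tgt, _ => push tgt (some true)
  | add a b, ctx, tgt, f => a.compile ctx tgt f ;; b.compile ctx tgt f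
  | sub a b, ctx, tgt, f => a.compile ctx f (f + 1) ;; b.compile ctx (f + 1) (f + 2) ;;
      whileTop (f + 1) Option.isSome (pop (f + 1) ;; pop f) ;; moveAll f tgt
  | ite c a b, ctx, tgt, f => c.compile ctx f (f + 1) ;;
      .cases f fun x => Option.rec (b.compile ctx tgt f)
        (fun _ => clear f ;; a.compile ctx tgt f) x
  | sym x t, ctx, tgt, f => t.compile ctx f (f + 1) ;;
      whileTop f Option.isSome (pop f ;; moveTop 0 1) ;;
      .cases 0 (fun y => if y = some x then push tgt (some true) else skip) ;; moveAll 1 0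
  | sum t, ctx, tgt, f => forInput f (t.compile ((f + 1) :: ctx) tgt (f + 2))
  | call t a b, ctx, tgt, f => a.compile ctx f (f + 1) ;; b.compile ctx (f + 1) (f + 2) ;;
      t.compile [f, f + 1] tgt (f + 2) ;; clear f ;; clear (f + 1)

/-- The stacks hold the input word `u`, the values `ρ` of the variables in the stacks `ctx`, and an
empty workspace. -/
structure Env (u : List Symb) (ctx ρ : List ℕ) (f : ℕ) (s : Stacks) : Prop where
  two_le : 2 ≤ f
  input : s 0 = u
  aux : s 1 = []
  work : ∀ k, f ≤ k → s k = []
  vars : List.Forall₂ (fun r v => (2 ≤ r ∧ r < f) ∧ s r = unary v) ctx ρ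

theorem Env.of_eq {u : List Symb} {ctx ρ : List ℕ} {f f' : ℕ} {s s' : Stacks}
    (h : Env u ctx ρ f s) (hf : f ≤ f') (h0 : s' 0 = s 0) (h1 : s' 1 = s 1)
    (hw : ∀ k, f' ≤ k → s' k = []) (hv : ∀ r ∈ ctx, 2 ≤ r → r < f → s' r = s r) :
    Env u ctx ρ f' s' := by
  refine ⟨h.two_le.trans hf, h0.trans h.input, h1.trans h.aux, hw, ?_⟩
  have hvars := h.vars
  clear h
  induction hvars with
  | nil => exact List.Forall₂.nil
  | cons hr _ ih =>
    refine List.Forall₂.cons ⟨⟨hr.1.1, hr.1.2.trans_le hf⟩, ?_⟩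
      (ih fun r hr => hv r (List.mem_cons_of_mem _ hr))
    rw [hv _ List.mem_cons_self hr.1.1 hr.1.2, hr.2]

theorem Env.lt_of_mem {u : List Symb} {ctx ρ : List ℕ} {f : ℕ} {s : Stacks}
    (h : Env u ctx ρ f s) {r : ℕ} (hr : r ∈ ctx) : 2 ≤ r ∧ r < f := by
  have hvars := h.vars
  clear h
  induction hvars with
  | nil => simp at hr
  | cons h _ ih =>
    rcases List.mem_cons.1 hr with rfl | hr
    · exact h.1
    · exact ih hr

theorem Env.update_work {u : List Symb} {ctx ρ : List ℕ} {f : ℕ} {s : Stacks}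
    (h : Env u ctx ρ f s) (l : List Symb) : Env u ctx ρ (f + 1) (update s f l) := by
  have := h.two_le
  refine h.of_eq (by omega) ?_ ?_ ?_ ?_
  · rw [Function.update_of_ne (by omega)]
  · rw [Function.update_of_ne (by omega)]
  · intro k hk
    rw [Function.update_of_ne (by omega), h.work k (by omega)]
  · intro r _ _ hr
    rw [Function.update_of_ne (by omega)]

theorem Env.succ {u : List Symb} {ctx ρ : List ℕ} {f : ℕ} {s : Stacks}
    (h : Env u ctx ρ f s) : Env u ctx ρ (f + 1) s :=
  h.of_eq (Nat.le_succ f) rfl rfl (fun k hk => h.work k (by omega)) fun _ _ _ _ => rfl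

theorem Env.update_target {u : List Symb} {ctx ρ : List ℕ} {f tgt : ℕ} {s : Stacks}
    (h : Env u ctx ρ f s) (h2 : 2 ≤ tgt) (hf : tgt < f) (hc : tgt ∉ ctx) (l : List Symb) :
    Env u ctx ρ f (update s tgt l) := by
  refine h.of_eq le_rfl ?_ ?_ ?_ ?_
  · rw [Function.update_of_ne (by omega)]
  · rw [Function.update_of_ne (by omega)]
  · intro k hk
    rw [Function.update_of_ne (by omega), h.work k (by omega)]
  · intro r hr _ _
    exact Function.update_of_ne (ne_of_mem_of_not_mem hr hc) _ _

/-- The values of a term are bounded by a polynomial in the length of the input and the values of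
the variables. -/
theorem exists_eval_le (t : Term) : ∃ Q : Polynomial ℕ, ∀ (u : List Symb) (ρ : List ℕ) (B : ℕ),
    u.length ≤ B → (∀ v ∈ ρ, v ≤ B) → t.eval u ρ ≤ Q.eval B := by
  induction t with
  | var i =>
    refine ⟨Polynomial.X, fun u ρ B _ hρ => ?_⟩
    rw [Polynomial.eval_X, eval, List.getD_eq_getElem?_getD]
    rcases h : ρ[i]? with _ | v
    · simp
    · exact hρ v (List.mem_of_getElem? h)
  | zero => exact ⟨0, fun u ρ B _ _ => Nat.zero_le _⟩
  | one => exact ⟨1, fun u ρ B _ _ => by simp [eval]⟩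
  | add a b iha ihb =>
    obtain ⟨Q, hQ⟩ := iha
    obtain ⟨R, hR⟩ := ihb
    refine ⟨Q + R, fun u ρ B hu hρ => ?_⟩
    rw [Polynomial.eval_add]
    exact add_le_add (hQ u ρ B hu hρ) (hR u ρ B hu hρ)
  | sub a b iha ihb =>
    obtain ⟨Q, hQ⟩ := iha
    exact ⟨Q, fun u ρ B hu hρ => (Nat.sub_le _ _).trans (hQ u ρ B hu hρ)⟩
  | ite c a b _ iha ihb =>
    obtain ⟨Q, hQ⟩ := iha
    obtain ⟨R, hR⟩ := ihb
    refine ⟨Q + R, fun u ρ B hu hρ => ?_⟩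
    have h1 := hQ u ρ B hu hρ
    have h2 := hR u ρ B hu hρ
    rw [Polynomial.eval_add, eval]
    split_ifs <;> omega
  | sym x t _ =>
    refine ⟨1, fun u ρ B _ _ => ?_⟩
    rw [Polynomial.eval_one, eval]
    split_ifs <;> omega
  | sum t ih =>
    obtain ⟨Q, hQ⟩ := ih
    refine ⟨Polynomial.X * Q, fun u ρ B hu hρ => ?_⟩
    rw [Polynomial.eval_mul, Polynomial.eval_X, eval]
    calc _ ≤ ∑ i ∈ Finset.range u.length, Q.eval B := by
          refine Finset.sum_le_sum fun i hi => hQ u _ B hu ?_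
          have := Finset.mem_range.1 hi
          simp only [List.mem_cons, forall_eq_or_imp]
          exact ⟨by omega, hρ⟩
      _ = u.length * Q.eval B := by simp
      _ ≤ B * Q.eval B := Nat.mul_le_mul_right _ hu
  | call t a b iht iha ihb =>
    obtain ⟨Q, hQ⟩ := iht
    obtain ⟨R, hR⟩ := iha
    obtain ⟨S, hS⟩ := ihb
    refine ⟨Q.comp (Polynomial.X + R + S), fun u ρ B hu hρ => ?_⟩
    have h1 := hR u ρ B hu hρ
    have h2 := hS u ρ B hu hρ
    simp only [Polynomial.eval_comp, Polynomial.eval_add, Polynomial.eval_X, eval]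
    refine hQ u _ _ (by omega) ?_
    simp only [List.mem_cons, List.not_mem_nil, or_false, forall_eq_or_imp, forall_eq]
    omega

/-- A compiled term adds the value of the term to the target stack, in polynomial time. -/
theorem exists_exec_compile (t : Term) : ∃ P : Polynomial ℕ,
    ∀ (u : List Symb) (ρ : List ℕ) (B : ℕ), u.length ≤ B → (∀ v ∈ ρ, v ≤ B) →
    ∀ (ctx : List ℕ) (tgt f : ℕ) (s : Stacks), Env u ctx ρ f s → 2 ≤ tgt → tgt < f → tgt ∉ ctx →
      Exec (t.compile ctx tgt f) s (update s tgt (unary (t.eval u ρ) ++ s tgt)) (P.eval B) := by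
  induction t with
  | var i =>
    refine ⟨8 * Polynomial.X + 2, fun u ρ B _ hρ ctx tgt f s hs h2 hf hc => ?_⟩
    simp only [compile, eval]
    rcases h : ctx[i]? with _ | r
    · have hl : ρ[i]? = none := by
        rw [List.getElem?_eq_none_iff] at h ⊢
        rw [← hs.vars.length_eq]
        exact h
      refine (Exec.skip s).conv ?_ (by simp)
      simp [List.getD_eq_getElem?_getD, hl]
    · obtain ⟨hi, hr⟩ := List.getElem?_eq_some_iff.1 h
      have hi' : i < ρ.length := hs.vars.length_eq ▸ hi
      have hrv := (List.forall₂_iff_get.1 hs.vars).2 i hi hi'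
      simp only [List.get_eq_getElem, hr] at hrv
      have hmem : r ∈ ctx := List.mem_of_getElem? h
      have hv : ρ.getD i 0 = ρ[i] := by simp [List.getD_eq_getElem?_getD, hi']
      rw [hv]
      refine (exec_copyUnary (k := r) (l := tgt) (f := f) (fun h => hc (h ▸ hmem)) (by omega)
        (by omega) hrv.2 (hs.work f le_rfl)).conv rfl ?_
      have := hρ ρ[i] (List.getElem_mem hi')
      simp only [Polynomial.eval_add, Polynomial.eval_mul, Polynomial.eval_X,
        Polynomial.eval_ofNat]
      omega
  | zero =>
    exact ⟨1, fun u ρ B _ _ ctx tgt f s _ _ _ _ => (Exec.skip s).conv (by simp [eval]) (by simp)⟩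
  | one =>
    exact ⟨1, fun u ρ B _ _ ctx tgt f s _ _ _ _ => (Exec.push _ _ s).conv
      (by simp [eval, unary]) (by simp)⟩
  | add a b iha ihb =>
    obtain ⟨P, hP⟩ := iha
    obtain ⟨R, hR⟩ := ihb
    refine ⟨P + R, fun u ρ B hu hρ ctx tgt f s hs h2 hf hc => ?_⟩
    refine ((hP u ρ B hu hρ ctx tgt f s hs h2 hf hc).seq (hR u ρ B hu hρ ctx tgt f _
      (hs.update_target h2 hf hc _) h2 hf hc)).conv ?_ (by simp)
    rw [Function.update_idem, Function.update_self, ← List.append_assoc, unary_append, eval,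
      add_comm]
  | sub a b iha ihb =>
    obtain ⟨P, hP⟩ := iha
    obtain ⟨R, hR⟩ := ihb
    obtain ⟨Q, hQ⟩ := a.exists_eval_le
    obtain ⟨S, hS⟩ := b.exists_eval_le
    refine ⟨P + R + 3 * S + 4 * Q + 2, fun u ρ B hu hρ ctx tgt f s hs h2 hf hc => ?_⟩
    have hf2 := hs.two_le
    have hfc : f ∉ ctx := fun h => absurd (hs.lt_of_mem h).2 (lt_irrefl _)
    have hfc' : f + 1 ∉ ctx := fun h => absurd (hs.lt_of_mem h).2 (by omega)
    have h1 := hP u ρ B hu hρ ctx f (f + 1) s hs.succ hf2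
      (by omega) hfc
    rw [hs.work f le_rfl, List.append_nil] at h1
    have h3 := hR u ρ B hu hρ ctx (f + 1) (f + 2) _
      (hs.update_work (unary (a.eval u ρ))).succ (by omega) (by omega) hfc'
    rw [Function.update_of_ne (by omega), hs.work (f + 1) (by omega), List.append_nil] at h3
    have h4 := exec_while (k := f + 1) (b := Option.isSome) (p := pop (f + 1) ;; pop f) (c := 2)
      (b.eval u ρ) (fun i => update (update s f (unary (a.eval u ρ - i))) (f + 1)
        (unary (b.eval u ρ - i))) (fun i hi => by simp; omega) (by simp)
      (fun i hi => by
        refine ((Exec.pop (f + 1) _).seq (Exec.pop f _)).conv ?_ le_rfl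
        funext x
        have e1 : a.eval u ρ - i - 1 = a.eval u ρ - (i + 1) := by omega
        have e2 : b.eval u ρ - i - 1 = b.eval u ρ - (i + 1) := by omega
        grind [Function.update_apply, unary_tail])
    refine (h1.seq (h3.seq (h4.seq (exec_moveAll (k := f) (l := tgt) (by omega) _)))).conv ?_ ?_
    · have hw := hs.work (f + 1) (by omega)
      have hw' := hs.work f le_rfl
      funext x
      grind [Function.update_apply, unary_reverse, unary_zero, eval]
    · have e1 := hQ u ρ B hu hρ
      have e2 := hS u ρ B hu hρ
      rw [Function.update_of_ne (by omega), Function.update_self, unary_length]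
      simp only [Polynomial.eval_add, Polynomial.eval_mul, Polynomial.eval_ofNat]
      omega
  | ite c a b ihc iha ihb =>
    obtain ⟨P, hP⟩ := ihc
    obtain ⟨R, hR⟩ := iha
    obtain ⟨T, hT⟩ := ihb
    obtain ⟨Q, hQ⟩ := c.exists_eval_le
    refine ⟨P + R + T + 2 * Q + 2, fun u ρ B hu hρ ctx tgt f s hs h2 hf hc => ?_⟩
    have hf2 := hs.two_le
    have hfc : f ∉ ctx := fun h => absurd (hs.lt_of_mem h).2 (lt_irrefl _)
    have h1 := hP u ρ B hu hρ ctx f (f + 1) s hs.succ hf2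
      (by omega) hfc
    rw [hs.work f le_rfl, List.append_nil] at h1
    have e1 := hQ u ρ B hu hρ
    have hw' := hs.work f le_rfl
    have hup : update s f [] = s := by rw [← hw', Function.update_eq_self]
    refine (h1.seq (Exec.cases (n := R.eval B + T.eval B + 2 * Q.eval B + 1) ?_)).conv rfl ?_
    · rw [Function.update_self, eval]
      rcases h : c.eval u ρ with _ | n
      · simp only [unary_zero, List.head?_nil, hup, if_true]
        exact (hT u ρ B hu hρ ctx tgt f s hs h2 hf hc).mono (by omega)
      · simp only [unary_succ, List.head?_cons, if_neg (Nat.succ_ne_zero n)]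
        refine ((exec_clear f _).seq' (hR u ρ B hu hρ ctx tgt f s hs h2 hf hc) ?_).conv rfl ?_
        · rw [Function.update_idem, hup]
        · rw [Function.update_self, ← unary_succ, unary_length]
          omega
    · simp only [Polynomial.eval_add, Polynomial.eval_mul, Polynomial.eval_ofNat]
      omega
  | sym x t ih =>
    obtain ⟨P, hP⟩ := ih
    obtain ⟨Q, hQ⟩ := t.exists_eval_le
    refine ⟨P + 5 * Q + 4 * Polynomial.X + 4, fun u ρ B hu hρ ctx tgt f s hs h2 hf hc => ?_⟩
    have hf2 := hs.two_le
    have hfc : f ∉ ctx := fun h => absurd (hs.lt_of_mem h).2 (lt_irrefl _)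
    have h1 := hP u ρ B hu hρ ctx f (f + 1) s hs.succ hf2
      (by omega) hfc
    have hw := hs.work f le_rfl
    rw [hw, List.append_nil] at h1
    have e1 := hQ u ρ B hu hρ
    have hs0 := hs.input
    have hs1 := hs.aux
    set v := t.eval u ρ with hv
    have h3 := exec_while (k := f) (b := Option.isSome) (p := pop f ;; moveTop 0 1) (c := 4) v
      (fun i => update (update (update s 0 (u.drop i)) 1 (u.take i).reverse) f (unary (v - i)))
      (fun i hi => by simp; omega) (by simp)
      (fun i hi => by
        have e2 : v - i - 1 = v - (i + 1) := by omega
        by_cases hiu : i < u.length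
        · have hd : u.drop i = u[i] :: u.drop (i + 1) := List.drop_eq_getElem_cons hiu
          refine ((Exec.pop f _).seq (exec_moveTop_cons (a := u[i]) (t := u.drop (i + 1))
            ?_)).conv ?_ le_rfl
          · grind [Function.update_apply]
          · rw [List.take_succ_eq_append_getElem hiu]
            funext x
            grind [Function.update_apply, unary_tail]
        · have hd : u.drop i = [] := List.drop_of_length_le (by omega)
          refine ((Exec.pop f _).seq (exec_moveTop_nil ?_)).conv ?_ (by omega)
          · grind [Function.update_apply]
          · rw [List.drop_of_length_le (show u.length ≤ i + 1 by omega), hd,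
              List.take_of_length_le (show u.length ≤ i + 1 by omega),
              List.take_of_length_le (show u.length ≤ i by omega)]
            funext x
            grind [Function.update_apply, unary_tail])
    have h4 : Exec (.cases 0 (fun y => if y = some x then push tgt (some true) else skip))
        (update (update s 0 (u.drop v)) 1 (u.take v).reverse)
        (update (update (update s 0 (u.drop v)) 1 (u.take v).reverse) tgt
          (unary ((Term.sym x t).eval u ρ) ++ s tgt)) 2 := by
      refine Exec.cases (n := 1) ?_
      rw [Function.update_of_ne (by omega), Function.update_self, List.head?_drop, eval, ← hv]
      have e3 : update (update s 0 (u.drop v)) 1 (u.take v).reverse tgt = s tgt := by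
        grind [Function.update_apply]
      split_ifs with hx
      · refine (Exec.push tgt _ _).conv ?_ le_rfl
        rw [e3]
        rfl
      · refine (Exec.skip _).conv ?_ le_rfl
        rw [← e3]
        simp
    refine (h1.seq' (h3.seq' (h4.seq (exec_moveAll (k := 1) (l := 0) (by omega) _)) ?_)
      ?_).conv ?_ ?_
    · funext y
      grind [Function.update_apply, unary_zero]
    · funext y
      grind [Function.update_apply]
    · funext y
      have e4 := List.take_append_drop v u
      grind [Function.update_apply]
    · have e5 : (u.take v).length ≤ B := (List.length_take_le' _ _).trans hu
      rw [Function.update_of_ne (by omega), Function.update_self, List.length_reverse]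
      simp only [Polynomial.eval_add, Polynomial.eval_mul, Polynomial.eval_ofNat,
        Polynomial.eval_X]
      omega
  | sum t ih =>
    obtain ⟨P, hP⟩ := ih
    refine ⟨Polynomial.X * (P + 14) + 4, fun u ρ B hu hρ ctx tgt f s hs h2 hf hc => ?_⟩
    have hf2 := hs.two_le
    have hs0 := hs.input
    have hs1 := hs.aux
    have hw := hs.work f le_rfl
    have hw' := hs.work (f + 1) (by omega)
    have hfc : f ∉ ctx := fun h => absurd (hs.lt_of_mem h).2 (lt_irrefl _)
    have h := exec_forInput (f := f) (p := t.compile ((f + 1) :: ctx) tgt (f + 2))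
      (c := P.eval B) hf2 u.length
      (fun i => update s tgt (unary (∑ j ∈ Finset.range i, t.eval u (j :: ρ)) ++ s tgt))
      (by grind [Function.update_apply]) (by grind [Function.update_apply])
      (by grind [Function.update_apply]) (by grind [Function.update_apply])
      (by grind [Function.update_apply]) (by grind [Function.update_apply])
      (fun i hi m => by
        have hs' := (((hs.update_target h2 hf hc (unary (∑ j ∈ Finset.range i,
          t.eval u (j :: ρ)) ++ s tgt)).update_work (unary m)).update_work (unary i))
        have hs'' := hP u (i :: ρ) B hu (by
          simp only [List.mem_cons, forall_eq_or_imp]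
          exact ⟨by omega, hρ⟩) ((f + 1) :: ctx) tgt (f + 2) _
          ⟨hs'.two_le, hs'.input, hs'.aux, hs'.work,
            List.Forall₂.cons ⟨⟨by omega, by omega⟩, Function.update_self _ _ _⟩ hs'.vars⟩
          h2 (by omega) (by
            simp only [List.mem_cons, not_or]
            exact ⟨by omega, hc⟩)
        refine hs''.conv ?_ le_rfl
        have hsum : unary (∑ j ∈ Finset.range (i + 1), t.eval u (j :: ρ)) =
            unary (t.eval u (i :: ρ)) ++ unary (∑ j ∈ Finset.range i, t.eval u (j :: ρ)) := by
          rw [Finset.sum_range_succ, unary_append, add_comm]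
        rw [hsum]
        clear hP
        funext x
        grind [Function.update_apply])
    simp only [Finset.range_zero, Finset.sum_empty, unary_zero, List.nil_append,
      Function.update_eq_self] at h
    refine h.conv rfl ?_
    simp only [Polynomial.eval_add, Polynomial.eval_mul, Polynomial.eval_ofNat,
      Polynomial.eval_X]
    gcongr
  | call t a b iht iha ihb =>
    obtain ⟨P, hP⟩ := iha
    obtain ⟨R, hR⟩ := ihb
    obtain ⟨T, hT⟩ := iht
    obtain ⟨Q, hQ⟩ := a.exists_eval_le
    obtain ⟨S, hS⟩ := b.exists_eval_le
    refine ⟨P + R + T.comp (Polynomial.X + Q + S) + 2 * Q + 2 * S + 2,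
      fun u ρ B hu hρ ctx tgt f s hs h2 hf hc => ?_⟩
    have hf2 := hs.two_le
    have hfc : f ∉ ctx := fun h => absurd (hs.lt_of_mem h).2 (lt_irrefl _)
    have hfc' : f + 1 ∉ ctx := fun h => absurd (hs.lt_of_mem h).2 (by omega)
    have h1 := hP u ρ B hu hρ ctx f (f + 1) s hs.succ hf2
      (by omega) hfc
    have hw := hs.work f le_rfl
    have hw' := hs.work (f + 1) (by omega)
    rw [hw, List.append_nil] at h1
    have h3 := hR u ρ B hu hρ ctx (f + 1) (f + 2) _
      (hs.update_work (unary (a.eval u ρ))).succ (by omega) (by omega) hfc'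
    rw [Function.update_of_ne (by omega), hw', List.append_nil] at h3
    have e1 := hQ u ρ B hu hρ
    have e2 := hS u ρ B hu hρ
    have hs' := ((hs.update_work (unary (a.eval u ρ))).update_work (unary (b.eval u ρ)))
    have h4 := hT u [a.eval u ρ, b.eval u ρ] (B + Q.eval B + S.eval B) (by omega)
      (by
        simp only [List.mem_cons, List.not_mem_nil, or_false, forall_eq_or_imp, forall_eq]
        omega) [f, f + 1] tgt (f + 2) _
      ⟨hs'.two_le, hs'.input, hs'.aux, hs'.work, by
        refine List.Forall₂.cons ⟨⟨by omega, by omega⟩, ?_⟩ (List.Forall₂.cons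
          ⟨⟨by omega, by omega⟩, ?_⟩ List.Forall₂.nil)
        · rw [Function.update_of_ne (by omega), Function.update_self]
        · rw [Function.update_self]⟩ h2 (by omega)
      (by
        simp only [List.mem_cons, List.not_mem_nil, or_false, not_or]
        omega)
    refine (h1.seq (h3.seq (h4.seq ((exec_clear f _).seq (exec_clear (f + 1) _))))).conv ?_ ?_
    · clear hP hR hT hQ hS h1 h3 h4 hs'
      rw [eval]
      funext x
      grind [Function.update_apply]
    · have g1 : f ≠ tgt := by omega
      have g2 : f + 1 ≠ tgt := by omega
      simp only [Polynomial.eval_add, Polynomial.eval_mul, Polynomial.eval_ofNat,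
        Polynomial.eval_X, Polynomial.eval_comp, Function.update_of_ne g1, Function.update_of_ne g2,
        Function.update_self, Function.update_of_ne (show f ≠ f + 1 by omega),
        Function.update_of_ne (show f + 1 ≠ f by omega), unary_length]
      omega

end Term

/-! ### Binary counters on stacks -/

namespace StackProg

open Computability
open Function (update)

theorem encodeNat_bit1 (n : ℕ) : encodeNat (2 * n + 1) = true :: encodeNat n := by
  have h : ((2 * n + 1 : ℕ) : Num) = Num.bit1 (n : Num) := by
    rw [two_mul, ← Num.bit1_of_bit1]
    push_cast
    rfl
  unfold encodeNat
  rw [h]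
  cases (n : Num) <;> rfl

theorem encodeNat_bit0 {n : ℕ} (hn : 0 < n) : encodeNat (2 * n) = false :: encodeNat n := by
  have h : ((2 * n : ℕ) : Num) = Num.bit0 (n : Num) := by
    rw [two_mul, ← Num.bit0_of_bit0]
    push_cast
    rfl
  unfold encodeNat
  rw [h]
  rcases hm : (n : Num) with _ | p
  · have := Num.to_of_nat n
    rw [hm] at this
    simp at this
    omega
  · rfl

theorem encodeNat_zero : encodeNat 0 = [] := rfl

/-- The effect of adding one on the binary digits. -/
theorem exists_encodeNat_succ (n : ℕ) : ∃ (j : ℕ) (r : List Bool),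
    encodeNat n = List.replicate j true ++ (if r = [] then [] else false :: r) ∧
      encodeNat (n + 1) = List.replicate j false ++ true :: r := by
  induction n using Nat.strong_induction_on with
  | _ n ih =>
    rcases Nat.even_or_odd' n with ⟨m, rfl | rfl⟩
    · refine ⟨0, encodeNat m, ?_, encodeNat_bit1 m⟩
      rcases Nat.eq_zero_or_pos m with rfl | hm
      · simp [encodeNat_zero]
      · have hne : encodeNat m ≠ [] := by
          obtain ⟨k, rfl⟩ : ∃ k, m = k + 1 := ⟨m - 1, by omega⟩
          obtain ⟨j, r, -, h⟩ := ih k (by omega)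
          rw [h]
          simp
        rw [encodeNat_bit0 hm, if_neg hne]
        rfl
    · obtain ⟨j, r, h1, h2⟩ := ih m (by omega)
      refine ⟨j + 1, r, ?_, ?_⟩
      · rw [encodeNat_bit1, h1]
        rfl
      · rw [show 2 * m + 1 + 1 = 2 * (m + 1) by ring, encodeNat_bit0 (Nat.succ_pos m), h2]
        rfl

theorem length_encodeNat_succ (n : ℕ) : (encodeNat n).length ≤ (encodeNat (n + 1)).length ∧
    (encodeNat (n + 1)).length ≤ (encodeNat n).length + 1 := by
  obtain ⟨j, r, h1, h2⟩ := exists_encodeNat_succ n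
  rw [h1, h2]
  split_ifs with hr
  · simp [hr]
  · simp

theorem length_encodeNat_mono : Monotone fun n => (encodeNat n).length :=
  monotone_nat_of_le_succ fun n => (length_encodeNat_succ n).1

theorem length_encodeNat_add_le (k n : ℕ) :
    (encodeNat (k + n)).length ≤ (encodeNat k).length + n := by
  induction n with
  | zero => exact le_rfl
  | succ n ih =>
    have := (length_encodeNat_succ (k + n)).2
    rw [← add_assoc]
    omega

theorem length_encodeNat_le (n : ℕ) : (encodeNat n).length ≤ n := by
  simpa [encodeNat_zero] using length_encodeNat_add_le 0 n

/-- The binary digits of a number on a stack, the least significant one on top. -/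
def bits (n : ℕ) : List Symb := (encodeNat n).map some

@[simp] theorem length_bits (n : ℕ) : (bits n).length = (encodeNat n).length := List.length_map _

@[simp] theorem bits_zero : bits 0 = [] := rfl

theorem bits_ne_nil {n : ℕ} (hn : 0 < n) : bits n ≠ [] := by
  obtain ⟨k, rfl⟩ : ∃ k, n = k + 1 := ⟨n - 1, by omega⟩
  obtain ⟨j, r, -, h⟩ := exists_encodeNat_succ k
  simp [bits, h]

/-- Add one to the binary number in stack `k`. -/
def incr (k : ℕ) : StackProg :=
  whileTop k (· == some (some true)) (pop k ;; push 1 (some false)) ;; pop k ;;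
    push k (some true) ;; moveAll 1 k

/-- Subtract one from the positive binary number in stack `k`. -/
def decr (k : ℕ) : StackProg :=
  whileTop k (· == some (some false)) (pop k ;; push 1 (some true)) ;; pop k ;;
    .cases k (fun x => Option.rec skip (fun _ => push k (some false)) x) ;; moveAll 1 k

/-- Replace the block of symbols `x` on top of stack `k` by as many symbols `y` in stack `1`. -/
theorem exec_carry {k : ℕ} (hk : 2 ≤ k) (x y : Symb) (j : ℕ) (t : List Symb)
    (ht : t.head? ≠ some x) {s : Stacks} (h1 : s 1 = []) (hs : s k = List.replicate j x ++ t) :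
    Exec (whileTop k (· == some x) (pop k ;; push 1 y)) s
      (update (update s k t) 1 (List.replicate j y)) (3 * j + 1) := by
  have h := exec_while (k := k) (b := (· == some x)) (p := pop k ;; push 1 y) (c := 2) j
    (fun i => update (update s k (List.replicate (j - i) x ++ t)) 1 (List.replicate i y))
    (fun i hi => by
      rw [Function.update_of_ne (by omega), Function.update_self]
      obtain ⟨m, hm⟩ : ∃ m, j - i = m + 1 := ⟨j - i - 1, by omega⟩
      simp [hm, List.replicate_succ])
    (by
      rw [Function.update_of_ne (by omega), Function.update_self]
      simpa using ht)
    (fun i hi => by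
      obtain ⟨m, hm⟩ : ∃ m, j - i = m + 1 := ⟨j - i - 1, by omega⟩
      have hm' : j - (i + 1) = m := by omega
      rw [hm, hm', List.replicate_succ, List.replicate_succ]
      refine ((Exec.pop k _).seq (Exec.push 1 _ _)).conv ?_ le_rfl
      funext z
      grind [Function.update_apply])
  have e0 : update (update s k (List.replicate (j - 0) x ++ t)) 1 (List.replicate 0 y) = s := by
    funext z
    grind [Function.update_apply]
  rw [e0] at h
  exact h.conv (by simp) (by omega)

theorem exec_incr {k : ℕ} (hk : 2 ≤ k) {s : Stacks} (h1 : s 1 = []) {n : ℕ} (hs : s k = bits n) :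
    Exec (incr k) s (update s k (bits (n + 1))) (7 * (bits n).length + 4) := by
  obtain ⟨j, r, e1, e2⟩ := exists_encodeNat_succ n
  have e1' : bits n = List.replicate j (some true) ++
      (if r = [] then [] else some false :: r.map some) := by
    rw [bits, e1]
    split_ifs <;> simp
  have e2' : bits (n + 1) = List.replicate j (some false) ++ some true :: r.map some := by
    rw [bits, e2]
    simp
  have h := exec_carry hk (some true) (some false) j _ (by split_ifs <;> simp) h1 (hs.trans e1')
  have htail : (if r = [] then [] else some false :: r.map some).tail = r.map some := by
    split_ifs with hr <;> simp [hr]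
  refine (h.seq ((Exec.pop k _).seq ((Exec.push k _ _).seq (exec_moveAll (k := 1) (l := k)
    (by omega) _)))).conv ?_ ?_
  · rw [e2']
    funext z
    grind [Function.update_apply, List.reverse_replicate]
  · have : j ≤ (bits n).length := by
      rw [e1']
      simp
    have e3 : (1 : ℕ) ≠ k := by omega
    simp only [Function.update_of_ne e3, Function.update_self, List.length_replicate]
    omega

theorem exec_decr {k : ℕ} (hk : 2 ≤ k) {s : Stacks} (h1 : s 1 = []) {n : ℕ}
    (hs : s k = bits (n + 1)) :
    Exec (decr k) s (update s k (bits n)) (7 * (bits (n + 1)).length + 5) := by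
  obtain ⟨j, r, e1, e2⟩ := exists_encodeNat_succ n
  have e1' : bits n = List.replicate j (some true) ++
      (if r = [] then [] else some false :: r.map some) := by
    rw [bits, e1]
    split_ifs <;> simp
  have e2' : bits (n + 1) = List.replicate j (some false) ++ some true :: r.map some := by
    rw [bits, e2]
    simp
  have h := exec_carry hk (some false) (some true) j _ (by simp) h1 (hs.trans e2')
  have h2 : Exec (.cases k (fun x => Option.rec skip (fun _ => push k (some false)) x))
      (update (update s k (r.map some)) 1 (List.replicate j (some true)))
      (update (update s k (if r = [] then [] else some false :: r.map some)) 1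
        (List.replicate j (some true))) 2 := by
    refine Exec.cases (n := 1) ?_
    rw [Function.update_of_ne (by omega), Function.update_self]
    rcases r with _ | ⟨b, r⟩
    · exact Exec.skip _
    · refine (Exec.push k _ _).conv ?_ le_rfl
      funext z
      grind [Function.update_apply]
  refine (h.seq ((Exec.pop k _).seq' (h2.seq (exec_moveAll (k := 1) (l := k)
    (by omega) _)) ?_)).conv ?_ ?_
  · funext z
    grind [Function.update_apply]
  · rw [e1']
    funext z
    grind [Function.update_apply, List.reverse_replicate]
  · have : j ≤ (bits (n + 1)).length := by
      rw [e2']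
      simp
    simp only [Function.update_self, List.length_replicate]
    omega

/-- Move the unary number in stack `5` from the binary number in stack `3` to the one in stack `4`:
the former is decremented as long as it is positive, and then the latter is incremented. -/
def subLoop : StackProg :=
  whileTop 5 Option.isSome (pop 5 ;; .cases 3 fun x => Option.rec (incr 4) (fun _ => decr 3) x)

/-- Add the unary number in stack `5` to the binary number in stack `3`. -/
def addLoop : StackProg := whileTop 5 Option.isSome (pop 5 ;; incr 3)

theorem exec_subLoop {s : Stacks} (h1 : s 1 = []) {k n : ℕ} (h3 : s 3 = bits k) (h4 : s 4 = [])
    (h5 : s 5 = unary n) :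
    Exec subLoop s (update (update (update s 5 []) 3 (bits (k - n))) 4 (bits (n - k)))
      (n * (7 * ((bits k).length + n) + 8) + 1) := by
  have h := exec_while (k := 5) (b := Option.isSome)
    (p := pop 5 ;; .cases 3 fun x => Option.rec (incr 4) (fun _ => decr 3) x)
    (c := 7 * ((bits k).length + n) + 7) n
    (fun i => update (update (update s 5 (unary (n - i))) 3 (bits (k - i))) 4 (bits (i - k)))
    (fun i hi => by simp; omega)
    (by simp)
    (fun i hi => by
      refine (Exec.seq (m := 1) (n := 7 * ((bits k).length + n) + 6) (Exec.pop 5 _)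
        (Exec.cases (n := 7 * ((bits k).length + n) + 5) ?_)).conv rfl (by omega)
      rw [Function.update_of_ne (by omega), Function.update_of_ne (by omega), Function.update_self]
      by_cases hik : k ≤ i
      · have e0 : k - i = 0 := by omega
        have e1 : k - (i + 1) = 0 := by omega
        have e2 : i + 1 - k = i - k + 1 := by omega
        rw [e0, e1, e2, bits_zero]
        refine (exec_incr (k := 4) (by omega) ?_ (n := i - k) ?_).conv ?_ ?_
        · simpa [Function.update_apply] using h1
        · simp
        · funext z
          have e3 : n - i - 1 = n - (i + 1) := by omega
          grind [Function.update_apply, unary_tail]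
        · have := length_encodeNat_le (i - k)
          rw [length_bits]
          omega
      · obtain ⟨m, hm⟩ : ∃ m, k - i = m + 1 := ⟨k - i - 1, by omega⟩
        have e1 : k - (i + 1) = m := by omega
        have e2 : i + 1 - k = i - k := by omega
        rw [hm, e1, e2]
        obtain ⟨b, t, hb⟩ := List.exists_cons_of_ne_nil (bits_ne_nil (Nat.succ_pos m))
        rw [hb]
        refine (exec_decr (k := 3) (by omega) ?_ (n := m) ?_).conv ?_ ?_
        · simpa [Function.update_apply] using h1
        · simp [hb]
        · funext z
          have e3 : n - i - 1 = n - (i + 1) := by omega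
          grind [Function.update_apply, unary_tail]
        · have : (encodeNat (m + 1)).length ≤ (encodeNat k).length :=
            length_encodeNat_mono (show m + 1 ≤ k by omega)
          rw [length_bits, length_bits]
          omega)
  have h0 : update (update (update s 5 (unary (n - 0))) 3 (bits (k - 0))) 4 (bits (0 - k)) = s := by
    funext z
    have : 0 - k = 0 := by omega
    grind [Function.update_apply, bits_zero]
  rw [h0] at h
  refine h.conv ?_ le_rfl
  simp

theorem exec_addLoop {s : Stacks} (h1 : s 1 = []) {k n : ℕ} (h3 : s 3 = bits k)
    (h5 : s 5 = unary n) :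
    Exec addLoop s (update (update s 5 []) 3 (bits (k + n)))
      (n * (7 * ((bits k).length + n) + 6) + 1) := by
  have h := exec_while (k := 5) (b := Option.isSome) (p := pop 5 ;; incr 3)
    (c := 7 * ((bits k).length + n) + 5) n
    (fun i => update (update s 5 (unary (n - i))) 3 (bits (k + i)))
    (fun i hi => by simp; omega)
    (by simp)
    (fun i hi => by
      refine ((Exec.pop 5 _).seq (exec_incr (k := 3) (by omega) ?_ (n := k + i) ?_)).conv ?_ ?_
      · simpa [Function.update_apply] using h1
      · simp
      · funext z
        have e3 : n - i - 1 = n - (i + 1) := by omega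
        grind [Function.update_apply, unary_tail]
      · have := length_encodeNat_add_le k i
        rw [length_bits, length_bits]
        omega)
  have h0 : update (update s 5 (unary (n - 0))) 3 (bits (k + 0)) = s := by
    funext z
    grind [Function.update_apply]
  rw [h0] at h
  refine h.conv ?_ le_rfl
  simp

/-- Drop as many symbols of the input as stack `6` says, and move the rest without its last symbol
to stack `3`. -/
def load : StackProg :=
  whileTop 6 Option.isSome (pop 6 ;; pop 0) ;; moveAll 0 4 ;; pop 4 ;; moveAll 4 3

theorem exec_load {s : Stacks} {u w : List Symb} {a : Symb} {n : ℕ} (h0 : s 0 = u)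
    (h3 : s 3 = []) (h4 : s 4 = []) (h6 : s 6 = unary n) (hu : u.drop n = w ++ [a]) :
    Exec load s (update (update (update s 6 []) 0 []) 3 w) (3 * n + 8 * u.length + 4) := by
  have h := exec_while (k := 6) (b := Option.isSome) (p := pop 6 ;; pop 0) (c := 2) n
    (fun i => update (update s 6 (unary (n - i))) 0 (u.drop i))
    (fun i hi => by simp; omega)
    (by simp)
    (fun i hi => by
      refine ((Exec.pop 6 _).seq (Exec.pop 0 _)).conv ?_ le_rfl
      funext z
      have e3 : n - i - 1 = n - (i + 1) := by omega
      grind [Function.update_apply, unary_tail, List.tail_drop])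
  have e0 : update (update s 6 (unary (n - 0))) 0 (u.drop 0) = s := by
    funext z
    grind [Function.update_apply]
  rw [e0, hu] at h
  have hl : w.length + 1 ≤ u.length := by
    have := congrArg List.length hu
    simp at this
    omega
  refine (h.seq ((exec_moveAll (k := 0) (l := 4) (by omega) _).seq ((Exec.pop 4 _).seq
    (exec_moveAll (k := 4) (l := 3) (by omega) _)))).conv ?_ ?_
  · funext z
    grind [Function.update_apply, unary_zero]
  · simp [h4]
    omega

end StackProg

/-! ### Word generators -/

/-- Descriptions of words that depend on the input word and on variables: the empty word, a single
symbol, a number as encoded by `encodeIndex`, concatenation, case distinction on whether a value is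
nonzero, and concatenation of the words for all `i < N`, where `N` is the length of the input. -/
inductive Gen : Type
  | nil : Gen
  | emit (a : Symb) : Gen
  | index (t : Term) : Gen
  | seq (g h : Gen) : Gen
  | ite (c : Term) (g h : Gen) : Gen
  | loop (g : Gen) : Gen

namespace Gen

open StackProg Term
open Function (update)

/-- The word described by a generator. -/
def out (u : List Symb) : Gen → List ℕ → List Symb
  | nil, _ => []
  | emit a, _ => [a]
  | index t, ρ => encodeIndex (t.eval u ρ)
  | seq g h, ρ => g.out u ρ ++ h.out u ρ
  | ite c g h, ρ => if c.eval u ρ = 0 then h.out u ρ else g.out u ρ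
  | loop g, ρ => (List.range u.length).flatMap fun i => g.out u (i :: ρ)

/-- A program that pushes the symbols of the word, one by one, on stack `2`. -/
def compile : Gen → (ctx : List ℕ) → (f : ℕ) → StackProg
  | nil, _, _ => skip
  | emit a, _, _ => push 2 a
  | index t, ctx, f => t.compile ctx f (f + 1) ;; moveAll f 2 ;; push 2 none
  | seq g h, ctx, f => g.compile ctx f ;; h.compile ctx f
  | ite c g h, ctx, f => c.compile ctx f (f + 1) ;;
      .cases f fun x => Option.rec (h.compile ctx f) (fun _ => clear f ;; g.compile ctx f) x
  | loop g, ctx, f => forInput f (g.compile ((f + 1) :: ctx) (f + 2))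

/-- The word has polynomial length. -/
theorem exists_length_out_le (g : Gen) : ∃ Q : Polynomial ℕ,
    ∀ (u : List Symb) (ρ : List ℕ) (B : ℕ), u.length ≤ B → (∀ v ∈ ρ, v ≤ B) →
      (g.out u ρ).length ≤ Q.eval B := by
  induction g with
  | nil => exact ⟨0, fun u ρ B _ _ => by simp [out]⟩
  | emit a => exact ⟨1, fun u ρ B _ _ => by simp [out]⟩
  | index t =>
    obtain ⟨Q, hQ⟩ := t.exists_eval_le
    refine ⟨Q + 1, fun u ρ B hu hρ => ?_⟩
    simpa [out, encodeIndex] using hQ u ρ B hu hρ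
  | seq g h ihg ihh =>
    obtain ⟨Q, hQ⟩ := ihg
    obtain ⟨R, hR⟩ := ihh
    refine ⟨Q + R, fun u ρ B hu hρ => ?_⟩
    rw [out, List.length_append, Polynomial.eval_add]
    exact add_le_add (hQ u ρ B hu hρ) (hR u ρ B hu hρ)
  | ite c g h ihg ihh =>
    obtain ⟨Q, hQ⟩ := ihg
    obtain ⟨R, hR⟩ := ihh
    refine ⟨Q + R, fun u ρ B hu hρ => ?_⟩
    have h1 := hQ u ρ B hu hρ
    have h2 := hR u ρ B hu hρ
    rw [out, Polynomial.eval_add]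
    split_ifs <;> omega
  | loop g ih =>
    obtain ⟨Q, hQ⟩ := ih
    refine ⟨Polynomial.X * Q, fun u ρ B hu hρ => ?_⟩
    rw [out, List.length_flatMap, Polynomial.eval_mul, Polynomial.eval_X]
    refine (List.sum_le_card_nsmul _ (Q.eval B) ?_).trans ?_
    · intro x hx
      obtain ⟨i, hi, rfl⟩ := List.mem_map.1 hx
      have := List.mem_range.1 hi
      refine hQ u _ B hu ?_
      simp only [List.mem_cons, forall_eq_or_imp]
      exact ⟨by omega, hρ⟩
    · simpa using Nat.mul_le_mul_right _ hu

/-- A compiled generator pushes its word on stack `2` in polynomial time. -/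
theorem exists_exec_compile (g : Gen) : ∃ P : Polynomial ℕ,
    ∀ (u : List Symb) (ρ : List ℕ) (B : ℕ), u.length ≤ B → (∀ v ∈ ρ, v ≤ B) →
    ∀ (ctx : List ℕ) (f : ℕ) (s : Stacks), Env u ctx ρ f s → 2 < f → 2 ∉ ctx →
      Exec (g.compile ctx f) s (update s 2 ((g.out u ρ).reverse ++ s 2)) (P.eval B) := by
  induction g with
  | nil =>
    exact ⟨1, fun u ρ B _ _ ctx f s _ _ _ => (Exec.skip s).conv (by simp [out]) (by simp)⟩
  | emit a =>
    exact ⟨1, fun u ρ B _ _ ctx f s _ _ _ => (Exec.push 2 a s).conv rfl (by simp)⟩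
  | index t =>
    obtain ⟨P, hP⟩ := t.exists_exec_compile
    obtain ⟨Q, hQ⟩ := t.exists_eval_le
    refine ⟨P + 4 * Q + 2, fun u ρ B hu hρ ctx f s hs hf hc => ?_⟩
    have hfc : f ∉ ctx := fun h => absurd (hs.lt_of_mem h).2 (lt_irrefl _)
    have hw := hs.work f le_rfl
    have h1 := hP u ρ B hu hρ ctx f (f + 1) s hs.succ hs.two_le (by omega) hfc
    rw [hw, List.append_nil] at h1
    have e1 := hQ u ρ B hu hρ
    refine (h1.seq ((exec_moveAll (k := f) (l := 2) (by omega) _).seq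
      (Exec.push 2 none _))).conv ?_ ?_
    · have e2 : (encodeIndex (t.eval u ρ)).reverse = none :: unary (t.eval u ρ) := by
        simp [encodeIndex, unary]
      rw [out, e2]
      clear hP hQ h1 hs
      funext x
      grind [Function.update_apply, unary_reverse]
    · simp only [Function.update_self, unary_length, Polynomial.eval_add, Polynomial.eval_mul,
        Polynomial.eval_ofNat]
      omega
  | seq g h ihg ihh =>
    obtain ⟨P, hP⟩ := ihg
    obtain ⟨R, hR⟩ := ihh
    refine ⟨P + R, fun u ρ B hu hρ ctx f s hs hf hc => ?_⟩
    refine ((hP u ρ B hu hρ ctx f s hs hf hc).seq (hR u ρ B hu hρ ctx f _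
      (hs.update_target le_rfl hf hc _) hf hc)).conv ?_ (by simp)
    rw [Function.update_idem, Function.update_self, out, List.reverse_append, List.append_assoc]
  | ite c g h ihg ihh =>
    obtain ⟨P, hP⟩ := c.exists_exec_compile
    obtain ⟨R, hR⟩ := ihg
    obtain ⟨T, hT⟩ := ihh
    obtain ⟨Q, hQ⟩ := c.exists_eval_le
    refine ⟨P + R + T + 2 * Q + 2, fun u ρ B hu hρ ctx f s hs hf hc => ?_⟩
    have hfc : f ∉ ctx := fun h => absurd (hs.lt_of_mem h).2 (lt_irrefl _)
    have h1 := hP u ρ B hu hρ ctx f (f + 1) s hs.succ hs.two_le (by omega) hfc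
    rw [hs.work f le_rfl, List.append_nil] at h1
    have e1 := hQ u ρ B hu hρ
    have hw' := hs.work f le_rfl
    have hup : update s f [] = s := by rw [← hw', Function.update_eq_self]
    refine (h1.seq (Exec.cases (n := R.eval B + T.eval B + 2 * Q.eval B + 1) ?_)).conv rfl ?_
    · rw [Function.update_self, out]
      rcases h : c.eval u ρ with _ | n
      · simp only [unary_zero, List.head?_nil, hup, if_true]
        exact (hT u ρ B hu hρ ctx f s hs hf hc).mono (by omega)
      · simp only [unary_succ, List.head?_cons, if_neg (Nat.succ_ne_zero n)]
        refine ((exec_clear f _).seq' (hR u ρ B hu hρ ctx f s hs hf hc) ?_).conv rfl ?_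
        · rw [Function.update_idem, hup]
        · rw [Function.update_self, ← unary_succ, unary_length]
          omega
    · simp only [Polynomial.eval_add, Polynomial.eval_mul, Polynomial.eval_ofNat]
      omega
  | loop g ih =>
    obtain ⟨P, hP⟩ := ih
    refine ⟨Polynomial.X * (P + 14) + 4, fun u ρ B hu hρ ctx f s hs hf hc => ?_⟩
    have hs0 := hs.input
    have hs1 := hs.aux
    have hw := hs.work f le_rfl
    have hw' := hs.work (f + 1) (by omega)
    have h := exec_forInput (f := f) (p := g.compile ((f + 1) :: ctx) (f + 2))
      (c := P.eval B) hs.two_le u.length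
      (fun i => update s 2 (((List.range i).flatMap fun j => g.out u (j :: ρ)).reverse ++ s 2))
      (by grind [Function.update_apply]) (by grind [Function.update_apply])
      (by grind [Function.update_apply]) (by grind [Function.update_apply])
      (by grind [Function.update_apply]) (by grind [Function.update_apply])
      (fun i hi m => by
        have hs' := (((hs.update_target le_rfl hf hc (((List.range i).flatMap
          fun j => g.out u (j :: ρ)).reverse ++ s 2)).update_work (unary m)).update_work (unary i))
        have hs'' := hP u (i :: ρ) B hu (by
          simp only [List.mem_cons, forall_eq_or_imp]
          exact ⟨by omega, hρ⟩) ((f + 1) :: ctx) (f + 2) _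
          ⟨hs'.two_le, hs'.input, hs'.aux, hs'.work,
            List.Forall₂.cons ⟨⟨by omega, by omega⟩, Function.update_self _ _ _⟩ hs'.vars⟩
          (by omega) (by
            simp only [List.mem_cons, not_or]
            exact ⟨by omega, hc⟩)
        refine hs''.conv ?_ le_rfl
        have hsum : ((List.range (i + 1)).flatMap fun j => g.out u (j :: ρ)).reverse =
            (g.out u (i :: ρ)).reverse ++
              ((List.range i).flatMap fun j => g.out u (j :: ρ)).reverse := by
          rw [List.range_succ, List.flatMap_append, List.reverse_append]
          simp
        rw [hsum]
        clear hP hs' hs''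
        funext x
        grind [Function.update_apply])
    simp only [List.range_zero, List.flatMap_nil, List.reverse_nil, List.nil_append,
      Function.update_eq_self] at h
    refine h.conv rfl ?_
    simp only [Polynomial.eval_add, Polynomial.eval_mul, Polynomial.eval_ofNat,
      Polynomial.eval_X]
    gcongr

end Gen

/-! ### Programs for reductions that change a binary threshold -/

namespace StackProg

open Computability
open Function (update)

/-- The stacks of a reduction: input, binary counters in the stacks `3` and `4`, unary numbers in
the stacks `5` and `6`, and the output in reverse order. -/
def regs (u o d e n m : List Symb) : Stacks
  | 0 => u
  | 2 => o
  | 3 => d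
  | 4 => e
  | 5 => n
  | 6 => m
  | _ => []

theorem word_eq_regs (u : List Symb) : word u = regs u [] [] [] [] [] := by
  funext x
  match x with
  | 0 => rfl
  | 1 => rfl
  | 2 => rfl
  | 3 => rfl
  | 4 => rfl
  | 5 => rfl
  | 6 => rfl
  | _ + 7 => rfl

theorem regs_zero (u o d e n m : List Symb) : regs u o d e n m 0 = u := rfl
theorem regs_two (u o d e n m : List Symb) : regs u o d e n m 2 = o := rfl
theorem regs_three (u o d e n m : List Symb) : regs u o d e n m 3 = d := rfl
theorem regs_four (u o d e n m : List Symb) : regs u o d e n m 4 = e := rfl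
theorem regs_five (u o d e n m : List Symb) : regs u o d e n m 5 = n := rfl
theorem regs_six (u o d e n m : List Symb) : regs u o d e n m 6 = m := rfl

theorem update_regs_zero (u o d e n m l : List Symb) :
    update (regs u o d e n m) 0 l = regs l o d e n m := by
  funext x
  match x with
  | 0 | 1 | 2 | 3 | 4 | 5 | 6 | _ + 7 => rfl

theorem update_regs_two (u o d e n m l : List Symb) :
    update (regs u o d e n m) 2 l = regs u l d e n m := by
  funext x
  match x with
  | 0 | 1 | 2 | 3 | 4 | 5 | 6 | _ + 7 => rfl

theorem update_regs_three (u o d e n m l : List Symb) :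
    update (regs u o d e n m) 3 l = regs u o l e n m := by
  funext x
  match x with
  | 0 | 1 | 2 | 3 | 4 | 5 | 6 | _ + 7 => rfl

theorem update_regs_four (u o d e n m l : List Symb) :
    update (regs u o d e n m) 4 l = regs u o d l n m := by
  funext x
  match x with
  | 0 | 1 | 2 | 3 | 4 | 5 | 6 | _ + 7 => rfl

theorem update_regs_five (u o d e n m l : List Symb) :
    update (regs u o d e n m) 5 l = regs u o d e l m := by
  funext x
  match x with
  | 0 | 1 | 2 | 3 | 4 | 5 | 6 | _ + 7 => rfl

theorem update_regs_six (u o d e n m l : List Symb) :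
    update (regs u o d e n m) 6 l = regs u o d e n l := by
  funext x
  match x with
  | 0 | 1 | 2 | 3 | 4 | 5 | 6 | _ + 7 => rfl

/-- Write the word described by `g`, put the value of `tn` into stack `5` and the number whose
binary digits begin in the input at the position `ts` and end before the last symbol into
stack `3`. -/
def prepare (g : Gen) (tn ts : Term) : StackProg :=
  g.compile [] 5 ;; tn.compile [] 5 6 ;; ts.compile [] 6 7 ;; load

/-- Replace everything by the word that has been written to stack `2` in reverse order. -/
def finish : StackProg := clear 3 ;; clear 4 ;; moveAll 2 0

theorem env_regs {u o d e n m : List Symb} {f : ℕ} (hf : 2 ≤ f)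
    (h : ∀ k, f ≤ k → regs u o d e n m k = []) : Term.Env u [] [] f (regs u o d e n m) :=
  ⟨hf, rfl, rfl, h, List.Forall₂.nil⟩

theorem exists_exec_prepare (g : Gen) (tn ts : Term) : ∃ P : Polynomial ℕ,
    ∀ (u : List Symb) (k : ℕ), u.drop (ts.eval u []) = bits k ++ [none] →
      Exec (prepare g tn ts) (word u)
        (regs [] (g.out u []).reverse (bits k) [] (unary (tn.eval u [])) []) (P.eval u.length) := by
  obtain ⟨P, hP⟩ := g.exists_exec_compile
  obtain ⟨R, hR⟩ := tn.exists_exec_compile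
  obtain ⟨T, hT⟩ := ts.exists_exec_compile
  obtain ⟨Q, hQ⟩ := ts.exists_eval_le
  refine ⟨P + R + T + 3 * Q + 8 * Polynomial.X + 4, fun u k hk => ?_⟩
  have hnil : ∀ v ∈ ([] : List ℕ), v ≤ u.length := by simp
  have h1 := hP u [] u.length le_rfl hnil [] 5 (regs u [] [] [] [] [])
    (env_regs (by omega) fun k hk => by
      match k, hk with
      | 5, _ | 6, _ | _ + 7, _ => rfl) (by omega) (by simp)
  rw [regs_two, List.append_nil, update_regs_two] at h1
  have h2 := hR u [] u.length le_rfl hnil [] 5 6 (regs u (g.out u []).reverse [] [] [] [])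
    (env_regs (by omega) fun k hk => by
      match k, hk with
      | 6, _ | _ + 7, _ => rfl) (by omega) (by omega) (by simp)
  rw [regs_five, List.append_nil, update_regs_five] at h2
  have h3 := hT u [] u.length le_rfl hnil [] 6 7
    (regs u (g.out u []).reverse [] [] (unary (tn.eval u [])) [])
    (env_regs (by omega) fun k hk => by
      match k, hk with
      | _ + 7, _ => rfl) (by omega) (by omega) (by simp)
  rw [regs_six, List.append_nil, update_regs_six] at h3
  have h4 := exec_load (s := regs u (g.out u []).reverse [] [] (unary (tn.eval u []))
    (unary (ts.eval u []))) rfl rfl rfl rfl hk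
  rw [update_regs_six, update_regs_zero, update_regs_three] at h4
  rw [word_eq_regs]
  refine (h1.seq (h2.seq (h3.seq h4))).conv rfl ?_
  have := hQ u [] u.length le_rfl hnil
  rw [regs_zero]
  simp only [Polynomial.eval_add, Polynomial.eval_mul, Polynomial.eval_ofNat, Polynomial.eval_X]
  omega

theorem exec_finish (o d e : List Symb) :
    Exec finish (regs [] o d e [] []) (word o.reverse)
      (2 * d.length + 2 * e.length + 4 * o.length + 3) := by
  refine ((exec_clear 3 _).seq ((exec_clear 4 _).seq (exec_moveAll (k := 2) (l := 0)
    (by omega) _))).conv ?_ ?_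
  · simp only [update_regs_three, update_regs_four, update_regs_two, update_regs_zero, regs_two,
      regs_zero, word_eq_regs, List.append_nil]
  · simp only [update_regs_three, update_regs_four, regs_two, regs_three, regs_four]
    omega

theorem length_bits_mono {m n : ℕ} (h : m ≤ n) : (bits m).length ≤ (bits n).length := by
  rw [length_bits, length_bits]
  exact length_encodeNat_mono h

theorem length_bits_le {u : List Symb} {n k : ℕ} (h : u.drop n = bits k ++ [none]) :
    (bits k).length ≤ u.length := by
  have := congrArg List.length h
  rw [List.length_drop, List.length_append] at this
  omega

theorem exists_exec_prepare_subLoop (g : Gen) (tn ts : Term) : ∃ P : Polynomial ℕ,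
    ∀ (u : List Symb) (k : ℕ), u.drop (ts.eval u []) = bits k ++ [none] →
      Exec (prepare g tn ts ;; subLoop) (word u)
        (regs [] (g.out u []).reverse (bits (k - tn.eval u [])) (bits (tn.eval u [] - k)) [] [])
        (P.eval u.length) := by
  obtain ⟨P, hP⟩ := exists_exec_prepare g tn ts
  obtain ⟨Q, hQ⟩ := tn.exists_eval_le
  refine ⟨P + Q * (7 * (Polynomial.X + Q) + 8) + 1, fun u k hk => ?_⟩
  have hn := hQ u [] u.length le_rfl (by simp)
  have hl := length_bits_le hk
  have h := exec_subLoop (s := regs [] (g.out u []).reverse (bits k) [] (unary (tn.eval u [])) [])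
    rfl rfl rfl rfl
  rw [update_regs_five, update_regs_three, update_regs_four] at h
  refine ((hP u k hk).seq h).conv rfl ?_
  simp only [Polynomial.eval_add, Polynomial.eval_mul, Polynomial.eval_ofNat, Polynomial.eval_X,
    Polynomial.eval_one]
  rw [add_assoc]
  gcongr

theorem exists_exec_prepare_addLoop (g : Gen) (tn ts : Term) : ∃ P : Polynomial ℕ,
    ∀ (u : List Symb) (k : ℕ), u.drop (ts.eval u []) = bits k ++ [none] →
      Exec (prepare g tn ts ;; addLoop) (word u)
        (regs [] (g.out u []).reverse (bits (k + tn.eval u [])) [] [] []) (P.eval u.length) := by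
  obtain ⟨P, hP⟩ := exists_exec_prepare g tn ts
  obtain ⟨Q, hQ⟩ := tn.exists_eval_le
  refine ⟨P + Q * (7 * (Polynomial.X + Q) + 6) + 1, fun u k hk => ?_⟩
  have hn := hQ u [] u.length le_rfl (by simp)
  have hl := length_bits_le hk
  have h := exec_addLoop (s := regs [] (g.out u []).reverse (bits k) [] (unary (tn.eval u [])) [])
    rfl rfl rfl
  rw [update_regs_five, update_regs_three] at h
  refine ((hP u k hk).seq h).conv rfl ?_
  simp only [Polynomial.eval_add, Polynomial.eval_mul, Polynomial.eval_ofNat, Polynomial.eval_X,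
    Polynomial.eval_one]
  rw [add_assoc]
  gcongr

/-- Write the word described by `g` and the integer `n - k` with a sign, where `n` is the value of
`tn` and `k` is the number with the binary digits from position `ts` on. -/
def signedDiffProg (g : Gen) (tn ts : Term) : StackProg :=
  (prepare g tn ts ;; subLoop) ;;
    .cases 3 (fun x => Option.rec (push 2 (some false) ;; moveAll 4 2)
      (fun _ => push 2 (some true) ;; moveAll 3 2) x) ;; push 2 none ;; finish

/-- Write the word described by `g` and a natural number: `k + n` if the value of `tb` is not zero
and otherwise the maximum of `1` and `n - k`, where `n` is the value of `tn` and `k` is the number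
with the binary digits from position `ts` on. -/
def sumOrDiffProg (g : Gen) (tb tn ts : Term) : StackProg :=
  tb.compile [] 5 6 ;; .cases 5 (fun x => Option.rec
    ((prepare g tn ts ;; subLoop) ;;
      .cases 4 (fun y => Option.rec (push 2 (some true)) (fun _ => moveAll 4 2) y))
    (fun _ => clear 5 ;; (prepare g tn ts ;; addLoop) ;; moveAll 3 2) x) ;; push 2 none ;; finish

theorem exists_exec_signedDiffProg (g : Gen) (tn ts : Term) : ∃ P : Polynomial ℕ,
    ∀ (u : List Symb) (k : ℕ), u.drop (ts.eval u []) = bits k ++ [none] →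
      Exec (signedDiffProg g tn ts) (word u)
        (word (g.out u [] ++ encodeSigned ((tn.eval u [] : ℤ) - k))) (P.eval u.length) := by
  obtain ⟨P, hP⟩ := exists_exec_prepare_subLoop g tn ts
  obtain ⟨Q, hQ⟩ := tn.exists_eval_le
  obtain ⟨S, hS⟩ := g.exists_length_out_le
  refine ⟨P + 14 * (Polynomial.X + Q) + 4 * S + 20, fun u k hk => ?_⟩
  have hn := hQ u [] u.length le_rfl (by simp)
  have hg := hS u [] u.length le_rfl (by simp)
  have hl := length_bits_le hk
  have h := hP u k hk
  set n := tn.eval u []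
  have hl1 : (bits (k - n)).length ≤ u.length :=
    (length_bits_mono (Nat.sub_le k n)).trans hl
  have hl2 : (bits (n - k)).length ≤ Q.eval u.length := by
    have := length_encodeNat_le (n - k)
    rw [length_bits]
    omega
  have key : ∃ d e, d.length ≤ u.length ∧ e.length ≤ Q.eval u.length ∧
      Exec (.cases 3 (fun x => Option.rec (push 2 (some false) ;; moveAll 4 2)
        (fun _ => push 2 (some true) ;; moveAll 3 2) x))
      (regs [] (g.out u []).reverse (bits (k - n)) (bits (n - k)) [] [])
      (regs [] ((encodeSigned ((n : ℤ) - k)).dropLast.reverse ++ (g.out u []).reverse) d e [] [])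
      (4 * (u.length + Q.eval u.length) + 3) := by
    by_cases hkn : k ≤ n
    · have e0 : k - n = 0 := by omega
      have e1 : (encodeSigned ((n : ℤ) - k)).dropLast = some false :: bits (n - k) := by
        rw [encodeSigned, encodeBinary, ← List.cons_append, List.dropLast_concat, bits]
        congr 2
        · simpa using hkn
        · congr 1
          omega
      refine ⟨[], [], by simp, by simp, ?_⟩
      rw [e0, e1]
      refine Exec.cases (n := 4 * (u.length + Q.eval u.length) + 2)
        (((Exec.push 2 (some false) _).seq (exec_moveAll (k := 4) (l := 2) (by omega) _)).conv
          ?_ ?_)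
      · simp [update_regs_two, update_regs_four, regs_two, regs_four]
      · simp only [update_regs_two, regs_four]
        omega
    · obtain ⟨b, t, hb⟩ := List.exists_cons_of_ne_nil (bits_ne_nil (show 0 < k - n by omega))
      have e0 : n - k = 0 := by omega
      have e1 : (encodeSigned ((n : ℤ) - k)).dropLast = some true :: bits (k - n) := by
        rw [encodeSigned, encodeBinary, ← List.cons_append, List.dropLast_concat, bits]
        congr 2
        · simpa using hkn
        · congr 1
          omega
      refine ⟨[], [], by simp, by simp, ?_⟩
      rw [e0, e1]
      refine Exec.cases (n := 4 * (u.length + Q.eval u.length) + 2) ?_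
      rw [regs_three, hb]
      refine (((Exec.push 2 (some true) _).seq (exec_moveAll (k := 3) (l := 2)
        (by omega) _)).conv ?_ ?_)
      · simp [update_regs_two, update_regs_three, regs_two, regs_three]
      · rw [← hb]
        simp only [update_regs_two, regs_three]
        omega
  obtain ⟨d, e, hd, he, hcase⟩ := key
  have e2 : (encodeSigned ((n : ℤ) - k)) = (encodeSigned ((n : ℤ) - k)).dropLast ++ [none] := by
    rw [encodeSigned, encodeBinary, ← List.cons_append, List.dropLast_concat]
  have hlen : ((encodeSigned ((n : ℤ) - k)).dropLast).length ≤ u.length + Q.eval u.length + 1 := by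
    rw [encodeSigned, encodeBinary, ← List.cons_append, List.dropLast_concat]
    have := length_encodeNat_mono (show ((n : ℤ) - k).natAbs ≤ (k - n) + (n - k) by omega)
    have h2 := length_encodeNat_add_le (k - n) (n - k)
    have h3 := length_encodeNat_le (n - k)
    rw [length_bits] at hl1
    simp only at this
    simp only [List.length_cons, List.length_map]
    omega
  have hpush := Exec.push 2 none (regs []
    ((encodeSigned ((n : ℤ) - k)).dropLast.reverse ++ (g.out u []).reverse) d e [] [])
  rw [update_regs_two, regs_two] at hpush
  refine (h.seq (hcase.seq (hpush.seq (exec_finish _ d e)))).conv ?_ ?_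
  · conv_rhs => rw [e2]
    simp
  · simp only [Polynomial.eval_add, Polynomial.eval_mul, Polynomial.eval_ofNat, Polynomial.eval_X,
      List.length_cons, List.length_append, List.length_reverse]
    omega

theorem exists_exec_sumOrDiffProg (g : Gen) (tb tn ts : Term) : ∃ P : Polynomial ℕ,
    ∀ (u : List Symb) (k : ℕ), u.drop (ts.eval u []) = bits k ++ [none] →
      Exec (sumOrDiffProg g tb tn ts) (word u)
        (word (g.out u [] ++ encodeBinary
          (if tb.eval u [] = 0 then max 1 (tn.eval u [] - k) else k + tn.eval u [])))
        (P.eval u.length) := by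
  obtain ⟨P, hP⟩ := exists_exec_prepare_subLoop g tn ts
  obtain ⟨R, hR⟩ := exists_exec_prepare_addLoop g tn ts
  obtain ⟨T, hT⟩ := tb.exists_exec_compile
  obtain ⟨Q, hQ⟩ := tn.exists_eval_le
  obtain ⟨V, hV⟩ := tb.exists_eval_le
  obtain ⟨S, hS⟩ := g.exists_length_out_le
  refine ⟨P + R + T + 2 * V + 14 * (Polynomial.X + Q) + 4 * S + 30, fun u k hk => ?_⟩
  have hn := hQ u [] u.length le_rfl (by simp)
  have hb := hV u [] u.length le_rfl (by simp)
  have hg := hS u [] u.length le_rfl (by simp)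
  have hl := length_bits_le hk
  have h1 := hP u k hk
  have h2 := hR u k hk
  have h3 := hT u [] u.length le_rfl (by simp) [] 5 6 (regs u [] [] [] [] [])
    (env_regs (by omega) fun k hk => by
      match k, hk with
      | 6, _ | _ + 7, _ => rfl) (by omega) (by omega) (by simp)
  rw [regs_five, List.append_nil, update_regs_five] at h3
  set n := tn.eval u []
  set b := tb.eval u []
  set r := (if b = 0 then max 1 (n - k) else k + n) with hr
  have hl1 : (bits (k - n)).length ≤ u.length :=
    (length_bits_mono (Nat.sub_le k n)).trans hl
  have hl2 : (bits (n - k)).length ≤ Q.eval u.length := by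
    have := length_encodeNat_le (n - k)
    rw [length_bits]
    omega
  have hl3 : (bits (k + n)).length ≤ u.length + Q.eval u.length := by
    have := length_encodeNat_add_le k n
    rw [length_bits] at hl ⊢
    omega
  have hlr : (bits r).length ≤ u.length + Q.eval u.length + 1 := by
    have e1 := length_encodeNat_mono (show max 1 (n - k) ≤ (n - k) + 1 by omega)
    have e2 := (length_encodeNat_succ (n - k)).2
    simp only at e1
    rw [length_bits] at hl2 hl3 ⊢
    rw [hr]
    split_ifs <;> omega
  have key : ∃ d e, d.length ≤ u.length ∧ e.length ≤ Q.eval u.length ∧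
      Exec (.cases 5 (fun x => Option.rec
        ((prepare g tn ts ;; subLoop) ;;
          .cases 4 (fun y => Option.rec (push 2 (some true)) (fun _ => moveAll 4 2) y))
        (fun _ => clear 5 ;; (prepare g tn ts ;; addLoop) ;; moveAll 3 2) x))
      (regs u [] [] [] (unary b) [])
      (regs [] ((bits r).reverse ++ (g.out u []).reverse) d e [] [])
      (P.eval u.length + R.eval u.length + 2 * V.eval u.length
        + 4 * (u.length + Q.eval u.length) + 5) := by
    rcases hb0 : b with _ | b'
    · have hr' : r = max 1 (n - k) := by rw [hr, if_pos hb0]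
      rcases Nat.eq_zero_or_pos (n - k) with hnk | hnk
      · refine ⟨bits (k - n), [], hl1, by simp, ?_⟩
        have e1 : r = 1 := by omega
        refine Exec.mono (Exec.cases (n := P.eval u.length + 2) ?_) (by omega)
        rw [unary_zero, ← word_eq_regs, e1]
        refine h1.seq (Exec.cases (n := 1) ?_)
        rw [hnk]
        exact (Exec.push 2 (some true) _).conv (by
          rw [update_regs_two, regs_two]
          rfl) le_rfl
      · refine ⟨bits (k - n), [], hl1, by simp, ?_⟩
        have e1 : r = n - k := by omega
        obtain ⟨c, t, hc⟩ := List.exists_cons_of_ne_nil (bits_ne_nil hnk)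
        refine Exec.mono (Exec.cases (n := P.eval u.length + (4 * Q.eval u.length + 2)) ?_)
          (by omega)
        rw [unary_zero, ← word_eq_regs, e1]
        refine h1.seq (Exec.cases (n := 4 * Q.eval u.length + 1) ?_)
        rw [regs_four, hc]
        refine (exec_moveAll (k := 4) (l := 2) (by omega) _).conv ?_ ?_
        · rw [← hc, update_regs_four, update_regs_two, regs_four, regs_two]
        · rw [← hc, regs_four]
          omega
    · refine ⟨[], [], by simp, by simp, ?_⟩
      have hr' : r = k + n := by rw [hr, if_neg (by omega)]
      refine Exec.mono (Exec.cases (n := (2 * V.eval u.length + 1) + (R.eval u.length +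
        (4 * (u.length + Q.eval u.length) + 1))) ?_) (by omega)
      have e1 := exec_clear 5 (regs u [] [] [] (unary (b' + 1)) [])
      rw [regs_five, update_regs_five, ← word_eq_regs, unary_length] at e1
      refine (e1.mono (by omega)).seq (h2.seq ?_)
      refine (exec_moveAll (k := 3) (l := 2) (by omega) _).conv ?_ ?_
      · rw [update_regs_three, update_regs_two, regs_three, regs_two, hr']
      · rw [regs_three]
        omega
  obtain ⟨d, e, hd, he, hcase⟩ := key
  have hpush := Exec.push 2 none (regs []
    ((bits r).reverse ++ (g.out u []).reverse) d e [] [])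
  rw [update_regs_two, regs_two] at hpush
  rw [word_eq_regs u]
  refine (h3.seq (hcase.seq (hpush.seq (exec_finish _ d e)))).conv ?_ ?_
  · simp [encodeBinary, bits]
  · simp only [Polynomial.eval_add, Polynomial.eval_mul, Polynomial.eval_ofNat, Polynomial.eval_X,
      List.length_cons, List.length_append, List.length_reverse]
    omega

end StackProg

/-! ### Parsing the input with terms -/

namespace Term

variable {u : List Symb} {ρ : List ℕ}

/-- A term holds if its value is nonzero. -/
def Holds (u : List Symb) (ρ : List ℕ) (t : Term) : Prop := t.eval u ρ ≠ 0

instance (t : Term) : Decidable (t.Holds u ρ) := inferInstanceAs (Decidable (_ ≠ 0))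

/-- The truth value of `a < b`. -/
def lt (a b : Term) : Term := ite (sub b a) one zero

/-- The truth value of `a = b`. -/
def eq (a b : Term) : Term := ite (add (sub a b) (sub b a)) zero one

/-- A term that holds if both terms hold. For disjunctions, `add` serves the purpose. -/
def and (a b : Term) : Term := ite a b zero

/-- A term that holds if the given one does not. -/
def not (a : Term) : Term := ite a zero one

/-- A numeral. -/
def num : ℕ → Term
  | 0 => zero
  | k + 1 => add (num k) one

/-- The sum of the values for all `i` below `b`. In both terms, the variable `0` stands for `i`. -/
def sumTo (b t : Term) : Term := sum (ite (lt (var 0) b) t zero)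

/-- The `i` below `b` for which the term `c` holds, if there is exactly one. -/
def find (b c : Term) : Term := sumTo b (ite c (var 0) zero)

@[simp] theorem eval_add (a b : Term) : (add a b).eval u ρ = a.eval u ρ + b.eval u ρ := rfl

@[simp] theorem eval_sub (a b : Term) : (sub a b).eval u ρ = a.eval u ρ - b.eval u ρ := rfl

@[simp] theorem eval_zero : zero.eval u ρ = 0 := rfl

@[simp] theorem eval_one : one.eval u ρ = 1 := rfl

@[simp] theorem eval_var_zero (a : ℕ) : (var 0).eval u (a :: ρ) = a := rfl

@[simp] theorem eval_var_one (a b : ℕ) : (var 1).eval u (a :: b :: ρ) = b := rfl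

@[simp] theorem eval_var_two (a b c : ℕ) : (var 2).eval u (a :: b :: c :: ρ) = c := rfl

@[simp] theorem eval_call (t a b : Term) :
    (call t a b).eval u ρ = t.eval u [a.eval u ρ, b.eval u ρ] := rfl

@[simp] theorem eval_ite (c a b : Term) :
    (ite c a b).eval u ρ = if c.Holds u ρ then a.eval u ρ else b.eval u ρ :=
  (ite_not _ _ _).symm

@[simp] theorem eval_num (k : ℕ) : (num k).eval u ρ = k := by
  induction k with
  | zero => rfl
  | succ k ih => rw [num, eval_add, ih, eval_one]

@[simp] theorem eval_lt (a b : Term) :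
    (lt a b).eval u ρ = if a.eval u ρ < b.eval u ρ then 1 else 0 := by
  rw [lt, eval_ite]
  exact if_congr (Nat.sub_ne_zero_iff_lt) rfl rfl

@[simp] theorem holds_lt (a b : Term) : (lt a b).Holds u ρ ↔ a.eval u ρ < b.eval u ρ := by
  rw [Holds, eval_lt]
  simp

@[simp] theorem holds_eq (a b : Term) : (eq a b).Holds u ρ ↔ a.eval u ρ = b.eval u ρ := by
  have h : (add (sub a b) (sub b a)).Holds u ρ ↔ a.eval u ρ ≠ b.eval u ρ := by
    rw [Holds, eval_add, eval_sub, eval_sub]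
    omega
  rw [Holds, eq, eval_ite]
  simp [h]

@[simp] theorem holds_and (a b : Term) : (and a b).Holds u ρ ↔ a.Holds u ρ ∧ b.Holds u ρ := by
  rw [Holds, and, eval_ite]
  split_ifs with h
  · simp only [h, true_and]
    rfl
  · simp [h]

@[simp] theorem holds_not (a : Term) : (not a).Holds u ρ ↔ ¬ a.Holds u ρ := by
  rw [Holds, not, eval_ite]
  split_ifs with h <;> simp [h]

@[simp] theorem holds_add (a b : Term) : (add a b).Holds u ρ ↔ a.Holds u ρ ∨ b.Holds u ρ := by
  rw [Holds, eval_add, Holds, Holds]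
  omega

@[simp] theorem holds_sym (x : Symb) (t : Term) :
    (sym x t).Holds u ρ ↔ u[t.eval u ρ]? = some x := by
  rw [Holds, eval]
  simp

theorem eval_sumTo {b t : Term} {n : ℕ} (hb : ∀ i, b.eval u (i :: ρ) = n) (hn : n ≤ u.length) :
    (sumTo b t).eval u ρ = ∑ i : Fin n, t.eval u (i :: ρ) := by
  rw [sumTo, eval, Fin.sum_univ_eq_sum_range (fun i => t.eval u (i :: ρ)) n]
  simp only [eval_ite, holds_lt, eval_var_zero, hb, eval_zero]
  rw [← Finset.sum_filter]
  refine Finset.sum_congr ?_ fun _ _ => rfl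
  ext i
  simp only [Finset.mem_filter, Finset.mem_range]
  omega

theorem holds_sumTo {b t : Term} {n : ℕ} (hb : ∀ i, b.eval u (i :: ρ) = n) (hn : n ≤ u.length) :
    (sumTo b t).Holds u ρ ↔ ∃ i : Fin n, t.Holds u (i :: ρ) := by
  rw [Holds, eval_sumTo hb hn]
  simp [Holds]

theorem eval_find {b c : Term} {n : ℕ} (hb : ∀ i, b.eval u (i :: ρ) = n) (hn : n ≤ u.length)
    (a : Fin n) (hc : ∀ i : Fin n, c.Holds u (i :: ρ) ↔ i = a) : (find b c).eval u ρ = a := by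
  rw [find, eval_sumTo hb hn]
  simp [hc]

/-- The product of two variables, provided that the first of them is at most the length of the
input. -/
def mulVars : Term := sumTo (var 1) (var 2)

/-- The product of two terms, with the same proviso. As `mulVars` has its own variables, the
factors need not be lifted. -/
abbrev mul (a b : Term) : Term := call mulVars a b

theorem eval_mul {a b : Term} (h : a.eval u ρ ≤ u.length) :
    (mul a b).eval u ρ = a.eval u ρ * b.eval u ρ := by
  rw [mul, eval_call, mulVars, eval_sumTo (n := a.eval u ρ) (fun _ => rfl) h]
  simp

/-- The number of separators before the position in the variable `0`. -/
def countBefore : Term := sumTo (var 1) (sym none (var 0))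

/-- The position at which the field with the number in the variable `0` starts. A position is before
the start of field `j` if and only if there are fewer than `j` separators before it, so it suffices
to count such positions. -/
def fieldStartVar : Term := sum (lt (call countBefore (var 0) zero) (var 1))

/-- The position at which a field starts, for a given number of the field. -/
abbrev fieldStart (a : Term) : Term := call fieldStartVar a zero

/-- The number written in a field: the field with number `j` consists of that many symbols and a
separator. -/
def field (a : Term) : Term := sub (sub (fieldStart (add a one)) (fieldStart a)) one

theorem eval_countBefore {p q : ℕ} (hp : p ≤ u.length) :
    countBefore.eval u [p, q] = (u.take p).count none := by
  rw [countBefore, eval_sumTo (n := p) (fun _ => rfl) hp]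
  induction p with
  | zero => simp
  | succ p ih =>
    have hp' : p < u.length := hp
    rw [Fin.sum_univ_castSucc, List.take_add_one, List.count_append]
    refine congrArg₂ (· + ·) (ih hp'.le) ?_
    have h1 : (sym none (var 0)).eval u [((Fin.last p : Fin (p + 1)) : ℕ), p + 1, q] =
        if u[p]? = some none then 1 else 0 := rfl
    rw [h1, List.getElem?_eq_getElem hp', Option.toList_some, List.count_singleton]
    simp

theorem count_encodeIndex (k : ℕ) : (encodeIndex k).count none = 1 := by
  simp [encodeIndex, List.count_replicate]

theorem count_encodeIndices (l : List ℕ) : (encodeIndices l).count none = l.length := by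
  induction l with
  | nil => rfl
  | cons a l ih =>
    rw [encodeIndices, List.flatMap_cons, List.count_append, count_encodeIndex]
    change 1 + (encodeIndices l).count none = _
    rw [ih, List.length_cons, add_comm]

theorem encodeIndices_append (l m : List ℕ) :
    encodeIndices (l ++ m) = encodeIndices l ++ encodeIndices m := List.flatMap_append

/-- As the last symbol is a separator, any shorter prefix has fewer separators. -/
theorem count_take_encodeIndices {l : List ℕ} {p : ℕ} (hp : p < (encodeIndices l).length) :
    ((encodeIndices l).take p).count none < l.length := by
  have h1 : ∃ w, encodeIndices l = w ++ [none] := by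
    rcases List.eq_nil_or_concat l with rfl | ⟨l, a, rfl⟩
    · simp [encodeIndices] at hp
    · refine ⟨encodeIndices l ++ List.replicate a (some true), ?_⟩
      rw [List.concat_eq_append, encodeIndices_append]
      simp [encodeIndices, encodeIndex]
  obtain ⟨w, hw⟩ := h1
  rw [← count_encodeIndices, hw, List.count_append]
  rw [hw, List.length_append, List.length_singleton] at hp
  rw [List.take_append_of_le_length (by omega)]
  have := (List.take_sublist p w).count_le none
  simp
  omega

theorem eval_fieldStart {l : List ℕ} {w : List Symb} (hu : u = encodeIndices l ++ w) {a : Term}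
    (ha : a.eval u ρ = l.length) : (fieldStart a).eval u ρ = (encodeIndices l).length := by
  have hlen : (encodeIndices l).length ≤ u.length := by
    rw [hu, List.length_append]
    omega
  rw [fieldStart, eval_call, ha]
  change ∑ p ∈ Finset.range u.length, (lt (call countBefore (var 0) zero) (var 1)).eval u
    [p, l.length, 0] = _
  rw [Finset.sum_congr rfl (g := fun p => if p < (encodeIndices l).length then 1 else 0)]
  · rw [Finset.sum_boole, Finset.range_eq_Ico, Finset.Ico_filter_lt, min_eq_right hlen]
    simp
  · intro p hp
    have hp := Finset.mem_range.1 hp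
    rw [eval_lt, eval_call, eval_var_zero, eval_countBefore hp.le, eval_var_one]
    refine if_congr ?_ rfl rfl
    constructor
    · intro h
      by_contra! hle
      rw [hu, List.take_append, List.take_of_length_le hle, List.count_append,
        count_encodeIndices] at h
      omega
    · intro h
      rw [hu, List.take_append_of_le_length h.le]
      exact count_take_encodeIndices h

/-- A word that starts with the fields of a list. -/
def HasFields (u : List Symb) (l : List ℕ) : Prop := ∃ w, u = encodeIndices l ++ w

theorem eval_field {l : List ℕ} (hu : HasFields u l) {a : Term} {x : ℕ}
    (ha : l[a.eval u ρ]? = some x) : (field a).eval u ρ = x := by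
  obtain ⟨w, hw⟩ := hu
  obtain ⟨h1, h2⟩ := List.getElem?_eq_some_iff.1 ha
  set j := a.eval u ρ with hj
  have e1 : u = encodeIndices (l.take j) ++ (encodeIndices (l.drop j) ++ w) := by
    rw [← List.append_assoc, ← encodeIndices_append, List.take_append_drop, hw]
  have e2 : u = encodeIndices (l.take (j + 1)) ++ (encodeIndices (l.drop (j + 1)) ++ w) := by
    rw [← List.append_assoc, ← encodeIndices_append, List.take_append_drop, hw]
  rw [field, eval_sub, eval_sub, eval_fieldStart e2, eval_fieldStart e1,
    List.take_succ_eq_append_getElem h1, encodeIndices_append, h2]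
  · simp [encodeIndices, encodeIndex]
  · rw [List.length_take, ← hj]
    omega
  · rw [List.length_take, eval_add, ← hj, eval_one]
    omega

theorem HasFields.lt_length {l : List ℕ} (hu : HasFields u l) {a : ℕ} (ha : a ∈ l) :
    a < u.length := by
  obtain ⟨w, rfl⟩ := hu
  obtain ⟨s, t, rfl⟩ := List.append_of_mem ha
  rw [encodeIndices_append]
  simp [encodeIndices, encodeIndex]
  omega

theorem getElem?_flatMap_of_length {α β : Type*} {f : α → List β} {k : ℕ}
    {l : List α} (hf : ∀ a ∈ l, (f a).length = k) {i j : ℕ} (hi : i < l.length) (hj : j < k) :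
    (l.flatMap f)[i * k + j]? = (f l[i])[j]? := by
  induction l generalizing i with
  | nil => simp at hi
  | cons a l ih =>
    have ha := hf a List.mem_cons_self
    rw [List.flatMap_cons]
    cases i with
    | zero => rw [zero_mul, zero_add, List.getElem?_append_left (by omega)]; rfl
    | succ i =>
      have e : (i + 1) * k + j = (f a).length + (i * k + j) := by rw [ha]; ring
      rw [e, List.getElem?_append_right (Nat.le_add_right _ _), Nat.add_sub_cancel_left,
        ih (fun a h => hf a (List.mem_cons_of_mem _ h)) (by simpa using hi)]
      rfl

end Term

namespace Gen

open Term

variable {u : List Symb} {ρ : List ℕ}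

/-- The concatenation of the words for all `i` below `b`. In the term and in the generator, the
variable `0` stands for `i`. -/
def loopTo (b : Term) (g : Gen) : Gen := loop (ite (lt (var 0) b) g nil)

theorem out_nil : nil.out u ρ = [] := rfl

theorem out_ite (c : Term) (g h : Gen) :
    (ite c g h).out u ρ = if c.Holds u ρ then g.out u ρ else h.out u ρ :=
  (ite_not _ _ _).symm

theorem out_loopTo {b : Term} {g : Gen} {n : ℕ} (hb : ∀ i, b.eval u (i :: ρ) = n)
    (hn : n ≤ u.length) :
    (loopTo b g).out u ρ = (List.finRange n).flatMap fun i : Fin n => g.out u ((i : ℕ) :: ρ) := by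
  obtain ⟨k, hk⟩ := Nat.exists_eq_add_of_le hn
  rw [loopTo, out, hk, List.range_add, List.flatMap_append]
  have h1 : ∀ i, ((ite (lt (var 0) b) g nil).out u (i :: ρ)) =
      if i < n then g.out u (i :: ρ) else [] := by
    intro i
    rw [out_ite]
    simp only [holds_lt, eval_var_zero, hb]
    rfl
  simp only [h1]
  have h2 : ((List.range k).map (n + ·)).flatMap
      (fun i => if i < n then g.out u (i :: ρ) else []) = [] := by
    rw [List.flatMap_eq_nil_iff]
    intro i hi
    obtain ⟨j, -, rfl⟩ := List.mem_map.1 hi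
    rw [if_neg (by omega)]
  rw [h2, List.append_nil, ← List.map_coe_finRange_eq_range, List.flatMap_map]
  refine List.flatMap_congr fun i _ => ?_
  rw [if_pos i.2]

end Gen

/-! ### The Cayley distance and the number of cycles -/

section Cayley

open Equiv Equiv.Perm

variable {α : Type*}

theorem numCycles_conj (σ τ : Perm α) : numCycles (τ * σ * τ⁻¹) = numCycles σ := by
  refine Nat.card_congr (Quotient.congr τ⁻¹ fun x y => ?_)
  exact sameCycle_conj

theorem numCycles_mul_comm (σ τ : Perm α) : numCycles (σ * τ) = numCycles (τ * σ) := by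
  rw [← numCycles_conj (σ * τ) τ, ← mul_assoc, mul_inv_cancel_right]

variable [Fintype α]

theorem numCycles_le_card (σ : Perm α) : numCycles σ ≤ Fintype.card α := by
  rw [← Nat.card_eq_fintype_card]
  exact Nat.card_le_card_of_surjective _ (Quotient.mk_surjective (s := SameCycle.setoid σ))

theorem numCycles_pos [Nonempty α] (σ : Perm α) : 0 < numCycles σ :=
  have : Nonempty (Quotient (SameCycle.setoid σ)) := ⟨⟦Classical.arbitrary α⟧⟩
  Nat.card_pos

theorem numCycles_one : numCycles (1 : Perm α) = Fintype.card α := by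
  rw [← Nat.card_eq_fintype_card]
  refine (Nat.card_congr (Equiv.ofBijective (Quotient.mk (SameCycle.setoid (1 : Perm α)))
    ⟨fun x y h => ?_, Quotient.mk_surjective⟩)).symm
  have h1 : SameCycle (1 : Perm α) x y := Quotient.exact h
  simpa using h1

/-- A function that is constant along a permutation factors through its cycles. -/
theorem eq_of_sameCycle {β : Type*} {σ : Perm α} {f : α → β} (h : ∀ x, f (σ x) = f x) {x y : α}
    (hxy : SameCycle σ x y) : f x = f y := by
  obtain ⟨n, rfl⟩ := hxy.exists_nat_pow_eq
  induction n with
  | zero => rfl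
  | succ n ih =>
    rw [pow_succ', Perm.mul_apply, h]
    exact ih ⟨n, by simp⟩

variable [DecidableEq α]

/-- A transposition joins at most two cycles. -/
theorem numCycles_le_mul_swap (σ : Perm α) (a b : α) :
    numCycles σ ≤ numCycles (σ * swap a b) + 1 := by
  classical
  let q : α → Quotient (SameCycle.setoid σ) := Quotient.mk _
  have hq : ∀ x, q (σ x) = q x := fun x =>
    Quotient.sound (sameCycle_apply_left.2 (SameCycle.refl σ x))
  -- Merging the cycle of `b` into that of `a` gives a function that is constant along
  -- `σ * swap a b`. It takes all cycles of `σ` as values, except possibly the cycle of `b`.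
  let f : α → Quotient (SameCycle.setoid σ) := fun x => if q x = q b then q a else q x
  have hf : ∀ x, f ((σ * swap a b) x) = f x := by
    intro x
    have hfσ : ∀ y, f (σ y) = f y := fun y => by simp only [f, hq]
    have hfab : f a = f b := by
      simp only [f, if_true]
      split_ifs <;> rfl
    rw [Perm.mul_apply, hfσ, swap_apply_def]
    split_ifs with h1 h2
    · rw [h1, hfab]
    · rw [h2, hfab]
    · rfl
  let g : Quotient (SameCycle.setoid (σ * swap a b)) → Quotient (SameCycle.setoid σ) :=
    Quotient.lift f fun x y h => eq_of_sameCycle hf h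
  have hsurj : Function.Surjective (fun x : Option (Quotient (SameCycle.setoid (σ * swap a b))) =>
      x.elim (q b) g) := by
    intro y
    obtain ⟨x, rfl⟩ := Quotient.mk_surjective y
    by_cases hx : q x = q b
    · exact ⟨none, hx.symm⟩
    · exact ⟨some ⟦x⟧, if_neg hx⟩
  have := Nat.card_le_card_of_surjective _ hsurj
  rwa [Finite.card_option] at this

/-- A point that is not fixed can be split off from its cycle by a transposition. -/
theorem numCycles_lt_mul_swap (σ : Perm α) {a : α} (ha : σ a ≠ a) :
    numCycles σ < numCycles (σ * swap a (σ⁻¹ a)) := by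
  classical
  let q : α → Quotient (SameCycle.setoid σ) := Quotient.mk _
  have hq : ∀ x, q (σ x) = q x := fun x =>
    Quotient.sound (sameCycle_apply_left.2 (SameCycle.refl σ x))
  set τ := σ * swap a (σ⁻¹ a) with hτ
  have hτa : τ a = a := by simp [hτ]
  have hf : ∀ x, q (τ x) = q x := by
    intro x
    have hab : q (σ⁻¹ a) = q a := by rw [← hq (σ⁻¹ a)]; simp
    rw [hτ, Perm.mul_apply, hq, swap_apply_def]
    split_ifs with h1 h2
    · rw [h1, hab]
    · rw [h2, hab]
    · rfl
  let g : Quotient (SameCycle.setoid τ) → Quotient (SameCycle.setoid σ) :=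
    Quotient.lift q fun x y h => eq_of_sameCycle hf h
  have hsurj : Function.Surjective g := by
    intro y
    obtain ⟨x, rfl⟩ := Quotient.mk_surjective y
    exact ⟨⟦x⟧, rfl⟩
  refine lt_of_le_of_ne (Nat.card_le_card_of_surjective g hsurj) fun hcard => ha ?_
  have hinj : Function.Injective g :=
    ((Nat.bijective_iff_surjective_and_card g).2 ⟨hsurj, hcard.symm⟩).1
  have h1 : (⟦σ a⟧ : Quotient (SameCycle.setoid τ)) = ⟦a⟧ := hinj (hq a)
  have h2 : SameCycle τ (σ a) a := Quotient.exact h1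
  exact (h2.symm.eq_of_left hτa).symm

/-- A product of `k` transpositions of `n` points has at least `n - k` cycles. -/
theorem card_le_numCycles_add_length (τ : List (Perm α)) (hτ : ∀ t ∈ τ, t.IsSwap) :
    Fintype.card α ≤ numCycles τ.prod + τ.length := by
  induction τ using List.reverseRecOn with
  | nil => simp [numCycles_one]
  | append_singleton τ t ih =>
    obtain ⟨a, b, -, rfl⟩ := hτ t (by simp)
    have h1 := ih fun t ht => hτ t (by simp [ht])
    have h2 := numCycles_le_mul_swap τ.prod a b
    simp only [List.prod_append, List.prod_singleton, List.length_append, List.length_singleton]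
    omega

/-- A permutation of `n` points with `c` cycles is a product of at most `n - c` transpositions. -/
theorem exists_swaps (σ : Perm α) : ∃ τ : List (Perm α), (∀ t ∈ τ, t.IsSwap) ∧
    τ.length + numCycles σ ≤ Fintype.card α ∧ τ.prod = σ := by
  induction h : Fintype.card α - numCycles σ using Nat.strong_induction_on generalizing σ with
  | _ k ih =>
    by_cases hσ : σ = 1
    · exact ⟨[], by simp, by simp [hσ, numCycles_one], hσ.symm⟩
    · obtain ⟨a, ha⟩ : ∃ a, σ a ≠ a := by
        by_contra! hall
        exact hσ (Perm.ext hall)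
      have h1 := numCycles_lt_mul_swap σ ha
      have h2 := numCycles_le_card (σ * swap a (σ⁻¹ a))
      obtain ⟨τ, hτ, hlen, hprod⟩ := ih _ (by omega) (σ * swap a (σ⁻¹ a)) rfl
      refine ⟨τ ++ [swap a (σ⁻¹ a)], ?_, ?_, ?_⟩
      · intro t ht
        rcases List.mem_append.1 ht with ht | ht
        · exact hτ t ht
        · rw [List.mem_singleton.1 ht]
          refine ⟨a, σ⁻¹ a, fun h => ha ?_, rfl⟩
          conv_lhs => rw [h]
          simp
      · simp only [List.length_append, List.length_singleton]
        omega
      · simp [hprod, mul_assoc]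

/-- The Cayley distance is the degree minus the number of cycles of the quotient. -/
theorem cayleyDist_add_numCycles (ρ π : Perm α) :
    cayleyDist ρ π + numCycles (ρ⁻¹ * π) = Fintype.card α := by
  obtain ⟨τ, hτ, hlen, hprod⟩ := exists_swaps (ρ⁻¹ * π)
  have hmem : τ.length ∈ {k | ∃ τ : List (Perm α),
      (∀ t ∈ τ, t.IsSwap) ∧ τ.length = k ∧ ρ * τ.prod = π} :=
    ⟨τ, hτ, rfl, by rw [hprod, mul_inv_cancel_left]⟩
  have h1 : cayleyDist ρ π ≤ τ.length := Nat.sInf_le hmem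
  obtain ⟨τ', hτ', hlen', hprod'⟩ := Nat.sInf_mem ⟨_, hmem⟩
  have h2 := card_le_numCycles_add_length τ' hτ'
  rw [hlen', show τ'.prod = ρ⁻¹ * π by rw [← hprod', inv_mul_cancel_left]] at h2
  change _ ≤ _ + cayleyDist ρ π at h2
  omega

end Cayley

/-! ### Routings of circuits of valency two -/

namespace SwitchingCircuit

open Equiv

variable {V E : Type*} (G : SwitchingCircuit V E)

theorem next_apply (ρ : G.Routing) (e : E) :
    G.next ρ e = ((G.outLabel (G.tgt e)).symm
      (ρ (G.tgt e) (G.inLabel (G.tgt e) ⟨e, rfl⟩))).1 := rfl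

/-- The permutation of the edges that permutes the labels of the incoming edges at each vertex. -/
def edgePerm : G.Routing →* Perm E where
  toFun ρ := (Equiv.sigmaFiberEquiv G.tgt).symm.trans
    ((Equiv.sigmaCongrRight fun v =>
      (G.inLabel v).trans ((ρ v).trans (G.inLabel v).symm)).trans
    (Equiv.sigmaFiberEquiv G.tgt))
  map_one' := by
    ext e
    simp
  map_mul' ρ ρ' := by
    ext e
    have key : ∀ v (x : {e // G.tgt e = v}), (Equiv.sigmaFiberEquiv G.tgt).symm x.1 = ⟨v, x⟩ := by
      rintro v ⟨e, rfl⟩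
      rfl
    simp only [Equiv.trans_apply, Perm.mul_apply, Equiv.sigmaFiberEquiv_apply, key,
      Equiv.sigmaCongrRight_apply]
    simp

theorem edgePerm_apply (ρ : G.Routing) (e : E) :
    G.edgePerm ρ e = ((G.inLabel (G.tgt e)).symm
      (ρ (G.tgt e) (G.inLabel (G.tgt e) ⟨e, rfl⟩))).1 := rfl

theorem edgePerm_apply_of_tgt (ρ : G.Routing) {e : E} {v : V} (h : G.tgt e = v) :
    G.edgePerm ρ e = ((G.inLabel v).symm (ρ v (G.inLabel v ⟨e, h⟩))).1 := by
  subst h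
  rfl

theorem next_apply_of_tgt (ρ : G.Routing) {e : E} {v : V} (h : G.tgt e = v) :
    G.next ρ e = ((G.outLabel v).symm (ρ v (G.inLabel v ⟨e, h⟩))).1 := by
  subst h
  rfl

theorem tgt_edgePerm (ρ : G.Routing) (e : E) : G.tgt (G.edgePerm ρ e) = G.tgt e :=
  ((G.inLabel (G.tgt e)).symm (ρ (G.tgt e) (G.inLabel (G.tgt e) ⟨e, rfl⟩))).2

theorem next_eq_mul (ρ : G.Routing) : G.next ρ = G.next 1 * G.edgePerm ρ := by
  ext e
  rw [Perm.mul_apply, G.next_apply_of_tgt 1 (G.tgt_edgePerm ρ e), next_apply]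
  congr 2
  rw [Pi.one_apply, Perm.one_apply]
  apply (G.inLabel (G.tgt e)).symm.injective
  rw [Equiv.symm_apply_apply]
  rfl

theorem edgePerm_injective : Function.Injective G.edgePerm := by
  intro ρ ρ' h
  funext v
  ext i
  obtain ⟨⟨e, rfl⟩, rfl⟩ := (G.inLabel v).surjective i
  have h1 := DFunLike.congr_fun h e
  rw [edgePerm_apply, edgePerm_apply] at h1
  have h2 := (G.inLabel (G.tgt e)).symm.injective (Subtype.ext h1)
  rw [h2]

variable {G}

/-- The routings that respect a polarisation form a group. -/
def Polarisation.respecting (T : G.Polarisation) : Subgroup G.Routing where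
  carrier := {ρ | T.Respects ρ}
  one_mem' _ _ _ _ := rfl
  mul_mem' {ρ ρ'} h h' x y hxy i := by
    rw [Pi.mul_apply, Pi.mul_apply, Perm.mul_apply, Perm.mul_apply, h' x y hxy, h x y hxy]
  inv_mem' {ρ} h x y hxy i := by
    rw [Pi.inv_apply, Pi.inv_apply, Perm.inv_eq_iff_eq, h x y hxy]
    simp

open Classical in
/-- The routing that reverses the labels at the vertices equivalent to `v` and does nothing
elsewhere. If `v` has valency two, it exchanges the two labels at each of these vertices. -/
noncomputable def Polarisation.flip (T : G.Polarisation) (v : V) : G.Routing :=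
  fun x => if T.r v x then Fin.revPerm else 1

theorem Polarisation.flip_respects (T : G.Polarisation) (v : V) : T.Respects (T.flip v) := by
  intro x y hxy i
  have hiff : T.r v x ↔ T.r v y :=
    ⟨fun h => T.iseqv.trans h hxy, fun h => T.iseqv.trans h (T.iseqv.symm hxy)⟩
  have hval := T.valency_eq hxy
  unfold Polarisation.flip
  by_cases h : T.r v x
  · rw [if_pos h, if_pos (hiff.1 h)]
    ext
    simp only [Fin.revPerm_apply, Fin.val_rev, Fin.val_cast]
    omega
  · rw [if_neg h, if_neg (fun h' => h (hiff.2 h'))]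
    rfl

theorem perm_eq_one_or_revPerm {n : ℕ} (hn : n ≤ 2) (σ : Perm (Fin n)) :
    σ = 1 ∨ (σ = Fin.revPerm ∧ n = 2) := by
  interval_cases n
  · exact Or.inl (Subsingleton.elim _ _)
  · exact Or.inl (Subsingleton.elim _ _)
  · revert σ
    decide

theorem mul_self_eq_one (hG : ∀ v, G.valency v ≤ 2) (ρ : G.Routing) : ρ * ρ = 1 := by
  funext v
  rw [Pi.mul_apply, Pi.one_apply]
  rcases perm_eq_one_or_revPerm (hG v) (ρ v) with h | ⟨h, -⟩
  · rw [h, one_mul]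
  · rw [h]
    ext i
    simp

/-- A routing that respects the polarisation is a product of flips of classes of valency two. -/
theorem Polarisation.respecting_eq_closure [Finite V] (T : G.Polarisation)
    (hG : ∀ v, G.valency v ≤ 2) :
    T.respecting = Subgroup.closure {ρ | ∃ v, G.valency v = 2 ∧ ρ = T.flip v} := by
  classical
  have := Fintype.ofFinite V
  refine le_antisymm (fun ρ hρ => ?_) ?_
  · induction h : (Finset.univ.filter fun v => ρ v ≠ 1).card using Nat.strong_induction_on
      generalizing ρ with
    | _ k ih =>
      by_cases hall : ∀ v, ρ v = 1
      · rw [show ρ = 1 from funext hall]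
        exact Subgroup.one_mem _
      · push Not at hall
        obtain ⟨v, hv⟩ := hall
        have hv2 := (perm_eq_one_or_revPerm (hG v) (ρ v)).resolve_left hv
        have hmem : T.flip v ∈ Subgroup.closure {ρ | ∃ v, G.valency v = 2 ∧ ρ = T.flip v} :=
          Subgroup.subset_closure ⟨v, hv2.2, rfl⟩
        have hclass : ∀ x, T.r v x → ρ x = Fin.revPerm := by
          intro x hx
          have hval := T.valency_eq hx
          ext i
          have := hρ v x hx (Fin.cast hval.symm i)
          rw [Fin.cast_cast, Fin.cast_eq_self, hv2.1] at this
          rw [this]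
          simp only [Fin.val_cast, Fin.revPerm_apply, Fin.val_rev]
          omega
        have hone : ∀ x, T.r v x → (T.flip v * ρ) x = 1 := by
          intro x hx
          rw [Pi.mul_apply, hclass x hx, Polarisation.flip, if_pos hx]
          ext i
          simp
        have hrest : ∀ x, ¬ T.r v x → (T.flip v * ρ) x = ρ x := by
          intro x hx
          rw [Pi.mul_apply, Polarisation.flip, if_neg hx, one_mul]
        have hlt : (Finset.univ.filter fun x => (T.flip v * ρ) x ≠ 1).card < k := by
          rw [← h]
          refine Finset.card_lt_card (Finset.ssubset_iff_of_subset ?_ |>.2 ⟨v, ?_, ?_⟩)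
          · intro x hx
            simp only [Finset.mem_filter, Finset.mem_univ, true_and] at hx ⊢
            by_cases hvx : T.r v x
            · exact absurd (hone x hvx) hx
            · rwa [hrest x hvx] at hx
          · simpa using hv
          · simpa using hone v (T.iseqv.refl v)
        have h3 := ih _ hlt (T.flip v * ρ)
          (T.respecting.mul_mem (T.flip_respects v) hρ) rfl
        exact (Subgroup.mul_mem_cancel_left _ hmem).1 h3
  · rw [Subgroup.closure_le]
    rintro _ ⟨v, -, rfl⟩
    exact T.flip_respects v

/-- The routings that respect the polarisation correspond to the group generated by the edge
permutations of the flips. -/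
theorem Polarisation.exists_equiv_closure [Finite V] (T : G.Polarisation)
    (hG : ∀ v, G.valency v ≤ 2) {S : Set (Perm E)}
    (hS : ∀ g, g ∈ S ↔ ∃ v, G.valency v = 2 ∧ g = G.edgePerm (T.flip v)) :
    (∃ φ : {ρ : G.Routing // T.Respects ρ} ≃ Subgroup.closure S,
      ∀ ρ, (φ ρ : Perm E) = G.edgePerm ρ.1) ∧
    ∀ η ∈ Subgroup.closure S, η * η = 1 := by
  have hmap : T.respecting.map G.edgePerm = Subgroup.closure S := by
    rw [T.respecting_eq_closure hG, MonoidHom.map_closure]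
    congr 1
    ext g
    rw [hS]
    constructor
    · rintro ⟨_, ⟨v, hv, rfl⟩, rfl⟩
      exact ⟨v, hv, rfl⟩
    · rintro ⟨v, hv, rfl⟩
      exact ⟨_, ⟨v, hv, rfl⟩, rfl⟩
  constructor
  · rw [← hmap]
    exact ⟨(T.respecting.equivMapOfInjective _ G.edgePerm_injective).toEquiv, fun ρ => rfl⟩
  · intro η hη
    rw [← hmap] at hη
    obtain ⟨ρ, -, rfl⟩ := hη
    rw [← map_mul, mul_self_eq_one hG, map_one]

end SwitchingCircuit

/-! ### Matching instances -/

/-- In a group of involutions, the distance of `π` from an element is given by the number of cycles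
of the product. -/
theorem cayleyDist_eq_of_mul_self {n : ℕ} {η : Equiv.Perm (Fin n)} (h : η * η = 1)
    (π : Equiv.Perm (Fin n)) : (cayleyDist η π : ℤ) = n - numCycles (π * η) := by
  have h1 := cayleyDist_add_numCycles η π
  rw [inv_eq_of_mul_eq_one_left h, numCycles_mul_comm, Fintype.card_fin] at h1
  omega

theorem subgroupDist_le_iff {n : ℕ} (H : Subgroup (Equiv.Perm (Fin n)))
    (π : Equiv.Perm (Fin n)) (d : ℤ) :
    (subgroupDist H π : ℤ) ≤ d ↔ ∃ η ∈ H, (cayleyDist η π : ℤ) ≤ d := by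
  have hne : ((fun η => cayleyDist η π) '' (H : Set (Equiv.Perm (Fin n)))).Nonempty :=
    ⟨_, 1, H.one_mem, rfl⟩
  constructor
  · intro h
    obtain ⟨η, hη, he⟩ := Nat.sInf_mem hne
    refine ⟨η, hη, ?_⟩
    change cayleyDist η π = subgroupDist H π at he
    rwa [he]
  · rintro ⟨η, hη, h⟩
    refine le_trans ?_ h
    have h1 : subgroupDist H π ≤ cayleyDist η π := Nat.sInf_le ⟨η, hη, rfl⟩
    exact_mod_cast h1

/-- A correspondence between routings and group elements that preserves the number of cycles also
relates the distances to the numbers of cycles. -/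
theorem RoutingInstance.matches_of_equiv {I : RoutingInstance} {J : SubgroupDistanceInstance}
    (φ : {ρ : I.G.Routing // I.T.Respects ρ} ≃ J.H)
    (hφ : ∀ ρ, numCycles (I.G.next ρ.1) = numCycles (J.π * (φ ρ : Equiv.Perm (Fin J.n))))
    (hJ : ∀ η ∈ J.H, η * η = 1) : I.Matches J := by
  refine ⟨⟨φ, hφ⟩, fun d => ?_⟩
  rw [subgroupDist_le_iff]
  constructor
  · rintro ⟨η, hη, h⟩
    rw [cayleyDist_eq_of_mul_self (hJ η hη)] at h
    refine ⟨(φ.symm ⟨η, hη⟩).1, (φ.symm ⟨η, hη⟩).2, ?_⟩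
    rw [hφ, Equiv.apply_symm_apply]
    change _ ≤ (numCycles (J.π * η) : ℤ)
    omega
  · rintro ⟨ρ, hρ, h⟩
    have h1 := hφ ⟨ρ, hρ⟩
    refine ⟨(φ ⟨ρ, hρ⟩).1, (φ ⟨ρ, hρ⟩).2, ?_⟩
    rw [cayleyDist_eq_of_mul_self (hJ _ (φ ⟨ρ, hρ⟩).2), ← h1]
    change _ - (numCycles (I.G.next ρ) : ℤ) ≤ d
    omega

/-- If the thresholds correspond to each other, there are equally many solutions. -/
theorem nonempty_solution_equiv {I : RoutingInstance} {J : SubgroupDistanceInstance}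
    (hIJ : I.Matches J) (hJ : ∀ η ∈ J.H, η * η = 1)
    (hK : ∀ c : ℕ, 0 < c → (I.K ≤ c ↔ (J.n : ℤ) - c ≤ J.K)) :
    Nonempty (polarisedMaximalRouting.Solution I ≃ subgroupDistance.Solution J) := by
  obtain ⟨⟨φ, hφ⟩, -⟩ := hIJ
  have : Nonempty (Fin J.n) := ⟨⟨0, J.n_pos⟩⟩
  refine ⟨(Equiv.subtypeSubtypeEquivSubtypeInter I.T.Respects
    (fun ρ => I.K ≤ numCycles (I.G.next ρ))).symm.trans ((φ.subtypeEquiv fun ρ => ?_).trans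
    (Equiv.subtypeSubtypeEquivSubtypeInter (fun η => η ∈ J.H)
      (fun η => (cayleyDist η J.π : ℤ) ≤ J.K)))⟩
  rw [cayleyDist_eq_of_mul_self (hJ _ (φ ρ).2), ← hφ, hK]
  rw [hφ]
  exact numCycles_pos _

/-! ### Products of disjoint transpositions -/

section Involutions

open Equiv Equiv.Perm

variable {α : Type*} [DecidableEq α]

/-- The points of a list of pairs. -/
abbrev pairPoints (r : List (α × α)) : List α := r.flatMap fun p => [p.1, p.2]

/-- The product of the transpositions that exchange the points of the pairs. -/
abbrev pairProd (r : List (α × α)) : Perm α := (r.map fun p => swap p.1 p.2).prod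

theorem pairProd_apply_of_notMem {r : List (α × α)} {x : α} (hx : x ∉ pairPoints r) :
    pairProd r x = x := by
  induction r with
  | nil => rfl
  | cons p r ih =>
    simp only [pairPoints, List.flatMap_cons, List.mem_append, List.mem_cons, List.not_mem_nil,
      or_false, not_or] at hx
    simp only [pairProd, List.map_cons, List.prod_cons, Perm.mul_apply]
    rw [ih hx.2, swap_apply_of_ne_of_ne hx.1.1 hx.1.2]

theorem pairProd_apply_of_mem {r : List (α × α)} (hr : (pairPoints r).Nodup) {p : α × α}
    (hp : p ∈ r) : pairProd r p.1 = p.2 ∧ pairProd r p.2 = p.1 := by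
  induction r with
  | nil => simp at hp
  | cons q r ih =>
    simp only [pairPoints, List.flatMap_cons] at hr
    obtain ⟨h1, h2, h3⟩ := List.nodup_append'.1 hr
    simp only [pairProd, List.map_cons, List.prod_cons, Perm.mul_apply]
    rcases List.mem_cons.1 hp with rfl | hp
    · have hn1 : p.1 ∉ pairPoints r := fun h => h3 (by simp) h
      have hn2 : p.2 ∉ pairPoints r := fun h => h3 (by simp) h
      have e1 := pairProd_apply_of_notMem hn1
      have e2 := pairProd_apply_of_notMem hn2
      exact ⟨by rw [e1, swap_apply_left], by rw [e2, swap_apply_right]⟩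
    · obtain ⟨e1, e2⟩ := ih h2 hp
      have hm1 : p.1 ∈ pairPoints r := List.mem_flatMap.2 ⟨p, hp, by simp⟩
      have hm2 : p.2 ∈ pairPoints r := List.mem_flatMap.2 ⟨p, hp, by simp⟩
      have key : ∀ x ∈ pairPoints r, swap q.1 q.2 x = x := fun x hx =>
        swap_apply_of_ne_of_ne (fun h => h3 (a := x) (by simp [h]) hx)
          (fun h => h3 (a := x) (by simp [h]) hx)
      exact ⟨by rw [e1, key _ hm2], by rw [e2, key _ hm1]⟩

theorem pairProd_mul_self {r : List (α × α)} (hr : (pairPoints r).Nodup) :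
    pairProd r * pairProd r = 1 := by
  ext x
  rw [Perm.mul_apply, Perm.one_apply]
  by_cases hx : x ∈ pairPoints r
  · obtain ⟨p, hp, hxp⟩ := List.mem_flatMap.1 hx
    obtain ⟨e1, e2⟩ := pairProd_apply_of_mem hr hp
    simp only [List.mem_cons, List.not_mem_nil, or_false] at hxp
    rcases hxp with rfl | rfl
    · rw [e1, e2]
    · rw [e2, e1]
  · rw [pairProd_apply_of_notMem hx, pairProd_apply_of_notMem hx]

/-- A list of nontrivial involutions no two of which move the same point. -/
structure IsDisjointInvolutions (γ : List (Perm α)) : Prop where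
  mul_self : ∀ g ∈ γ, g * g = 1
  ne_one : ∀ g ∈ γ, g ≠ 1
  disjoint : γ.Pairwise Perm.Disjoint

theorem IsIDS.isDisjointInvolutions {γ : List (Perm α)} (h : IsIDS γ) :
    IsDisjointInvolutions γ := by
  obtain ⟨c, rfl, hne, hnd⟩ := h
  change (pairPoints c.flatten).Nodup at hnd
  have hflat : pairPoints c.flatten = c.flatMap pairPoints := by
    clear hnd hne
    induction c with
    | nil => rfl
    | cons r c ih => rw [List.flatten_cons, List.flatMap_cons, ← ih, pairPoints, List.flatMap_append]
  rw [hflat, List.nodup_flatMap] at hnd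
  refine ⟨?_, ?_, ?_⟩
  · intro g hg
    obtain ⟨r, hr, rfl⟩ := List.mem_map.1 hg
    exact pairProd_mul_self (hnd.1 r hr)
  · intro g hg h1
    obtain ⟨r, hr, rfl⟩ := List.mem_map.1 hg
    obtain ⟨p, t, rfl⟩ := List.exists_cons_of_ne_nil (hne r hr)
    have e1 := (pairProd_apply_of_mem (hnd.1 _ hr) (List.mem_cons_self (a := p) (l := t))).1
    have e2 : p.1 = p.2 := by
      rw [← e1]
      exact (DFunLike.congr_fun h1 p.1).symm
    have := hnd.1 _ hr
    simp [pairPoints, e2] at this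
  · rw [List.pairwise_map]
    refine hnd.2.imp fun {r r'} hrr' x => ?_
    by_cases hx : x ∈ pairPoints r
    · exact Or.inr (pairProd_apply_of_notMem fun hx' => hrr' hx hx')
    · exact Or.inl (pairProd_apply_of_notMem hx)

theorem le_foldr_max {l : List ℕ} {a : ℕ} (h : a ∈ l) : a ≤ l.foldr max 0 := by
  induction l with
  | nil => simp at h
  | cons b l ih =>
    rcases List.mem_cons.1 h with rfl | h
    · exact le_max_left _ _
    · exact (ih h).trans (le_max_right _ _)

theorem foldr_max_le {l : List ℕ} {w : ℕ} (h : ∀ a ∈ l, a ≤ w) : l.foldr max 0 ≤ w := by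
  induction l with
  | nil => exact Nat.zero_le w
  | cons b l ih =>
    exact max_le (h b List.mem_cons_self) (ih fun a ha => h a (List.mem_cons_of_mem _ ha))

theorem two_mul_count_cycleType_le [Fintype α] (g : Perm α) :
    2 * g.cycleType.count 2 ≤ g.support.card := by
  rw [← sum_cycleType, mul_comm, ← smul_eq_mul, ← Multiset.sum_replicate]
  obtain ⟨s, hs⟩ := Multiset.le_iff_exists_add.1 (Multiset.le_count_iff_replicate_le.1
    (le_refl (g.cycleType.count 2)))
  conv_rhs => rw [hs]
  rw [Multiset.sum_add]
  exact Nat.le_add_right _ _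

theorem two_mul_count_cycleType_of_mul_self [Fintype α] {g : Perm α} (h : g * g = 1) :
    2 * g.cycleType.count 2 = g.support.card := by
  have h1 : ∀ c ∈ g.cycleType, c = 2 :=
    (pow_prime_eq_one_iff (p := 2)).1 (by rw [pow_two, h])
  rw [← sum_cycleType, Multiset.eq_replicate_card.2 h1]
  simp [mul_comm]

end Involutions

/-! ### From circuits to involutions with disjoint support -/

namespace RoutingInstance

open Equiv SwitchingCircuit

variable {m n : ℕ} (G : SwitchingCircuit (Fin m) (Fin n)) (T : G.Polarisation)

open Classical in
/-- The least vertices of the classes of valency two. -/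
noncomputable def representatives : List (Fin m) :=
  (List.finRange m).filter fun v => decide (G.valency v = 2 ∧ ∀ x < v, ¬ T.r v x)

theorem mem_representatives {v : Fin m} :
    v ∈ representatives G T ↔ G.valency v = 2 ∧ ∀ x < v, ¬ T.r v x := by
  simp [representatives]

/-- The edge permutations of the flips of the classes of valency two. -/
noncomputable def flips : List (Perm (Fin n)) :=
  (representatives G T).map fun v => G.edgePerm (T.flip v)

theorem flip_eq_of_rel {T : G.Polarisation} {x y : Fin m} (h : T.r x y) : T.flip x = T.flip y := by
  funext z
  have : T.r x z ↔ T.r y z :=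
    ⟨fun h' => T.iseqv.trans (T.iseqv.symm h) h', fun h' => T.iseqv.trans h h'⟩
  by_cases hz : T.r x z
  · rw [Polarisation.flip, Polarisation.flip, if_pos hz, if_pos (this.1 hz)]
  · rw [Polarisation.flip, Polarisation.flip, if_neg hz, if_neg (mt this.2 hz)]

theorem mem_flips {g : Perm (Fin n)} :
    g ∈ flips G T ↔ ∃ v, G.valency v = 2 ∧ g = G.edgePerm (T.flip v) := by
  classical
  simp only [flips, List.mem_map, mem_representatives]
  constructor
  · rintro ⟨v, hv, rfl⟩
    exact ⟨v, hv.1, rfl⟩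
  · rintro ⟨v, hv, rfl⟩
    obtain ⟨x, hx, hmin⟩ := WellFounded.has_min (wellFounded_lt (α := Fin m)) {x | T.r v x}
      ⟨v, T.iseqv.refl v⟩
    refine ⟨x, ⟨by rw [← T.valency_eq hx, hv], fun y hy hxy =>
      hmin y (T.iseqv.trans hx hxy) hy⟩, ?_⟩
    rw [flip_eq_of_rel G hx]

/-- The edge into `x` with the label `k`, and `d` if there is no such edge. -/
def inEdge (d : Fin n) (x : Fin m) (k : ℕ) : Fin n :=
  if h : k < G.valency x then ((G.inLabel x).symm ⟨k, h⟩).1 else d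

theorem tgt_inEdge (d : Fin n) {x : Fin m} {k : ℕ} (h : k < G.valency x) :
    G.tgt (inEdge G d x k) = x := by
  rw [inEdge, dif_pos h]
  exact ((G.inLabel x).symm ⟨k, h⟩).2

theorem inLabel_inEdge (d : Fin n) {x : Fin m} {k : ℕ} (h : k < G.valency x) :
    G.inLabel x ⟨inEdge G d x k, tgt_inEdge G d h⟩ = ⟨k, h⟩ := by
  have : (⟨inEdge G d x k, tgt_inEdge G d h⟩ : {e // G.tgt e = x}) = (G.inLabel x).symm ⟨k, h⟩ :=
    Subtype.ext (by simp only [inEdge, dif_pos h])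
  rw [this, Equiv.apply_symm_apply]

theorem inEdge_inLabel (d e : Fin n) {x : Fin m} (h : G.tgt e = x) :
    inEdge G d x (G.inLabel x ⟨e, h⟩) = e := by
  rw [inEdge, dif_pos (G.inLabel x ⟨e, h⟩).2]
  simp

theorem inEdge_ne (d : Fin n) {x : Fin m} (h : G.valency x = 2) :
    inEdge G d x 0 ≠ inEdge G d x 1 := by
  intro h'
  have h0 := inLabel_inEdge G d (x := x) (k := 0) (by omega)
  have h1 := inLabel_inEdge G d (x := x) (k := 1) (by omega)
  simp only [h'] at h0
  rw [h1] at h0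
  simp at h0

/-- The edge permutation of a flip exchanges the two edges into a vertex of the class. -/
theorem edgePerm_flip_inEdge (d : Fin n) {v x : Fin m} (hx : T.r v x) (h2 : G.valency x = 2)
    {k : ℕ} (hk : k < 2) :
    G.edgePerm (T.flip v) (inEdge G d x k) = inEdge G d x (1 - k) := by
  rw [G.edgePerm_apply_of_tgt _ (tgt_inEdge G d (by omega)), inLabel_inEdge G d (by omega)]
  have h3 : 1 - k < G.valency x := by omega
  conv_rhs => rw [inEdge, dif_pos h3]
  congr 2
  rw [Polarisation.flip, if_pos hx]
  ext
  simp only [Fin.revPerm_apply, Fin.val_rev]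
  omega

theorem edgePerm_flip_of_not_rel {v : Fin m} {e : Fin n} (h : ¬ T.r v (G.tgt e)) :
    G.edgePerm (T.flip v) e = e := by
  rw [edgePerm_apply, Polarisation.flip, if_neg h]
  simp

/-- At a vertex of the class, the edge permutation of a flip takes an edge to the other edge into
the vertex. -/
theorem edgePerm_flip_ne {v : Fin m} {e : Fin n} (he : T.r v (G.tgt e))
    (h2 : G.valency (G.tgt e) = 2) :
    G.tgt (G.edgePerm (T.flip v) e) = G.tgt e ∧ G.edgePerm (T.flip v) e ≠ e := by
  refine ⟨G.tgt_edgePerm _ e, fun h => ?_⟩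
  have h1 := congrArg (G.inLabel (G.tgt e)) (a₁ := ⟨G.edgePerm (T.flip v) e, G.tgt_edgePerm _ e⟩)
    (Subtype.ext h : _ = ⟨e, rfl⟩)
  have h3 : (⟨G.edgePerm (T.flip v) e, G.tgt_edgePerm _ e⟩ : {e' // G.tgt e' = G.tgt e}) =
      (G.inLabel (G.tgt e)).symm (T.flip v (G.tgt e) (G.inLabel (G.tgt e) ⟨e, rfl⟩)) := rfl
  rw [h3, Equiv.apply_symm_apply, Polarisation.flip, if_pos he] at h1
  have h4 := congrArg Fin.val h1
  simp only [Fin.revPerm_apply, Fin.val_rev] at h4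
  omega

theorem exists_eq_inEdge (d e : Fin n) (h2 : G.valency (G.tgt e) = 2) :
    ∃ k < 2, e = inEdge G d (G.tgt e) k :=
  ⟨G.inLabel (G.tgt e) ⟨e, rfl⟩, h2 ▸ (G.inLabel (G.tgt e) ⟨e, rfl⟩).2,
    (inEdge_inLabel G d e rfl).symm⟩

open Classical in
/-- The pairs of edges into the vertices of the class of `v`. -/
noncomputable def flipPairs (d : Fin n) (v : Fin m) : List (Fin n × Fin n) :=
  ((List.finRange m).filter fun x => decide (T.r v x)).map
    fun x => (inEdge G d x 0, inEdge G d x 1)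

theorem nodup_inEdges (d : Fin n) {l : List (Fin m)} (hl : l.Nodup)
    (h2 : ∀ x ∈ l, G.valency x = 2) :
    (l.flatMap fun x => [inEdge G d x 0, inEdge G d x 1]).Nodup := by
  have htgt : ∀ x ∈ l, ∀ e ∈ [inEdge G d x 0, inEdge G d x 1], G.tgt e = x := by
    intro x hx e he
    have := h2 x hx
    simp only [List.mem_cons, List.not_mem_nil, or_false] at he
    rcases he with rfl | rfl
    · exact tgt_inEdge G d (by omega)
    · exact tgt_inEdge G d (by omega)
  refine List.nodup_flatMap.2 ⟨fun x hx => ?_, ?_⟩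
  · simpa using inEdge_ne G d (h2 x hx)
  · refine hl.imp_of_mem fun {x y} hx hy hxy e he he' => hxy ?_
    rw [← htgt x hx e he, htgt y hy e he']

open Classical in
theorem pairPoints_flipPairs (d : Fin n) (v : Fin m) : pairPoints (flipPairs G T d v) =
    ((List.finRange m).filter fun x => decide (T.r v x)).flatMap
      fun x => [inEdge G d x 0, inEdge G d x 1] := by
  rw [pairPoints, flipPairs, List.flatMap_map]

theorem pairProd_flipPairs (d : Fin n) {v : Fin m} (hv : G.valency v = 2) :
    pairProd (flipPairs G T d v) = G.edgePerm (T.flip v) := by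
  classical
  have h2 : ∀ x, T.r v x → G.valency x = 2 := fun x hx => by rw [← T.valency_eq hx, hv]
  have hnd : (pairPoints (flipPairs G T d v)).Nodup := by
    rw [pairPoints_flipPairs]
    refine nodup_inEdges G d ((List.nodup_finRange m).filter _) fun x hx => h2 x ?_
    simpa using hx
  ext1 e
  by_cases he : T.r v (G.tgt e)
  · have hmem : (inEdge G d (G.tgt e) 0, inEdge G d (G.tgt e) 1) ∈ flipPairs G T d v :=
      List.mem_map.2 ⟨G.tgt e, by simpa using he, rfl⟩
    obtain ⟨e1, e2⟩ := pairProd_apply_of_mem hnd hmem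
    obtain ⟨k, hk, hek⟩ := exists_eq_inEdge G d e (h2 _ he)
    have h3 := edgePerm_flip_inEdge G T d he (h2 _ he) hk
    rw [← hek] at h3
    rw [h3]
    interval_cases k
    · rw [hek, tgt_inEdge G d (by have := h2 _ he; omega)]
      exact e1
    · rw [hek, tgt_inEdge G d (by have := h2 _ he; omega)]
      exact e2
  · rw [edgePerm_flip_of_not_rel G T he]
    refine pairProd_apply_of_notMem fun hmem => he ?_
    rw [pairPoints_flipPairs, List.mem_flatMap] at hmem
    obtain ⟨x, hx, hex⟩ := hmem
    have hx' : T.r v x := by simpa using hx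
    have := h2 x hx'
    simp only [List.mem_cons, List.not_mem_nil, or_false] at hex
    rcases hex with rfl | rfl
    · rwa [tgt_inEdge G d (by omega)]
    · rwa [tgt_inEdge G d (by omega)]

/-- The flips are disjoint involutions because an edge has only one target and a vertex lies in only
one class. -/
theorem isIDS_flips : IsIDS (flips G T) := by
  classical
  rcases Nat.eq_zero_or_pos n with rfl | hn
  · have : flips G T = [] := by
      rw [List.eq_nil_iff_forall_not_mem]
      intro g hg
      obtain ⟨v, hv, -⟩ := (mem_flips G T).1 hg
      exact ((G.inLabel v).symm ⟨0, by omega⟩).1.elim0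
    rw [this]
    exact ⟨[], rfl, by simp, by simp⟩
  · let d : Fin n := ⟨0, hn⟩
    refine ⟨(representatives G T).map (flipPairs G T d), ?_, ?_, ?_⟩
    · rw [List.map_map, flips]
      refine List.map_congr_left fun v hv => ?_
      exact (pairProd_flipPairs G T d ((mem_representatives G T).1 hv).1).symm
    · intro r hr
      obtain ⟨v, -, rfl⟩ := List.mem_map.1 hr
      have hmem : (inEdge G d v 0, inEdge G d v 1) ∈ flipPairs G T d v :=
        List.mem_map.2 ⟨v, by simp, rfl⟩
      exact List.ne_nil_of_mem hmem
    · have h1 : ((representatives G T).map (flipPairs G T d)).flatten.flatMap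
          (fun p => [p.1, p.2]) = ((representatives G T).flatMap fun v =>
            (List.finRange m).filter fun x => decide (T.r v x)).flatMap
              fun x => [inEdge G d x 0, inEdge G d x 1] := by
        rw [← List.flatMap_def, List.flatMap_assoc, List.flatMap_assoc]
        refine List.flatMap_congr fun v _ => ?_
        exact pairPoints_flipPairs G T d v
      rw [h1]
      refine nodup_inEdges G d ?_ ?_
      · refine List.nodup_flatMap.2 ⟨fun v _ => (List.nodup_finRange m).filter _, ?_⟩
        have hnd : (representatives G T).Nodup := (List.nodup_finRange m).filter _
        refine hnd.imp_of_mem fun {v v'} hv hv' hne x hx hx' => hne ?_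
        have hvx : T.r v x := by simpa using hx
        have hvx' : T.r v' x := by simpa using hx'
        have hvv' : T.r v v' := T.iseqv.trans hvx (T.iseqv.symm hvx')
        have e1 := ((mem_representatives G T).1 hv).2 v'
        have e2 := ((mem_representatives G T).1 hv').2 v
        exact le_antisymm (not_lt.1 fun h => e1 h hvv')
          (not_lt.1 fun h => e2 h (T.iseqv.symm hvv'))
      · intro x hx
        obtain ⟨v, hv, hvx⟩ := List.mem_flatMap.1 hx
        have hvx' : T.r v x := by simpa using hvx
        rw [← T.valency_eq hvx', ((mem_representatives G T).1 hv).1]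

/-- A flip moves at most two edges for each vertex of the class. -/
theorem idsWidth_flips_le : idsWidth (flips G T) ≤ T.width := by
  classical
  refine foldr_max_le fun a ha => ?_
  obtain ⟨g, hg, rfl⟩ := List.mem_map.1 ha
  obtain ⟨v, hv, rfl⟩ := (mem_flips G T).1 hg
  have h1 := two_mul_count_cycleType_le (G.edgePerm (T.flip v))
  have hrel : ∀ e ∈ (G.edgePerm (T.flip v)).support, T.r v (G.tgt e) := by
    intro e he
    by_contra h
    exact Equiv.Perm.mem_support.1 he (edgePerm_flip_of_not_rel G T h)
  have h2 : (G.edgePerm (T.flip v)).support.card ≤ Nat.card {x // T.r v x} * 2 := by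
    have hlt : ∀ e : (G.edgePerm (T.flip v)).support,
        (G.inLabel (G.tgt e) ⟨e, rfl⟩ : ℕ) < 2 := fun e => by
      have := (G.inLabel (G.tgt e) ⟨e, rfl⟩).2
      have := T.valency_eq (hrel e e.2)
      omega
    have := Nat.card_le_card_of_injective
      (fun e : (G.edgePerm (T.flip v)).support =>
        ((⟨G.tgt e, hrel e e.2⟩, ⟨G.inLabel (G.tgt e) ⟨e, rfl⟩, hlt e⟩) :
          {x // T.r v x} × Fin 2)) (by
        rintro ⟨e, he⟩ ⟨e', he'⟩ h
        simp only [Prod.mk.injEq, Subtype.mk.injEq, Fin.mk.injEq] at h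
        apply Subtype.ext
        change e = e'
        rw [← inEdge_inLabel G e e rfl, ← inEdge_inLabel G e e' rfl, h.2, h.1])
    rwa [Nat.card_prod, Nat.card_eq_fintype_card, Fintype.card_coe, Nat.card_fin] at this
  have h3 : Nat.card {x // T.r v x} ≤ T.width :=
    Finset.le_sup (f := fun x => Nat.card {y // T.r x y}) (Finset.mem_univ v)
  omega

end RoutingInstance

/-- The instance of subgroup distance that belongs to a routing instance: the points are the edges,
`π` is the identity routing, and the generators are the flips. Without edges, the instance has
degree one and no solution. -/
noncomputable def RoutingInstance.toSubgroupDistance (I : RoutingInstance) :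
    SubgroupDistanceInstance :=
  if h : 0 < I.numE then
    { n := I.numE
      n_pos := h
      π := I.G.next 1
      gens := RoutingInstance.flips I.G I.T
      K := (I.numE : ℤ) - I.K }
  else
    { n := 1
      n_pos := one_pos
      π := 1
      gens := []
      K := (I.numE : ℤ) - I.K }

namespace RoutingInstance

theorem isIDS_toSubgroupDistance (I : RoutingInstance) :
    IsIDS I.toSubgroupDistance.gens ∧ idsWidth I.toSubgroupDistance.gens ≤ I.T.width := by
  by_cases h : 0 < I.numE
  · rw [toSubgroupDistance, dif_pos h]
    exact ⟨isIDS_flips I.G I.T, idsWidth_flips_le I.G I.T⟩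
  · rw [toSubgroupDistance, dif_neg h]
    exact ⟨⟨[], rfl, by simp, by simp⟩, Nat.zero_le _⟩

theorem matches_toSubgroupDistance (I : RoutingInstance) (hI : ∀ x, I.G.valency x ≤ 2)
    (h : 0 < I.numE) : I.Matches I.toSubgroupDistance ∧
      Nonempty (polarisedMaximalRouting.Solution I ≃
        subgroupDistance.Solution I.toSubgroupDistance) := by
  obtain ⟨⟨φ, hφ⟩, hinv⟩ := I.T.exists_equiv_closure hI (S := {g | g ∈ flips I.G I.T})
    fun g => mem_flips I.G I.T
  rw [toSubgroupDistance, dif_pos h]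
  have hM := matches_of_equiv (I := I) (J := ⟨I.numE, h, I.G.next 1, flips I.G I.T,
    (I.numE : ℤ) - I.K⟩) φ (fun ρ =>
      congrArg numCycles ((I.G.next_eq_mul ρ.1).trans
        (congrArg (I.G.next 1 * ·) (hφ ρ).symm))) hinv
  refine ⟨hM, nonempty_solution_equiv hM hinv fun c _ => ?_⟩
  change _ ↔ (I.numE : ℤ) - c ≤ (I.numE : ℤ) - I.K
  omega

theorem nonempty_solution_equiv_toSubgroupDistance (I : RoutingInstance)
    (hI : ∀ x, I.G.valency x ≤ 2) :
    Nonempty (polarisedMaximalRouting.Solution I ≃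
      subgroupDistance.Solution I.toSubgroupDistance) := by
  by_cases h : 0 < I.numE
  · exact (I.matches_toSubgroupDistance hI h).2
  · -- There are no cycles and thus no solutions; the threshold on the other side is negative.
    have hE : IsEmpty (Fin I.numE) := by
      rw [Nat.eq_zero_of_not_pos h]
      infer_instance
    have h1 : IsEmpty (polarisedMaximalRouting.Solution I) := by
      constructor
      rintro ⟨ρ, -, hρ⟩
      have h2 := numCycles_le_card (I.G.next ρ)
      have h3 := I.K_pos
      rw [Fintype.card_fin] at h2
      omega
    have h2 : IsEmpty (subgroupDistance.Solution I.toSubgroupDistance) := by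
      constructor
      rintro ⟨η, -, hη⟩
      have h3 : I.toSubgroupDistance.K = (I.numE : ℤ) - I.K := by
        rw [toSubgroupDistance, dif_neg h]
      have h4 := I.K_pos
      rw [h3] at hη
      omega
    exact ⟨Equiv.equivOfIsEmpty _ _⟩

end RoutingInstance

/-! ### From involutions with disjoint support to circuits -/

section Involutions

open Equiv Equiv.Perm

variable {α : Type*}

theorem IsDisjointInvolutions.tail {g : Perm α} {γ : List (Perm α)}
    (h : IsDisjointInvolutions (g :: γ)) : IsDisjointInvolutions γ :=
  ⟨fun _ hf => h.mul_self _ (List.mem_cons_of_mem _ hf),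
    fun _ hf => h.ne_one _ (List.mem_cons_of_mem _ hf), h.disjoint.of_cons⟩

theorem IsDisjointInvolutions.disjoint_prod {g : Perm α} {γ : List (Perm α)}
    (h : IsDisjointInvolutions (g :: γ)) : Perm.Disjoint g γ.prod :=
  disjoint_prod_right γ fun _ hf => List.rel_of_pairwise_cons h.disjoint hf

theorem IsDisjointInvolutions.prod_mul_self {γ : List (Perm α)} (h : IsDisjointInvolutions γ) :
    γ.prod * γ.prod = 1 := by
  induction γ with
  | nil => rfl
  | cons g γ ih =>
    rw [List.prod_cons, mul_assoc, ← mul_assoc _ g, ← h.disjoint_prod.commute.eq, mul_assoc g,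
      ← mul_assoc, ih h.tail,
      h.mul_self g List.mem_cons_self, mul_one]

theorem IsDisjointInvolutions.prod_prod {γ : List (Perm α)} (h : IsDisjointInvolutions γ) (x : α) :
    γ.prod (γ.prod x) = x := by
  rw [← Perm.mul_apply, h.prod_mul_self, Perm.one_apply]

theorem IsDisjointInvolutions.prod_eq {γ : List (Perm α)} (h : IsDisjointInvolutions γ)
    {g : Perm α} (hg : g ∈ γ) {x : α} (hx : g x ≠ x) : γ.prod x = g x := by
  induction γ with
  | nil => simp at hg
  | cons f γ ih =>
    rw [List.prod_cons, Perm.mul_apply]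
    rcases List.mem_cons.1 hg with rfl | hg
    · rw [(h.disjoint_prod x).resolve_left hx]
    · have h1 := ih h.tail hg
      rw [h1]
      have h2 : Perm.Disjoint f g := List.rel_of_pairwise_cons h.disjoint hg
      refine (h2 (g x)).resolve_right fun h3 => hx (g.injective h3)

theorem exists_mem_apply_ne {γ : List (Perm α)} {x : α} (hx : γ.prod x ≠ x) :
    ∃ g ∈ γ, g x ≠ x := by
  by_contra! h
  apply hx
  clear hx
  induction γ with
  | nil => rfl
  | cons g γ ih =>
    rw [List.prod_cons, Perm.mul_apply, ih fun f hf => h f (List.mem_cons_of_mem _ hf),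
      h g List.mem_cons_self]

theorem IsDisjointInvolutions.eq_of_ne {γ : List (Perm α)} (h : IsDisjointInvolutions γ)
    {f g : Perm α} (hf : f ∈ γ) (hg : g ∈ γ) {x : α} (hfx : f x ≠ x) (hgx : g x ≠ x) : f = g := by
  by_contra hne
  have : Std.Symm (Perm.Disjoint (α := α)) := ⟨fun _ _ h => h.symm⟩
  rcases h.disjoint.forall hf hg hne x with h | h
  · exact hfx h
  · exact hgx h

/-- A point is moved by at most one of the involutions, so the images of a point sum to the image
under the product, apart from copies of the point. -/
theorem IsDisjointInvolutions.add_sum_apply {n : ℕ} {γ : List (Perm (Fin n))}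
    (h : IsDisjointInvolutions γ) (x : Fin n) :
    (x : ℕ) + (γ.map fun g => (g x : ℕ)).sum = γ.prod x + γ.length * x := by
  induction γ with
  | nil => simp
  | cons g γ ih =>
    have ih := ih h.tail
    rw [List.map_cons, List.sum_cons, List.prod_cons, Perm.mul_apply, List.length_cons, add_mul]
    rcases h.disjoint_prod x with h1 | h1
    · have h2 : g (γ.prod x) = γ.prod x := by
        rcases h.disjoint_prod (γ.prod x) with h2 | h2
        · exact h2
        · rw [γ.prod.injective h2, h1]
      rw [h2, h1]
      omega
    · rw [h1] at ih ⊢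
      omega

end Involutions

namespace SwitchingCircuit

open Equiv

section OfInvolution

variable {n : ℕ} (Γ π : Perm (Fin n))

/-- The least element of the orbit of a point. The points are grouped into the
orbits of the involution `Γ`, named by their least elements. -/
def orbitMin (e : Fin n) : Fin n := min e (Γ e)

/-- The position of a point in its orbit. -/
def orbitPos (e : Fin n) : ℕ := if Γ e < e then 1 else 0

/-- The size of the orbit with the least element `v`, and zero if `v` is not least in its orbit. -/
def orbitSize (v : Fin n) : ℕ := if v < Γ v then 2 else if Γ v = v then 1 else 0

variable {Γ}

theorem orbitMin_eq_iff (hΓ : ∀ x, Γ (Γ x) = x) {e e' : Fin n} :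
    orbitMin Γ e' = orbitMin Γ e ↔ e' = e ∨ e' = Γ e := by
  unfold orbitMin
  constructor
  · intro h
    rcases min_choice e (Γ e) with h1 | h1 <;> rcases min_choice e' (Γ e') with h2 | h2 <;>
      rw [h1, h2] at h
    · exact Or.inl h
    · right; rw [← h, hΓ]
    · exact Or.inr h
    · exact Or.inl (Γ.injective h)
  · rintro (rfl | rfl)
    · rfl
    · rw [hΓ, min_comm]

theorem orbitPos_lt (hΓ : ∀ x, Γ (Γ x) = x) (e : Fin n) :
    orbitPos Γ e < orbitSize Γ (orbitMin Γ e) := by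
  unfold orbitPos orbitSize orbitMin
  rcases lt_trichotomy (Γ e) e with h | h | h
  · rw [min_eq_right h.le, hΓ, if_pos h, if_pos h]
    omega
  · simp [h]
  · rw [min_eq_left h.le, if_pos h, if_neg h.not_gt]
    omega

theorem orbit_ext (hΓ : ∀ x, Γ (Γ x) = x) {e e' : Fin n} (h : orbitMin Γ e' = orbitMin Γ e)
    (h' : orbitPos Γ e' = orbitPos Γ e) : e' = e := by
  rcases (orbitMin_eq_iff hΓ).1 h with h | rfl
  · exact h
  · unfold orbitPos at h'
    rw [hΓ] at h'
    by_contra hne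
    rcases lt_or_gt_of_ne hne with h1 | h1
    · rw [if_neg h1.not_gt, if_pos h1] at h'
      omega
    · rw [if_neg h1.not_gt, if_pos h1] at h'
      omega

/-- A point of an orbit is given by its position. -/
noncomputable def orbitEquiv (hΓ : ∀ x, Γ (Γ x) = x) (v : Fin n) :
    {e // orbitMin Γ e = v} ≃ Fin (orbitSize Γ v) :=
  Equiv.ofBijective (fun e => ⟨orbitPos Γ e.1,
    (orbitPos_lt hΓ e.1).trans_eq (congrArg (orbitSize Γ) e.2)⟩) <| by
    constructor
    · rintro ⟨e, he⟩ ⟨e', he'⟩ h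
      exact Subtype.ext (orbit_ext hΓ (he.trans he'.symm) (Fin.mk.inj_iff.1 h))
    · rintro ⟨i, hi⟩
      unfold orbitSize at hi
      by_cases h : v < Γ v
      · rw [if_pos h] at hi
        interval_cases i
        · exact ⟨⟨v, min_eq_left h.le⟩, Fin.ext (if_neg h.not_gt)⟩
        · refine ⟨⟨Γ v, ?_⟩, Fin.ext (if_pos ?_)⟩
          · rw [orbitMin, hΓ, min_eq_right h.le]
          · change Γ (Γ v) < Γ v
            rwa [hΓ]
      · rw [if_neg h] at hi
        by_cases h' : Γ v = v
        · rw [if_pos h'] at hi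
          interval_cases i
          exact ⟨⟨v, by rw [orbitMin, h', min_self]⟩, Fin.ext (if_neg h'.not_lt)⟩
        · rw [if_neg h'] at hi
          omega

/-- The circuit whose vertices are the orbits of `Γ`, where the points of an orbit are the edges
into it and their images under `π` the edges out of it. A vertex that is not least in its orbit is
isolated. -/
noncomputable def ofInvolution (hΓ : ∀ x, Γ (Γ x) = x) (π : Perm (Fin n)) :
    SwitchingCircuit (Fin n) (Fin n) where
  src e := orbitMin Γ (π.symm e)
  tgt e := orbitMin Γ e
  valency v := orbitSize Γ v
  outLabel v := (π.symm.subtypeEquiv fun _ => Iff.rfl).trans (orbitEquiv hΓ v)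
  inLabel v := orbitEquiv hΓ v

theorem ofInvolution_valency_le (hΓ : ∀ x, Γ (Γ x) = x) (v : Fin n) :
    (ofInvolution hΓ π).valency v ≤ 2 := by
  change orbitSize Γ v ≤ 2
  unfold orbitSize
  split_ifs <;> omega

theorem ofInvolution_valency_eq_two (hΓ : ∀ x, Γ (Γ x) = x) (v : Fin n) :
    (ofInvolution hΓ π).valency v = 2 ↔ v < Γ v := by
  change orbitSize Γ v = 2 ↔ _
  unfold orbitSize
  split_ifs with h <;> simp [h]

theorem next_one_ofInvolution (hΓ : ∀ x, Γ (Γ x) = x) : (ofInvolution hΓ π).next 1 = π := by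
  ext1 e
  rw [next_apply]
  change ((π.symm.subtypeEquiv fun _ => Iff.rfl).symm ((orbitEquiv hΓ (orbitMin Γ e)).symm
    (orbitEquiv hΓ (orbitMin Γ e) ⟨e, rfl⟩))).1 = π e
  rw [Equiv.symm_apply_apply]
  rfl

theorem edgeData_ofInvolution (hΓ : ∀ x, Γ (Γ x) = x) (e : Fin n) :
    RoutingInstance.edgeData (ofInvolution hΓ π) e =
      [(orbitMin Γ (π.symm e) : ℕ), orbitPos Γ (π.symm e), (orbitMin Γ e : ℕ), orbitPos Γ e] :=
  rfl

end OfInvolution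

section Polarisation

variable {n : ℕ} {γ : List (Perm (Fin n))} (π : Perm (Fin n))

theorem _root_.IsDisjointInvolutions.exists_mem_lt (hγ : IsDisjointInvolutions γ) {v : Fin n}
    (h : v < γ.prod v) : ∃ g ∈ γ, v < g v := by
  obtain ⟨g, hg, hgv⟩ := exists_mem_apply_ne h.ne'
  exact ⟨g, hg, by rwa [← hγ.prod_eq hg hgv]⟩

/-- The circuit of a list of involutions with disjoint support. -/
noncomputable abbrev ofInvolutions (hγ : IsDisjointInvolutions γ) (π : Perm (Fin n)) :
    SwitchingCircuit (Fin n) (Fin n) :=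
  ofInvolution hγ.prod_prod π

/-- Vertices are equivalent if they are orbits of the same involution in the list. -/
noncomputable def involutionPolarisation (hγ : IsDisjointInvolutions γ) (π : Perm (Fin n)) :
    (ofInvolutions hγ π).Polarisation where
  r x y := x = y ∨ ∃ g ∈ γ, x < g x ∧ y < g y
  iseqv := by
    refine ⟨fun x => Or.inl rfl, ?_, ?_⟩
    · rintro x y (h | ⟨g, hg, h1, h2⟩)
      · exact Or.inl h.symm
      · exact Or.inr ⟨g, hg, h2, h1⟩
    · rintro x y z (rfl | ⟨g, hg, h1, h2⟩) h
      · exact h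
      · rcases h with rfl | ⟨f, hf, h3, h4⟩
        · exact Or.inr ⟨g, hg, h1, h2⟩
        · obtain rfl := hγ.eq_of_ne hg hf h2.ne' h3.ne'
          exact Or.inr ⟨g, hg, h1, h4⟩
  valency_eq := by
    rintro x y (rfl | ⟨g, hg, h1, h2⟩)
    · rfl
    · rw [(ofInvolution_valency_eq_two π hγ.prod_prod x).2 (by rwa [hγ.prod_eq hg h1.ne']),
        (ofInvolution_valency_eq_two π hγ.prod_prod y).2 (by rwa [hγ.prod_eq hg h2.ne'])]

variable (hγ : IsDisjointInvolutions γ)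

theorem involutionPolarisation_rel_iff {g : Perm (Fin n)} (hg : g ∈ γ) {v : Fin n} (hv : v < g v)
    (x : Fin n) : (involutionPolarisation hγ π).r v x ↔ x < g x := by
  constructor
  · rintro (rfl | ⟨f, hf, h1, h2⟩)
    · exact hv
    · rwa [hγ.eq_of_ne hg hf hv.ne' h1.ne']
  · exact fun h => Or.inr ⟨g, hg, hv, h⟩

theorem edgePerm_flip_ofInvolutions {g : Perm (Fin n)} (hg : g ∈ γ) {v : Fin n} (hv : v < g v) :
    (ofInvolutions hγ π).edgePerm ((involutionPolarisation hγ π).flip v) = g := by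
  have hgg : ∀ x, g (g x) = x := fun x => by
    rw [← Perm.mul_apply, hγ.mul_self g hg, Perm.one_apply]
  ext1 e
  by_cases he : (involutionPolarisation hγ π).r v ((ofInvolutions hγ π).tgt e)
  · have h1 := (involutionPolarisation_rel_iff π hγ hg hv _).1 he
    have h2 : (ofInvolutions hγ π).valency ((ofInvolutions hγ π).tgt e) = 2 :=
      (ofInvolution_valency_eq_two π hγ.prod_prod _).2 (by rwa [hγ.prod_eq hg h1.ne'])
    obtain ⟨h3, h4⟩ := RoutingInstance.edgePerm_flip_ne _ _ he h2
    -- The edge goes to the other element of its orbit.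
    have h5 := ((orbitMin_eq_iff hγ.prod_prod).1 h3).resolve_left h4
    rw [h5]
    change min e (γ.prod e) < g (min e (γ.prod e)) at h1
    rcases min_choice e (γ.prod e) with h | h
    · rw [h] at h1
      exact hγ.prod_eq hg h1.ne'
    · rw [h] at h1
      have h6 := hγ.prod_eq hg h1.ne'
      rw [hγ.prod_prod] at h6
      conv_rhs => rw [h6, hgg]
  · -- A point moved by `g` would lie in an orbit of the class of `v`.
    rw [RoutingInstance.edgePerm_flip_of_not_rel _ _ he]
    by_contra hne
    have hne : g e ≠ e := fun h => hne h.symm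
    apply he
    rw [involutionPolarisation_rel_iff π hγ hg hv]
    change min e (γ.prod e) < g (min e (γ.prod e))
    rw [hγ.prod_eq hg hne]
    rcases lt_or_gt_of_ne hne with h | h
    · rw [min_eq_right h.le, hgg]
      exact h
    · rw [min_eq_left h.le]
      exact h

/-- The involutions in the list are the flips of the classes of valency two. -/
theorem mem_involutions_iff (g : Perm (Fin n)) :
    g ∈ γ ↔ ∃ v, (ofInvolutions hγ π).valency v = 2 ∧
      g = (ofInvolutions hγ π).edgePerm ((involutionPolarisation hγ π).flip v) := by
  constructor
  · intro hg
    have hne := hγ.ne_one g hg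
    obtain ⟨v, hv⟩ : ∃ v, v < g v := by
      by_contra! h
      refine hne (Perm.ext fun x => (h x).antisymm ?_)
      have := h (g x)
      rwa [← Perm.mul_apply, hγ.mul_self g hg, Perm.one_apply] at this
    refine ⟨v, (ofInvolution_valency_eq_two π _ v).2 ?_,
      (edgePerm_flip_ofInvolutions π hγ hg hv).symm⟩
    rwa [hγ.prod_eq hg hv.ne']
  · rintro ⟨v, hv, rfl⟩
    obtain ⟨g, hg, hgv⟩ := hγ.exists_mem_lt ((ofInvolution_valency_eq_two π _ v).1 hv)
    rwa [edgePerm_flip_ofInvolutions π hγ hg hgv]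

/-- The class of the orbits of an involution has as many members as the involution has 2-cycles; all
other classes are singletons, which is where `1 ≤ w` is needed. -/
theorem width_involutionPolarisation_le {w : ℕ} (hw : 1 ≤ w) (h : idsWidth γ ≤ w) :
    (involutionPolarisation hγ π).width ≤ w := by
  refine Finset.sup_le fun v _ => ?_
  by_cases hv : ∃ g ∈ γ, v < g v
  · obtain ⟨g, hg, hgv⟩ := hv
    have hgg : ∀ x, g (g x) = x := fun x => by
      rw [← Perm.mul_apply, hγ.mul_self g hg, Perm.one_apply]
    have h1 := two_mul_count_cycleType_of_mul_self (hγ.mul_self g hg)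
    have h2 : g.cycleType.count 2 ≤ idsWidth γ := le_foldr_max (List.mem_map_of_mem hg)
    set A := Finset.univ.filter fun x => x < g x
    have h3 : Nat.card {y // (involutionPolarisation hγ π).r v y} = A.card := by
      rw [Nat.subtype_card A]
      intro x
      rw [involutionPolarisation_rel_iff π hγ hg hgv]
      simp [A]
    have h4 : Disjoint A (A.map g.toEmbedding) := by
      rw [Finset.disjoint_left]
      intro x hx hx'
      obtain ⟨y, hy, rfl⟩ := Finset.mem_map.1 hx'
      simp only [A, Finset.mem_filter, Finset.mem_univ, true_and] at hx hy
      rw [Equiv.coe_toEmbedding, hgg] at hx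
      exact hx.not_gt hy
    have h5 : A ∪ A.map g.toEmbedding ⊆ g.support := by
      intro x hx
      rw [Perm.mem_support]
      rcases Finset.mem_union.1 hx with hx | hx
      · simp only [A, Finset.mem_filter, Finset.mem_univ, true_and] at hx
        exact hx.ne'
      · obtain ⟨y, hy, rfl⟩ := Finset.mem_map.1 hx
        simp only [A, Finset.mem_filter, Finset.mem_univ, true_and] at hy
        rw [Equiv.coe_toEmbedding, hgg]
        exact hy.ne
    have h6 := Finset.card_le_card h5
    rw [Finset.card_union_of_disjoint h4, Finset.card_map] at h6
    rw [h3]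
    omega
  · have : Subsingleton {y // (involutionPolarisation hγ π).r v y} := by
      have key : ∀ y, (involutionPolarisation hγ π).r v y → v = y := by
        rintro y (h | ⟨g, hg, h1, -⟩)
        · exact h
        · exact absurd ⟨g, hg, h1⟩ hv
      exact ⟨fun a b => Subtype.ext ((key a a.2).symm.trans (key b b.2))⟩
    exact (Finite.card_le_one_iff_subsingleton.2 this).trans hw

end Polarisation

end SwitchingCircuit

/-- The routing instance that belongs to an instance of subgroup distance with involutions as
generators. The threshold has to be positive, which makes no difference to the solutions as every
routing has a cycle. -/
noncomputable def SubgroupDistanceInstance.toRouting (J : SubgroupDistanceInstance)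
    (hJ : IsDisjointInvolutions J.gens) : RoutingInstance where
  numV := J.n
  numE := J.n
  G := SwitchingCircuit.ofInvolutions hJ J.π
  T := SwitchingCircuit.involutionPolarisation hJ J.π
  K := max 1 ((J.n : ℤ) - J.K).toNat
  K_pos := lt_max_of_lt_left one_pos

theorem SubgroupDistanceInstance.toRouting_spec (J : SubgroupDistanceInstance)
    (hJ : IsDisjointInvolutions J.gens) :
    (J.toRouting hJ).Matches J ∧ Nonempty (subgroupDistance.Solution J ≃
      polarisedMaximalRouting.Solution (J.toRouting hJ)) := by
  obtain ⟨⟨φ, hφ⟩, hinv⟩ := (SwitchingCircuit.involutionPolarisation hJ J.π).exists_equiv_closure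
    (SwitchingCircuit.ofInvolution_valency_le J.π hJ.prod_prod) (S := {g | g ∈ J.gens})
    (SwitchingCircuit.mem_involutions_iff J.π hJ)
  have hM := RoutingInstance.matches_of_equiv (I := J.toRouting hJ) (J := J) φ (fun ρ =>
    congrArg numCycles ((SwitchingCircuit.next_eq_mul _ ρ.1).trans
      (congrArg₂ (· * ·) (SwitchingCircuit.next_one_ofInvolution J.π hJ.prod_prod)
        (hφ ρ).symm))) hinv
  refine ⟨hM, (nonempty_solution_equiv hM hinv fun c hc => ?_).map Equiv.symm⟩
  change max 1 ((J.n : ℤ) - J.K).toNat ≤ c ↔ _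
  omega

/-! ### Generating the instance of subgroup distance -/

namespace SwitchingCircuit

variable {V E : Type*} (G : SwitchingCircuit V E)

theorem outLabel_val {e : E} {v : V} (h : G.src e = v) :
    (G.outLabel v ⟨e, h⟩ : ℕ) = G.outLabel (G.src e) ⟨e, rfl⟩ := by
  subst h
  rfl

theorem inLabel_val {e : E} {v : V} (h : G.tgt e = v) :
    (G.inLabel v ⟨e, h⟩ : ℕ) = G.inLabel (G.tgt e) ⟨e, rfl⟩ := by
  subst h
  rfl

theorem eq_next_one_iff {e e' : E} : e' = G.next 1 e ↔ G.src e' = G.tgt e ∧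
    (G.outLabel (G.src e') ⟨e', rfl⟩ : ℕ) = G.inLabel (G.tgt e) ⟨e, rfl⟩ := by
  rw [next_apply, Pi.one_apply, Equiv.Perm.one_apply]
  constructor
  · rintro rfl
    have h := ((G.outLabel (G.tgt e)).symm (G.inLabel (G.tgt e) ⟨e, rfl⟩)).2
    refine ⟨h, ?_⟩
    rw [← G.outLabel_val h, Subtype.coe_eta, Equiv.apply_symm_apply]
  · rintro ⟨h, h'⟩
    rw [← G.outLabel_val h] at h'
    rw [← Fin.ext h', Equiv.symm_apply_apply]

theorem valency_eq_two_iff {v : V} (hv : G.valency v ≤ 2) : G.valency v = 2 ↔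
    ∃ e, G.tgt e = v ∧ (G.inLabel (G.tgt e) ⟨e, rfl⟩ : ℕ) = 1 := by
  constructor
  · intro h
    obtain ⟨⟨e, he⟩, he'⟩ := (G.inLabel v).surjective ⟨1, by omega⟩
    exact ⟨e, he, by rw [← G.inLabel_val he, he']⟩
  · rintro ⟨e, rfl, he⟩
    have := (G.inLabel (G.tgt e) ⟨e, rfl⟩).2
    omega

end SwitchingCircuit

namespace RoutingInstance

open SwitchingCircuit Term

/-- There are only two edges into a vertex of valency two. -/
theorem eq_edgePerm_flip_iff {m n : ℕ} {G : SwitchingCircuit (Fin m) (Fin n)} {T : G.Polarisation}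
    {v : Fin m} {e e' : Fin n} (he : T.r v (G.tgt e)) (h2 : G.valency (G.tgt e) = 2) :
    e' = G.edgePerm (T.flip v) e ↔ G.tgt e' = G.tgt e ∧ e' ≠ e := by
  constructor
  · rintro rfl
    exact edgePerm_flip_ne G T he h2
  · rintro ⟨h, hne⟩
    obtain ⟨h', hne'⟩ := edgePerm_flip_ne G T he h2
    obtain ⟨i, hi, ei⟩ := exists_eq_inEdge G e e h2
    obtain ⟨j, hj, ej⟩ := exists_eq_inEdge G e e' (by rwa [h])
    obtain ⟨k, hk, ek⟩ := exists_eq_inEdge G e (G.edgePerm (T.flip v) e) (by rwa [h'])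
    rw [h] at ej
    rw [h'] at ek
    have hij : i ≠ j := fun hij => hne (by rw [ej, ← hij, ← ei])
    have hik : i ≠ k := fun hik => hne' (by rw [ek, ← hik, ← ei])
    rw [ej, ek, show j = k by omega]

/-- The numbers at the beginning of an encoded routing instance. -/
def fields (I : RoutingInstance) : List ℕ :=
  I.numV :: I.numE :: (List.finRange I.numE).flatMap (edgeData I.G)

theorem encode_eq (I : RoutingInstance) : I.encode =
    encodeIndices I.fields ++ (relMatrix I.T.r ++ encodeBinary I.K) := by
  simp [encode, fields, encodeIndices]

theorem hasFields_encode (I : RoutingInstance) : HasFields I.encode I.fields := ⟨_, I.encode_eq⟩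

theorem length_fields (I : RoutingInstance) : I.fields.length = 2 + 4 * I.numE := by
  simp [fields, List.length_flatMap, edgeData]
  ring

theorem numV_lt (I : RoutingInstance) : I.numV < I.encode.length :=
  I.hasFields_encode.lt_length (List.mem_cons_self)

theorem numE_lt (I : RoutingInstance) : I.numE < I.encode.length :=
  I.hasFields_encode.lt_length (List.mem_cons_of_mem _ List.mem_cons_self)

theorem length_relMatrix {m : ℕ} (r : Fin m → Fin m → Prop) : (relMatrix r).length = m * m := by
  simp [relMatrix, List.length_flatMap]

open Classical in
theorem relMatrix_getElem? {m : ℕ} (r : Fin m → Fin m → Prop) (x y : Fin m) :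
    (relMatrix r)[(x : ℕ) * m + y]? = some (some (decide (r x y))) := by
  rw [relMatrix, getElem?_flatMap_of_length (k := m) (by simp) (by simp) y.2]
  simp

/-- The number of vertices of an encoded routing instance. -/
def numVTerm : Term := field zero

/-- The number of edges of an encoded routing instance. -/
def numETerm : Term := field one

/-- The entry with the number `k` of the data of the edge `e` (source, label at the source, target,
label at the target); these data follow two other numbers. -/
def edgeField (k : ℕ) (e : Term) : Term := field (add (mul e (num 4)) (num (k + 2)))

abbrev srcTerm (e : Term) : Term := edgeField 0 e

abbrev outLabelTerm (e : Term) : Term := edgeField 1 e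

abbrev tgtTerm (e : Term) : Term := edgeField 2 e

abbrev inLabelTerm (e : Term) : Term := edgeField 3 e

/-- The position at which the matrix of the equivalence relation starts. -/
def matrixStart : Term := fieldStart (add (num 2) (mul numETerm (num 4)))

/-- The entry of this matrix for the vertices `x` and `y`. -/
def relTerm (x y : Term) : Term :=
  sym (some true) (add matrixStart (add (mul x numVTerm) y))

/-- The edge that follows the edge in the variable `0` in the identity routing. -/
def nextTerm : Term :=
  find numETerm (and (eq (srcTerm (var 0)) (tgtTerm (var 1)))
    (eq (outLabelTerm (var 0)) (inLabelTerm (var 1))))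

/-- The vertex in the variable `0` has valency two and is the least vertex of its class. -/
def isRepresentative : Term :=
  and (sumTo numETerm (and (eq (tgtTerm (var 0)) (var 1)) (eq (inLabelTerm (var 0)) one)))
    (not (sumTo numVTerm (and (lt (var 0) (var 1)) (relTerm (var 1) (var 0)))))

/-- The image of the edge in the variable `0` under the flip of the class of the vertex in the
variable `1`: the other edge with the same target, if the target is in the class. -/
def flipTerm : Term :=
  .ite (relTerm (var 1) (tgtTerm (var 0)))
    (find numETerm (and (eq (tgtTerm (var 0)) (tgtTerm (var 1))) (not (eq (var 0) (var 1)))))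
    (var 0)

section Eval

variable (I : RoutingInstance) {ρ : List ℕ}

theorem eval_numVTerm : numVTerm.eval I.encode ρ = I.numV :=
  eval_field I.hasFields_encode rfl

theorem eval_numETerm : numETerm.eval I.encode ρ = I.numE :=
  eval_field I.hasFields_encode rfl

theorem eval_edgeField {k : ℕ} (hk : k < 4) {t : Term} {e : Fin I.numE}
    (ht : t.eval I.encode ρ = e) :
    (edgeField k t).eval I.encode ρ = (edgeData I.G e)[k]'hk := by
  have h := I.numE_lt
  refine eval_field I.hasFields_encode ?_
  rw [eval_add, eval_mul (by omega), ht, eval_num, eval_num]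
  change ((List.finRange I.numE).flatMap (edgeData I.G))[(e : ℕ) * 4 + k]? = _
  rw [getElem?_flatMap_of_length (k := 4) (fun _ _ => rfl) (by simp) hk]
  simp [List.getElem?_eq_getElem (l := edgeData I.G e) (i := k) hk]

theorem eval_srcTerm {t : Term} {e : Fin I.numE} (ht : t.eval I.encode ρ = e) :
    (srcTerm t).eval I.encode ρ = I.G.src e :=
  I.eval_edgeField (by omega) ht

theorem eval_outLabelTerm {t : Term} {e : Fin I.numE} (ht : t.eval I.encode ρ = e) :
    (outLabelTerm t).eval I.encode ρ = I.G.outLabel (I.G.src e) ⟨e, rfl⟩ :=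
  I.eval_edgeField (by omega) ht

theorem eval_tgtTerm {t : Term} {e : Fin I.numE} (ht : t.eval I.encode ρ = e) :
    (tgtTerm t).eval I.encode ρ = I.G.tgt e :=
  I.eval_edgeField (by omega) ht

theorem eval_inLabelTerm {t : Term} {e : Fin I.numE} (ht : t.eval I.encode ρ = e) :
    (inLabelTerm t).eval I.encode ρ = I.G.inLabel (I.G.tgt e) ⟨e, rfl⟩ :=
  I.eval_edgeField (by omega) ht

theorem eval_matrixStart :
    matrixStart.eval I.encode ρ = (encodeIndices I.fields).length := by
  have h := I.numE_lt
  refine eval_fieldStart I.encode_eq ?_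
  rw [eval_add, eval_mul (by rw [eval_numETerm]; omega), eval_numETerm, eval_num, eval_num,
    length_fields, mul_comm]

theorem holds_relTerm {a b : Term} {x y : Fin I.numV} (ha : a.eval I.encode ρ = x)
    (hb : b.eval I.encode ρ = y) : (relTerm a b).Holds I.encode ρ ↔ I.T.r x y := by
  classical
  have h := I.numV_lt
  have hlt : (x : ℕ) * I.numV + y < (relMatrix I.T.r).length := by
    rw [length_relMatrix]
    nlinarith [x.2, y.2]
  rw [relTerm, holds_sym, eval_add, eval_add, eval_mul (by omega), eval_matrixStart, eval_numVTerm,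
    ha, hb, encode_eq, List.getElem?_append_right (Nat.le_add_right _ _), Nat.add_sub_cancel_left,
    List.getElem?_append_left hlt, relMatrix_getElem?]
  simp

theorem eval_nextTerm (e : Fin I.numE) :
    nextTerm.eval I.encode ((e : ℕ) :: ρ) = I.G.next 1 e := by
  refine eval_find (fun _ => I.eval_numETerm) I.numE_lt.le _ fun e' => ?_
  rw [eq_next_one_iff, holds_and, holds_eq, holds_eq, I.eval_srcTerm (e := e') rfl,
    I.eval_outLabelTerm (e := e') rfl, I.eval_tgtTerm (e := e) rfl, I.eval_inLabelTerm (e := e) rfl,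
    Fin.val_inj]

theorem holds_isRepresentative (hI : ∀ x, I.G.valency x ≤ 2) (v : Fin I.numV) :
    isRepresentative.Holds I.encode ((v : ℕ) :: ρ) ↔
      I.G.valency v = 2 ∧ ∀ x < v, ¬ I.T.r v x := by
  rw [isRepresentative, holds_and, holds_not,
    holds_sumTo (fun _ => I.eval_numETerm) I.numE_lt.le,
    holds_sumTo (fun _ => I.eval_numVTerm) I.numV_lt.le, I.G.valency_eq_two_iff (hI v)]
  refine and_congr (exists_congr fun e => ?_) ?_
  · rw [holds_and, holds_eq, holds_eq, I.eval_tgtTerm (e := e) rfl, I.eval_inLabelTerm (e := e) rfl,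
      eval_var_one, eval_one, Fin.val_inj]
  · push Not
    refine forall_congr' fun x => ?_
    rw [holds_and, holds_lt, I.holds_relTerm (x := v) (y := x) rfl rfl]
    simp

theorem eval_flipTerm {v : Fin I.numV} (hv : I.G.valency v = 2) (e : Fin I.numE) :
    flipTerm.eval I.encode ((e : ℕ) :: (v : ℕ) :: ρ) = I.G.edgePerm (I.T.flip v) e := by
  rw [flipTerm, eval_ite]
  by_cases h : I.T.r v (I.G.tgt e)
  · rw [if_pos ((I.holds_relTerm rfl (I.eval_tgtTerm rfl)).2 h)]
    refine eval_find (fun _ => I.eval_numETerm) I.numE_lt.le _ fun e' => ?_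
    rw [eq_edgePerm_flip_iff h (by rw [← I.T.valency_eq h, hv]), holds_and, holds_not, holds_eq,
      holds_eq, I.eval_tgtTerm (e := e') rfl, I.eval_tgtTerm (e := e) rfl, eval_var_zero,
      eval_var_one, Fin.val_inj, Fin.val_inj]
  · rw [if_neg (mt (I.holds_relTerm rfl (I.eval_tgtTerm rfl)).1 h), eval_var_zero,
      edgePerm_flip_of_not_rel _ _ h]

end Eval

/-- The degree, which is one if there are no edges. -/
def degreeTerm : Term := .ite numETerm numETerm one

/-- The word of the instance of subgroup distance, up to the threshold. -/
def toSubgroupGen : Gen :=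
  .seq (.index degreeTerm) (.seq (.loopTo degreeTerm (.index nextTerm))
    (.seq (.index (sumTo numVTerm (.ite isRepresentative one zero)))
      (.loopTo numVTerm
        (.ite isRepresentative (.loopTo degreeTerm (.index flipTerm)) .nil))))

theorem encodeIndices_oneLine {n : ℕ} (σ : Equiv.Perm (Fin n)) :
    encodeIndices (SubgroupDistanceInstance.oneLine σ) =
      (List.finRange n).flatMap fun i => encodeIndex (σ i) := List.flatMap_map ..

theorem encodeIndices_flatMap_oneLine {n : ℕ} (γ : List (Equiv.Perm (Fin n))) :
    encodeIndices (γ.flatMap SubgroupDistanceInstance.oneLine) =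
      γ.flatMap fun σ => (List.finRange n).flatMap fun i => encodeIndex (σ i) := by
  rw [encodeIndices, List.flatMap_assoc]
  exact List.flatMap_congr fun σ _ => encodeIndices_oneLine σ

theorem flatMap_filter_eq {α β : Type*} (p : α → Prop) [DecidablePred p] (f : α → List β)
    (l : List α) : (l.filter fun a => decide (p a)).flatMap f =
      l.flatMap fun a => if p a then f a else [] := by
  induction l with
  | nil => rfl
  | cons a l ih =>
    rw [List.filter_cons, List.flatMap_cons, ← ih]
    by_cases h : p a <;> simp [h]

theorem length_filter_finRange {n : ℕ} (p : Fin n → Prop) [DecidablePred p] :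
    ((List.finRange n).filter fun a => decide (p a)).length = ∑ i, if p i then 1 else 0 := by
  have key : ∀ l : List (Fin n), (l.filter fun a => decide (p a)).length =
      (l.map fun i => if p i then 1 else 0).sum := by
    intro l
    induction l with
    | nil => rfl
    | cons a l ih =>
      rw [List.filter_cons, List.map_cons, List.sum_cons, ← ih]
      by_cases h : p a
      · simp [h, add_comm]
      · simp [h]
  rw [key, Fin.sum_univ_def]

theorem length_representatives (I : RoutingInstance) (hI : ∀ x, I.G.valency x ≤ 2) :
    (sumTo numVTerm (.ite isRepresentative one zero)).eval I.encode [] =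
      (representatives I.G I.T).length := by
  classical
  rw [eval_sumTo (fun _ => I.eval_numVTerm) I.numV_lt.le, representatives, length_filter_finRange]
  refine Finset.sum_congr rfl fun v _ => ?_
  rw [eval_ite]
  exact if_congr (I.holds_isRepresentative hI v) rfl rfl

theorem eval_degreeTerm (I : RoutingInstance) {ρ : List ℕ} :
    degreeTerm.eval I.encode ρ = if I.numE = 0 then 1 else I.numE := by
  have h : numETerm.Holds I.encode ρ ↔ ¬ I.numE = 0 := by
    rw [← I.eval_numETerm (ρ := ρ)]
    rfl
  rw [degreeTerm, eval_ite, eval_numETerm, eval_one, ← ite_not (p := I.numE = 0)]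
  exact if_congr h rfl rfl

theorem out_toSubgroupGen (I : RoutingInstance) (hI : ∀ x, I.G.valency x ≤ 2) :
    toSubgroupGen.out I.encode [] ++ encodeSigned ((I.numE : ℤ) - I.K) =
      I.toSubgroupDistance.encode := by
  classical
  simp only [toSubgroupGen, Gen.out, length_representatives I hI]
  rw [Gen.out_loopTo (fun _ => I.eval_numVTerm) I.numV_lt.le]
  simp only [Gen.out_ite, Gen.out_nil, I.holds_isRepresentative hI, List.append_assoc]
  rw [I.eval_degreeTerm]
  by_cases h : 0 < I.numE
  · have hd : ∀ ρ, degreeTerm.eval I.encode ρ = I.numE := fun ρ => by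
      rw [eval_degreeTerm, if_neg h.ne']
    rw [if_neg h.ne', Gen.out_loopTo (fun _ => hd _) I.numE_lt.le, toSubgroupDistance, dif_pos h,
      SubgroupDistanceInstance.encode]
    have h1 : ∀ e : Fin I.numE, (Gen.index nextTerm).out I.encode [(e : ℕ)] =
        encodeIndex (I.G.next 1 e) := fun e => congrArg encodeIndex (I.eval_nextTerm e)
    have h2 : (flips I.G I.T).flatMap (fun σ => (List.finRange I.numE).flatMap fun e =>
        encodeIndex (σ e)) = (List.finRange I.numV).flatMap fun v =>
          if I.G.valency v = 2 ∧ ∀ x < v, ¬ I.T.r v x then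
            (Gen.loopTo degreeTerm (.index flipTerm)).out I.encode [(v : ℕ)]
          else [] := by
      rw [flips, List.flatMap_map, representatives, flatMap_filter_eq]
      refine List.flatMap_congr fun v _ => ?_
      split_ifs with hv
      · rw [Gen.out_loopTo (fun _ => hd _) I.numE_lt.le]
        exact List.flatMap_congr fun e _ => (congrArg encodeIndex (I.eval_flipTerm hv.1 e)).symm
      · rfl
    have h3 : (flips I.G I.T).length = (representatives I.G I.T).length := List.length_map _
    simp only [h1, encodeIndices_oneLine, encodeIndices_flatMap_oneLine, h2, h3]
  · -- Without edges, the generator has to give the word for the trivial permutation of one point.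
    have h0 : I.numE = 0 := by omega
    have hd : ∀ ρ, degreeTerm.eval I.encode ρ = 1 := fun ρ => by
      rw [eval_degreeTerm, if_pos h0]
    have hval : ∀ v, I.G.valency v ≠ 2 := fun v hv => by
      have := ((I.G.inLabel v).symm ⟨0, by omega⟩).1.2
      omega
    have hrep : representatives I.G I.T = [] := by
      rw [List.eq_nil_iff_forall_not_mem]
      exact fun v hv => hval v ((mem_representatives I.G I.T).1 hv).1
    have hnext : nextTerm.eval I.encode [0] = 0 := by
      rw [nextTerm, find, eval_sumTo (n := 0) (fun _ => I.eval_numETerm.trans h0) (Nat.zero_le _)]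
      rfl
    rw [if_pos h0, Gen.out_loopTo (fun _ => hd _) (by have := I.numE_lt; omega),
      toSubgroupDistance, dif_neg h, SubgroupDistanceInstance.encode, hrep]
    have h1 : (Gen.index nextTerm).out I.encode [0] = encodeIndex 0 := congrArg encodeIndex hnext
    have h2 : (List.finRange I.numV).flatMap (fun _ => ([] : List Symb)) = [] :=
      List.flatMap_eq_nil_iff.2 fun _ _ => rfl
    have h3 : List.finRange 1 = [0] := rfl
    simp [hval, h1, h2, h3, SubgroupDistanceInstance.oneLine, encodeIndices]

theorem exists_exec_toSubgroupDistance : ∃ (p : StackProg) (P : Polynomial ℕ),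
    ∀ I : RoutingInstance, (∀ x, I.G.valency x ≤ 2) →
      StackProg.Exec p (StackProg.word I.encode) (StackProg.word I.toSubgroupDistance.encode)
        (P.eval I.encode.length) := by
  obtain ⟨P, hP⟩ := StackProg.exists_exec_signedDiffProg toSubgroupGen numETerm
    (add matrixStart (mul numVTerm numVTerm))
  refine ⟨StackProg.signedDiffProg toSubgroupGen numETerm
    (add matrixStart (mul numVTerm numVTerm)), P, fun I hI => ?_⟩
  have h := hP I.encode I.K ?_
  · rwa [I.eval_numETerm, I.out_toSubgroupGen hI] at h
  · rw [eval_add, I.eval_matrixStart, eval_mul (by rw [eval_numVTerm]; exact I.numV_lt.le),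
      I.eval_numVTerm, encode_eq, ← List.append_assoc, List.drop_left' (by
        rw [List.length_append, length_relMatrix])]
    rfl

end RoutingInstance

/-! ### Generating the routing instance -/

namespace SubgroupDistanceInstance

open SwitchingCircuit Term

/-- The numbers at the beginning of an encoded instance of subgroup distance. -/
def fields (J : SubgroupDistanceInstance) : List ℕ :=
  J.n :: (oneLine J.π ++ J.gens.length :: J.gens.flatMap oneLine)

theorem encode_eq (J : SubgroupDistanceInstance) :
    J.encode = encodeIndices J.fields ++ encodeSigned J.K := by
  simp [encode, fields, encodeIndices]

theorem hasFields_encode (J : SubgroupDistanceInstance) : HasFields J.encode J.fields :=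
  ⟨_, J.encode_eq⟩

theorem length_fields (J : SubgroupDistanceInstance) :
    J.fields.length = J.gens.length * J.n + (J.n + 2) := by
  simp [fields, List.length_flatMap, length_oneLine]
  ring

theorem n_lt (J : SubgroupDistanceInstance) : J.n < J.encode.length :=
  J.hasFields_encode.lt_length List.mem_cons_self

theorem length_gens_lt (J : SubgroupDistanceInstance) : J.gens.length < J.encode.length :=
  J.hasFields_encode.lt_length (by simp [fields])

theorem oneLine_getElem? {n : ℕ} (σ : Equiv.Perm (Fin n)) (x : Fin n) :
    (oneLine σ)[(x : ℕ)]? = some (σ x : ℕ) := by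
  simp [oneLine]

/-- The degree of an encoded instance of subgroup distance. -/
def nTerm : Term := field zero

/-- The image of a point under `π`. -/
def piTerm (x : Term) : Term := field (add x one)

/-- The number of generators. -/
def numGensTerm : Term := field (add nTerm one)

/-- The image of a point under the generator with a given number. -/
def genTerm (j x : Term) : Term := field (add (add (mul j nTerm) x) (add nTerm (num 2)))

/-- The image of the point in the variable `0` under the product of the generators, which is found
with `IsDisjointInvolutions.add_sum_apply`. -/
def prodVar : Term :=
  sub (add (var 0) (sumTo numGensTerm (genTerm (var 0) (var 1)))) (mul numGensTerm (var 0))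

/-- The image of a point under the product of the generators. -/
abbrev prodTerm (x : Term) : Term := call prodVar x zero

/-- The preimage of the point in the variable `0` under `π`. -/
def preimageVar : Term := find nTerm (eq (piTerm (var 0)) (var 1))

/-- The preimage of a point under `π`. -/
abbrev preimageTerm (x : Term) : Term := call preimageVar x zero

/-- The least element of the orbit of a point under the product of the generators. -/
def orbitMinTerm (x : Term) : Term := .ite (lt (prodTerm x) x) (prodTerm x) x

/-- The position of a point in this orbit. -/
def orbitPosTerm (x : Term) : Term := lt (prodTerm x) x

/-- The vertices in the variables `0` and `1` are equivalent. -/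
def equivTerm : Term :=
  add (eq (var 1) (var 0)) (sumTo numGensTerm (and (lt (var 2) (genTerm (var 0) (var 2)))
    (lt (var 1) (genTerm (var 0) (var 1)))))

/-- The position of the sign of the threshold. -/
def signStart : Term := fieldStart (add (mul numGensTerm nTerm) (add nTerm (num 2)))

section Eval

variable (J : SubgroupDistanceInstance) {ρ : List ℕ}

theorem eval_nTerm : nTerm.eval J.encode ρ = J.n :=
  eval_field J.hasFields_encode rfl

theorem eval_piTerm {t : Term} {x : Fin J.n} (ht : t.eval J.encode ρ = x) :
    (piTerm t).eval J.encode ρ = J.π x := by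
  refine eval_field J.hasFields_encode ?_
  rw [eval_add, ht, eval_one, fields, List.getElem?_cons_succ,
    List.getElem?_append_left (by rw [length_oneLine]; exact x.2), oneLine_getElem?]

theorem eval_numGensTerm : numGensTerm.eval J.encode ρ = J.gens.length := by
  refine eval_field J.hasFields_encode ?_
  rw [eval_add, eval_nTerm, eval_one, fields, List.getElem?_cons_succ,
    List.getElem?_append_right (by rw [length_oneLine]), length_oneLine, Nat.sub_self]
  rfl

theorem eval_genTerm {a b : Term} {j : Fin J.gens.length} {x : Fin J.n}
    (ha : a.eval J.encode ρ = j) (hb : b.eval J.encode ρ = x) :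
    (genTerm a b).eval J.encode ρ = J.gens[j] x := by
  have h := J.length_gens_lt
  refine eval_field J.hasFields_encode ?_
  rw [eval_add, eval_add, eval_add, eval_mul (by omega), ha, hb, eval_nTerm, eval_num, fields,
    ← add_assoc, List.getElem?_cons_succ,
    List.getElem?_append_right (by rw [length_oneLine]; omega), length_oneLine]
  have e : (j : ℕ) * J.n + x + J.n + 1 - J.n = (j : ℕ) * J.n + x + 1 := by omega
  rw [e, List.getElem?_cons_succ,
    getElem?_flatMap_of_length (fun σ _ => length_oneLine σ) j.2 x.2, oneLine_getElem?]
  rfl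

theorem eval_prodTerm (hJ : IsDisjointInvolutions J.gens) {t : Term} {x : Fin J.n}
    (ht : t.eval J.encode ρ = x) : (prodTerm t).eval J.encode ρ = J.gens.prod x := by
  have h : ∀ j : Fin J.gens.length,
      (genTerm (var 0) (var 1)).eval J.encode [(j : ℕ), x, 0] = J.gens[j] x :=
    fun j => J.eval_genTerm rfl rfl
  have h1 : (J.gens.map fun g => (g x : ℕ)).sum = ∑ j : Fin J.gens.length, (J.gens[j] x : ℕ) :=
    (Fin.sum_univ_fun_getElem J.gens fun g => (g x : ℕ)).symm
  rw [prodTerm, eval_call, ht, eval_zero, prodVar, eval_sub, eval_add,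
    eval_mul (by rw [eval_numGensTerm]; exact J.length_gens_lt.le),
    eval_sumTo (fun _ => J.eval_numGensTerm) J.length_gens_lt.le, eval_numGensTerm, eval_var_zero]
  simp only [h]
  rw [← h1, hJ.add_sum_apply, Nat.add_sub_cancel]

theorem eval_preimageTerm {t : Term} {x : Fin J.n} (ht : t.eval J.encode ρ = x) :
    (preimageTerm t).eval J.encode ρ = J.π.symm x := by
  rw [preimageTerm, eval_call, ht, preimageVar]
  refine eval_find (fun _ => J.eval_nTerm) J.n_lt.le _ fun y => ?_
  rw [holds_eq, J.eval_piTerm (x := y) rfl, eval_var_one, Fin.val_inj, Equiv.eq_symm_apply]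

theorem eval_orbitMinTerm (hJ : IsDisjointInvolutions J.gens) {t : Term} {x : Fin J.n}
    (ht : t.eval J.encode ρ = x) :
    (orbitMinTerm t).eval J.encode ρ = orbitMin J.gens.prod x := by
  rw [orbitMinTerm, eval_ite, orbitMin, J.eval_prodTerm hJ ht, ht]
  by_cases h : J.gens.prod x < x
  · rw [min_eq_right h.le, if_pos]
    rwa [holds_lt, J.eval_prodTerm hJ ht, ht]
  · rw [min_eq_left (not_lt.1 h), if_neg]
    rwa [holds_lt, J.eval_prodTerm hJ ht, ht]

theorem eval_orbitPosTerm (hJ : IsDisjointInvolutions J.gens) {t : Term} {x : Fin J.n}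
    (ht : t.eval J.encode ρ = x) :
    (orbitPosTerm t).eval J.encode ρ = orbitPos J.gens.prod x := by
  rw [orbitPosTerm, eval_lt, J.eval_prodTerm hJ ht, ht]
  rfl

theorem holds_equivTerm (x y : Fin J.n) (hJ : IsDisjointInvolutions J.gens) :
    equivTerm.Holds J.encode [(y : ℕ), x] ↔ (involutionPolarisation hJ J.π).r x y := by
  rw [equivTerm, holds_add, holds_eq, holds_sumTo (fun _ => J.eval_numGensTerm)
    J.length_gens_lt.le, eval_var_zero, eval_var_one, Fin.val_inj]
  refine or_congr Iff.rfl ?_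
  have h : ∀ j : Fin J.gens.length, ((lt (var 2) (genTerm (var 0) (var 2))).and
      (lt (var 1) (genTerm (var 0) (var 1)))).Holds J.encode [(j : ℕ), y, x] ↔
      x < J.gens[j] x ∧ y < J.gens[j] y := by
    intro j
    rw [holds_and, holds_lt, holds_lt, J.eval_genTerm (j := j) (x := x) rfl rfl,
      J.eval_genTerm (j := j) (x := y) rfl rfl]
    rfl
  simp only [h]
  constructor
  · rintro ⟨j, hj⟩
    exact ⟨J.gens[j], List.getElem_mem _, hj⟩
  · rintro ⟨g, hg, h⟩
    obtain ⟨j, hj, rfl⟩ := List.getElem_of_mem hg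
    exact ⟨⟨j, hj⟩, h⟩

theorem eval_signStart : signStart.eval J.encode ρ = (encodeIndices J.fields).length := by
  refine eval_fieldStart J.encode_eq ?_
  rw [eval_add, eval_mul (by rw [eval_numGensTerm]; exact J.length_gens_lt.le), eval_numGensTerm,
    eval_add, eval_nTerm, eval_num, length_fields]

end Eval

/-- The word of the routing instance, up to the threshold. -/
def toRoutingGen : Gen :=
  .seq (.index nTerm) (.seq (.index nTerm) (.seq
    (.loopTo nTerm (.seq (.index (orbitMinTerm (preimageTerm (var 0))))
      (.seq (.index (orbitPosTerm (preimageTerm (var 0))))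
        (.seq (.index (orbitMinTerm (var 0))) (.index (orbitPosTerm (var 0)))))))
    (.loopTo nTerm (.loopTo nTerm
      (.ite equivTerm (.emit (some true)) (.emit (some false)))))))

theorem out_toRoutingGen (J : SubgroupDistanceInstance) (hJ : IsDisjointInvolutions J.gens) :
    toRoutingGen.out J.encode [] ++ encodeBinary (max 1 ((J.n : ℤ) - J.K).toNat) =
      (J.toRouting hJ).encode := by
  classical
  have h1 : ∀ e : Fin J.n, (Gen.seq (.index (orbitMinTerm (preimageTerm (var 0))))
      (.seq (.index (orbitPosTerm (preimageTerm (var 0))))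
        (.seq (.index (orbitMinTerm (var 0))) (.index (orbitPosTerm (var 0)))))).out J.encode
          [(e : ℕ)] = encodeIndices (RoutingInstance.edgeData (J.toRouting hJ).G e) := by
    intro e
    have h := J.eval_preimageTerm (ρ := [(e : ℕ)]) (t := var 0) (x := e) rfl
    simp only [Gen.out]
    rw [J.eval_orbitMinTerm hJ h, J.eval_orbitPosTerm hJ h, J.eval_orbitMinTerm hJ (x := e) rfl,
      J.eval_orbitPosTerm hJ (x := e) rfl]
    have h2 := edgeData_ofInvolution J.π hJ.prod_prod e
    change _ = encodeIndices (RoutingInstance.edgeData (ofInvolution hJ.prod_prod J.π) e)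
    rw [h2]
    simp [encodeIndices]
  have h2 : ∀ x : Fin J.n, (Gen.loopTo nTerm (.ite equivTerm (.emit (some true))
      (.emit (some false)))).out J.encode [(x : ℕ)] = (List.finRange J.n).map fun y =>
        some (decide ((involutionPolarisation hJ J.π).r x y)) := by
    intro x
    rw [Gen.out_loopTo (fun _ => J.eval_nTerm) J.n_lt.le, List.map_eq_flatMap]
    refine List.flatMap_congr fun y _ => ?_
    rw [Gen.out_ite]
    by_cases h : (involutionPolarisation hJ J.π).r x y
    · rw [if_pos ((J.holds_equivTerm x y hJ).2 h), decide_eq_true h]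
      rfl
    · rw [if_neg (mt (J.holds_equivTerm x y hJ).1 h), decide_eq_false h]
      rfl
  rw [toRoutingGen]
  have h3 : (J.toRouting hJ).encode = encodeIndex J.n ++ (encodeIndex J.n ++
      ((List.finRange J.n).flatMap (fun e => encodeIndices
        (RoutingInstance.edgeData (J.toRouting hJ).G e)) ++
      ((List.finRange J.n).flatMap (fun x => (List.finRange J.n).map fun y =>
        some (decide ((involutionPolarisation hJ J.π).r x y))) ++
      encodeBinary (max 1 ((J.n : ℤ) - J.K).toNat)))) := by
    rw [RoutingInstance.encode, encodeIndices, List.flatMap_assoc]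
    rfl
  have h4 : ∀ g h : Gen, (Gen.seq g h).out J.encode [] = g.out J.encode [] ++ h.out J.encode [] :=
    fun _ _ => rfl
  have h5 : (Gen.index nTerm).out J.encode [] = encodeIndex J.n := congrArg encodeIndex J.eval_nTerm
  rw [h3, h4, h4, h4, h5, Gen.out_loopTo (fun _ => J.eval_nTerm) J.n_lt.le,
    Gen.out_loopTo (fun _ => J.eval_nTerm) J.n_lt.le]
  simp only [h1, h2, List.append_assoc]
  rfl

theorem exists_exec_toRouting : ∃ (p : StackProg) (P : Polynomial ℕ),
    ∀ (J : SubgroupDistanceInstance) (hJ : IsDisjointInvolutions J.gens),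
      StackProg.Exec p (StackProg.word J.encode) (StackProg.word (J.toRouting hJ).encode)
        (P.eval J.encode.length) := by
  obtain ⟨P, hP⟩ := StackProg.exists_exec_sumOrDiffProg toRoutingGen
    (sym (some true) signStart) nTerm (add signStart one)
  refine ⟨StackProg.sumOrDiffProg toRoutingGen (sym (some true) signStart) nTerm
    (add signStart one), P, fun J hJ => ?_⟩
  have h := hP J.encode J.K.natAbs ?_
  · have hK : (if (sym (some true) signStart).eval J.encode [] = 0 then
        max 1 (nTerm.eval J.encode [] - J.K.natAbs) else J.K.natAbs + nTerm.eval J.encode []) =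
          max 1 ((J.n : ℤ) - J.K).toNat := by
      have h1 : (sym (some true) signStart).Holds J.encode [] ↔ J.K < 0 := by
        rw [holds_sym, eval_signStart, encode_eq, List.getElem?_append_right le_rfl, Nat.sub_self]
        simp [encodeSigned]
      rw [eval_nTerm]
      have := J.n_pos
      by_cases h2 : J.K < 0
      · rw [if_neg (h1.2 h2)]
        omega
      · rw [if_pos (not_not.1 (mt h1.1 h2))]
        omega
    rwa [hK, J.out_toRoutingGen hJ] at h
  · rw [eval_add, eval_signStart, eval_one, encode_eq, encodeSigned, List.drop_append,
      List.drop_of_length_le (Nat.le_succ _), Nat.add_sub_cancel_left]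
    rfl

end SubgroupDistanceInstance

theorem theorem7 (w : ℕ) (hw : 1 ≤ w) :
    ∃ (f : (maximalRouting w 2).Instance → (idsSubgroupDistance w).Instance)
      (g : (idsSubgroupDistance w).Instance → (maximalRouting w 2).Instance),
      IsPolyTimeParsimonious (maximalRouting w 2) (idsSubgroupDistance w) f ∧
      IsPolyTimeParsimonious (idsSubgroupDistance w) (maximalRouting w 2) g ∧
      (∀ I : (maximalRouting w 2).Instance, 0 < I.1.numE → I.1.Matches (f I).1) ∧
      (∀ J : (idsSubgroupDistance w).Instance, (g J).1.Matches J.1) := by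
  obtain ⟨p, P, hP⟩ := RoutingInstance.exists_exec_toSubgroupDistance
  obtain ⟨q, Q, hQ⟩ := SubgroupDistanceInstance.exists_exec_toRouting
  refine ⟨fun I => ⟨I.1.toSubgroupDistance, I.1.isIDS_toSubgroupDistance.1,
      I.1.isIDS_toSubgroupDistance.2.trans I.2.1⟩,
    fun J => ⟨J.1.toRouting J.2.1.isDisjointInvolutions,
      SwitchingCircuit.width_involutionPolarisation_le _ _ hw J.2.2,
      SwitchingCircuit.ofInvolution_valency_le _ _⟩, ⟨?_, fun I => ?_⟩, ⟨?_, fun J => ?_⟩,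
    fun I hI => ?_, fun J => ?_⟩
  · exact StackProg.nonempty_computableInPolyTime p P fun I => hP I.1 I.2.2
  · exact I.1.nonempty_solution_equiv_toSubgroupDistance I.2.2
  · exact StackProg.nonempty_computableInPolyTime q Q fun J => hQ J.1 J.2.1.isDisjointInvolutions
  · exact (J.1.toRouting_spec J.2.1.isDisjointInvolutions).2
  · exact (I.1.matches_toSubgroupDistance I.2.2 hI).1
  · exact (J.1.toRouting_spec J.2.1.isDisjointInvolutions).1
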